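/- **Setting.** Let $n\ge 1$. Let $\Gamma$ be a Bieberbach group, that is, a discrete, cocompact, torsion-free subgroup of the isometry group $I(\mathbb R^n)=O(n)\ltimes\mathbb R^n$. Write $\gamma\in\Gamma$ uniquely as $\gamma=BL_b$, i.e. $\gamma x=B(x+b)$, and put $r(\gamma)=B$. Let $F=r(\Gamma)$ be the holonomy group and let $\Lambda\subset\mathbb R^n$ be the translation lattice, $\ker r=\{L_\lambda:\lambda\in\Lambda\}$, so $F\simeq\Lambda\backslash\Gamma$. Put $n_B=\dim\ker(B-\mathrm{Id})$ and $F_1=\{B\in F: n_B=1\}$. $Cl(n)$ is the Clifford algebra of $\mathbb R^n$ with $v^2=-\|v\|^2$, and $\mathrm{Spin}(n)\subset Cl(n)$ is the group of products of an even number of unit vectors. Assume $M_\Gamma=\Gamma\backslash\mathbb R^n$ is spin, with spin structure given by a homomorphism $\varepsilon:\Gamma\to\mathrm{Spin}(n)$ with $\varepsilon(\gamma)v\varepsilon(\gamma)^{-1}=r(\gamma)v$ for all $v\in\mathbb R^n$ (so $F\subset SO(n)$). Let $\rho:\Gamma\to U(V)$ be a finite-dimensional unitary representation, trivial on $\Lambda$,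 with character $\chi_\rho$. Let $m=\lfloor n/2\rfloor$ and let $(L_n,S_n)$ be the spin representation: $S_n$ is an irreducible complex $Cl(n)$-module, with a basis $\delta_I$, $I\subset\{1,\dots,m\}$, such that $e_{2j-1}e_{2j}\delta_I=i\,\delta_I$ if $j\notin I$ and $=-i\,\delta_I$ if $j\in I$. If $n$ is odd, the module is the one in which $e_n\delta_I=-i(-1)^{|I|}\delta_I$. If $n$ is even, the half-spin representations $L_n^{+}$ and $L_n^-$ are the restrictions of $L_n$ to the spans of the $\delta_I$ with $|I|$ even, resp. odd; $L_n^{\pm1}:=L_n^\pm$. Let $D_\rho=\sum_j e_j\,\partial/\partial x_j$ (with $e_j$ acting by $L(e_j)\otimes\mathrm{Id}$) be the twisted Dirac operator on the smooth sections of the spinor bundle with twist $V$, that is, on the smooth $f:\mathbb R^n\to S_n\otimes V$ with $f(\gamma x)=(L_n(\varepsilon(\gamma))\otimes\rho(\gamma))f(x)$ for all $\gamma\in\Gamma$. For $\mu>0$ let $d^\pm_{\rho,\mu}(\Gamma,\varepsilon)$ be the dimension of its eigenspace for $\pm2\pi\mu$, and let $d_{\rho,0}(\Gamma,\varepsilon)=\dim\ker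 D_\rho$. For $\mu>0$ let $\Lambda^*_{\varepsilon,\mu}=\{u\in\mathbb R^n:\|u\|=\mu,\ e^{2\pi i\lambda\cdot u}=\varepsilon(L_\lambda)\in\{\pm1\}\text{ for all }\lambda\in\Lambda\}$, let $(\Lambda^*_{\varepsilon,\mu})^B$ be the set of its elements fixed by $B$, and put $e_{\mu,\gamma}=\sum_{u\in(\Lambda^*_{\varepsilon,\mu})^B}e^{-2\pi i u\cdot b}$ for $\gamma=BL_b$. Identify $\mathrm{Spin}(n-1)$ with a subgroup of $\mathrm{Spin}(n)$ through $\mathbb R^{n-1}=\mathbb R^{n-1}\times\{0\}$, and let $T\subset\mathrm{Spin}(n-1)$ be the torus of the elements $\prod_{j=1}^{\lfloor (n-1)/2\rfloor}(\cos t_j+\sin t_j\,e_{2j-1}e_{2j})$. For $\gamma\in\Gamma$ let $x_\gamma$ denote any element of $T$ that is conjugate in $\mathrm{Spin}(n)$ to $\varepsilon(\gamma)$. For $u\neq0$ fixed by $B$ put $\sigma(u,x_\gamma)=1$ if there is $h_u\in\mathrm{Spin}(n)$ with $h_uuh_u^{-1}=\|u\|e_n$ such that $h_u\varepsilon(\gamma)h_u^{-1}$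 is conjugate to $x_\gamma$ in $\mathrm{Spin}(n-1)$, and $\sigma(u,x_\gamma)=-1$ otherwise. **Theorem.** $F$ is finite. If $n\ge3$, every $\gamma\in\Gamma$ admits an element $x_\gamma$ (if $n\le2$, then $F$ is trivial and one may represent it by $\gamma=1$, $x_\gamma=1$). For every $\mu>0$ the set $\Lambda^*_{\varepsilon,\mu}$ and the multiplicities $d^\pm_{\rho,\mu}(\Gamma,\varepsilon)$ are finite, and for every system of representatives $\gamma=BL_b$ of $\Lambda\backslash\Gamma$ and every choice of elements $x_\gamma$ for them: * if $n$ is even, $$d^\pm_{\rho,\mu}(\Gamma,\varepsilon)=\frac1{|F|}\sum_{\gamma\in\Lambda\backslash\Gamma}\chi_\rho(\gamma)\,e_{\mu,\gamma}\,\chi_{L_{n-1}}(x_\gamma);$$ * if $n$ is odd, $$d^\pm_{\rho,\mu}(\Gamma,\varepsilon)=\frac1{|F|}\Big(\sum_{\gamma\in\Lambda\backslash\Gamma,\ B\notin F_1}\chi_\rho(\gamma)\,e_{\mu,\gamma}\,\chi_{L_{n-1}^\pm}(x_\gamma)+\sum_{\gamma\in\Lambda\backslash\Gamma,\ B\in F_1}\chi_\rho(\gamma)\sum_{u\in(\Lambda^*_{\varepsilon,\mu})^B}e^{-2\pi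 iu\cdot b}\,\chi_{L_{n-1}^{\pm\sigma(u,x_\gamma)}}(x_\gamma)\Big).$$ If $\varepsilon_{|\Lambda}\ne1$ then $d_{\rho,0}(\Gamma,\varepsilon)=0$. If $\varepsilon_{|\Lambda}=1$ then $d_{\rho,0}(\Gamma,\varepsilon)$ is finite and $$d_{\rho,0}(\Gamma,\varepsilon)=\frac1{|F|}\sum_{\gamma\in\Lambda\backslash\Gamma}\chi_\rho(\gamma)\,\chi_{L_n}(\varepsilon(\gamma))=\dim(S_n\otimes V)^F.$$ The summands (indexed by $\gamma$) in the two multiplicity formulas are independent of the representative $\gamma$ mod $\Lambda$ and of the choice of $x_\gamma$, but in general the individual factors are not: if $\varepsilon_{|\Lambda}\ne1$ and $\Lambda^*_{\varepsilon,\mu}\neq\emptyset$, there are $\gamma,\gamma'$ in the same class mod $\Lambda$ with $e_{\mu,\gamma}\ne e_{\mu,\gamma'}$ and $\chi_{L_{n-1}}(x_\gamma)\neq\chi_{L_{n-1}}(x_{\gamma'})$ (for any $x_\gamma$, $x_{\gamma'}$); and if $n\ge3$ is odd and $B\in F_1$, then for each $x_\gamma$ there is another admissible choice $x'_\gamma$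 with $\chi_{L_{n-1}^\pm}(x_\gamma)\ne\chi_{L_{n-1}^\pm}(x'_\gamma)$ for both signs. -/

import Mathlib

open scoped TensorProduct ContDiff

noncomputable section

namespace FlatDirac

/-! ### Euclidean space, Clifford algebra, spin group -/

/-- Euclidean space `ℝⁿ` with its standard inner product. -/
abbrev Euc (n : ℕ) := EuclideanSpace ℝ (Fin n)

/-- The quadratic form `v ↦ -‖v‖²`, so that `v * w + w * v + 2⟨v, w⟩ = 0` in its Clifford
algebra. -/
def negQ (n : ℕ) : QuadraticForm ℝ (Euc n) :=
  LinearMap.BilinMap.toQuadraticMap (-(innerₗ (Euc n)))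

theorem negQ_apply (n : ℕ) (v : Euc n) : negQ n v = -∑ k, v k * v k := by
  have h := EuclideanSpace.real_norm_sq_eq v
  simp only [sq] at h
  simp [negQ, LinearMap.BilinMap.toQuadraticMap_apply, h, sq]

/-- The Clifford algebra `Cl(n)`. -/
abbrev Cl (n : ℕ) := CliffordAlgebra (negQ n)

/-- A vector seen as an element of the Clifford algebra. -/
abbrev vec {n : ℕ} (v : Euc n) : Cl n := CliffordAlgebra.ι (negQ n) v

/-- The `k`-th vector of the canonical basis (indices start at `0`). -/
abbrev stdVec {n : ℕ} (k : Fin n) : Euc n := EuclideanSpace.single k (1 : ℝ)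

/-- `Spin(n)`: the products of an even number of unit vectors. -/
abbrev Spin (n : ℕ) := spinGroup (negQ n)

/-- The inclusion `ℝᴺ → ℝᴺ⁺¹`, `v ↦ (v, 0)`. -/
def inclVec (N : ℕ) : Euc N →ₗ[ℝ] Euc (N + 1) where
  toFun v := WithLp.toLp 2 (Fin.snoc (α := fun _ => ℝ) (fun k => v k) 0)
  map_add' v w := by
    ext k
    refine Fin.lastCases ?_ (fun j => ?_) k <;> simp
  map_smul' c v := by
    ext k
    refine Fin.lastCases ?_ (fun j => ?_) k <;> simp

/-- The inclusion `ℝᴺ → ℝᴺ⁺¹` as an isometry of quadratic spaces. -/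
def inclIsom (N : ℕ) : negQ N →qᵢ negQ (N + 1) where
  toLinearMap := inclVec N
  map_app' v := by
    simp [negQ_apply, Fin.sum_univ_castSucc, inclVec]

/-- The inclusion `Cl(N) → Cl(N+1)`; it maps `Spin(N)` onto the stabilizer of the last basis
vector in `Spin(N+1)` (for `N ≥ 1`). -/
def incl (N : ℕ) : Cl N →ₐ[ℝ] Cl (N + 1) := CliffordAlgebra.map (inclIsom N)

/-- The element `x(t₁, …, t_m) = ∏ⱼ (cos tⱼ + sin tⱼ e_{2j-1} e_{2j})`, `m = ⌊N/2⌋`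
(the factors commute). -/
def torusElt (N : ℕ) (t : Fin (N / 2) → ℝ) : Cl N :=
  (List.ofFn fun j : Fin (N / 2) =>
    algebraMap ℝ (Cl N) (Real.cos (t j)) +
      Real.sin (t j) • (vec (stdVec (⟨2 * j.1, by omega⟩ : Fin N)) *
        vec (stdVec (⟨2 * j.1 + 1, by omega⟩ : Fin N)))).prod

/-- The standard maximal torus `T` of `Spin(N)`. -/
def maxTorus (N : ℕ) : Set (Spin N) := {x | ∃ t, (x : Cl N) = torusElt N t}

/-! ### The spin representations -/

/-- The spinor space `S_n`, of dimension `2^⌊n/2⌋`; its canonical basis vectors `δ_I` are indexed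
by the subsets `I` of `{1, …, ⌊n/2⌋}`, and `δ_I` will span the weight space of weight
`(1/2) ∑ᵢ εᵢ - ∑_{i ∈ I} εᵢ`, that is, `e_{2j-1} e_{2j} δ_I = i δ_I` if `j ∉ I` and `-i δ_I` if
`j ∈ I`. -/
abbrev Spinor (n : ℕ) := EuclideanSpace ℂ (Finset (Fin (n / 2)))

/-- `(-1)^{#{i ∈ I : i < j}}`. -/
def koszul {m : ℕ} (j : Fin m) (I : Finset (Fin m)) : ℂ := (-1) ^ (I.filter (· < j)).card

/-- The operator `φ ↦ (I ↦ c I * φ (I ∆ {j}))`. -/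
def flip {m : ℕ} (j : Fin m) (c : Finset (Fin m) → ℂ) :
    Module.End ℂ (EuclideanSpace ℂ (Finset (Fin m))) where
  toFun φ := WithLp.toLp 2 fun I => c I * φ (symmDiff I {j})
  map_add' φ ψ := by ext I; simp [mul_add]
  map_smul' a φ := by ext I; simp [mul_left_comm]

/-- The operator `φ ↦ (I ↦ (-1)^{|I|} φ I)`. -/
def parity (m : ℕ) : Module.End ℂ (EuclideanSpace ℂ (Finset (Fin m))) where
  toFun φ := WithLp.toLp 2 fun I => (-1) ^ I.card * φ I
  map_add' φ ψ := by ext I; simp [mul_add]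
  map_smul' a φ := by ext I; simp [mul_left_comm]

/-- Clifford multiplication by the canonical basis vectors on `S_n`. The unpaired last vector,
which exists for odd `n`, acts by `∓i` on the span of the `δ_I` with `|I|` even, resp. odd. -/
def gammaOp (n : ℕ) (k : Fin n) : Module.End ℂ (Spinor n) :=
  if h : k.1 / 2 < n / 2 then
    flip ⟨k.1 / 2, h⟩ fun I =>
      koszul ⟨k.1 / 2, h⟩ I *
        (if k.1 % 2 = 0 then Complex.I else if (⟨k.1 / 2, h⟩ : Fin (n / 2)) ∈ I then 1 else -1)
  else (-Complex.I) • parity (n / 2)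

theorem card_symmDiff_singleton {m : ℕ} (j : Fin m) (I : Finset (Fin m)) :
    (-1 : ℂ) ^ (symmDiff I {j}).card = -(-1 : ℂ) ^ I.card := by
  by_cases h : j ∈ I
  · have h1 : symmDiff I {j} = I.erase j := by
      ext i; by_cases hi : i = j <;> simp [Finset.mem_symmDiff, hi, h]
    have h2 := Finset.card_erase_add_one h
    rw [h1, ← h2, pow_succ]; ring
  · have h1 : symmDiff I {j} = insert j I := by
      ext i; by_cases hi : i = j <;> simp [Finset.mem_symmDiff, hi, h]
    rw [h1, Finset.card_insert_of_notMem h, pow_succ]; ring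

theorem koszul_symmDiff_of_lt {m : ℕ} {i j : Fin m} (h : i < j) (I : Finset (Fin m)) :
    koszul j (symmDiff I {i}) = -koszul j I := by
  have h1 : (symmDiff I {i}).filter (· < j) = symmDiff (I.filter (· < j)) {i} := by
    ext l; by_cases hl : l = i <;> simp [Finset.mem_symmDiff, hl, h]
  rw [koszul, koszul, h1, card_symmDiff_singleton]

theorem koszul_symmDiff_of_le {m : ℕ} {i j : Fin m} (h : j ≤ i) (I : Finset (Fin m)) :
    koszul j (symmDiff I {i}) = koszul j I := by
  have h1 : (symmDiff I {i}).filter (· < j) = I.filter (· < j) := by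
    ext l; by_cases hl : l = i <;> simp [Finset.mem_symmDiff, hl, h]
  rw [koszul, koszul, h1]

theorem koszul_sq {m : ℕ} (j : Fin m) (I : Finset (Fin m)) : koszul j I * koszul j I = 1 := by
  rw [koszul, ← mul_pow]; simp

theorem gammaOp_sq (n : ℕ) (k : Fin n) : gammaOp n k * gammaOp n k = -1 := by
  ext φ I
  by_cases h : k.1 / 2 < n / 2
  · have hs := koszul_sq ⟨k.1 / 2, h⟩ I
    by_cases hk : k.1 % 2 = 0
    · simp [gammaOp, h, hk, flip, koszul_symmDiff_of_le]
      linear_combination (-φ I) * hs + (koszul ⟨k.1 / 2, h⟩ I) ^ 2 * φ I * Complex.I_mul_I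
    · by_cases hI : (⟨k.1 / 2, h⟩ : Fin (n / 2)) ∈ I
      · simp [gammaOp, h, hk, flip, koszul_symmDiff_of_le, hI, Finset.mem_symmDiff]
        linear_combination (φ I) * hs
      · simp [gammaOp, h, hk, flip, koszul_symmDiff_of_le, hI, Finset.mem_symmDiff]
        linear_combination (φ I) * hs
  · have hs : ((-1 : ℂ) ^ I.card) * ((-1 : ℂ) ^ I.card) = 1 := by rw [← mul_pow]; simp
    simp [gammaOp, h, parity]
    linear_combination (-φ I) * hs + ((-1 : ℂ) ^ I.card) ^ 2 * φ I * Complex.I_mul_I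

theorem parity_gammaOp (n : ℕ) (k : Fin n) (h : k.1 / 2 < n / 2) :
    parity (n / 2) * gammaOp n k = -(gammaOp n k * parity (n / 2)) := by
  ext φ I
  simp only [gammaOp, h, dif_pos, flip, parity, Module.End.mul_apply, LinearMap.neg_apply,
    LinearMap.coe_mk, AddHom.coe_mk, PiLp.neg_apply, card_symmDiff_singleton]
  ring

theorem gammaOp_anticomm_aux (n : ℕ) {k l : Fin n} (hkl : k < l) :
    gammaOp n k * gammaOp n l + gammaOp n l * gammaOp n k = 0 := by
  have hkl' : k.1 < l.1 := hkl
  by_cases hk : k.1 / 2 < n / 2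
  · by_cases hl : l.1 / 2 < n / 2
    · rcases Nat.lt_or_ge (k.1 / 2) (l.1 / 2) with hlt | hge
      · have hlt' : (⟨k.1 / 2, hk⟩ : Fin (n / 2)) < ⟨l.1 / 2, hl⟩ := hlt
        have hne : (⟨k.1 / 2, hk⟩ : Fin (n / 2)) ≠ ⟨l.1 / 2, hl⟩ := hlt'.ne
        ext φ I
        have hcomm : symmDiff (symmDiff I {(⟨l.1 / 2, hl⟩ : Fin (n / 2))}) {⟨k.1 / 2, hk⟩} =
            symmDiff (symmDiff I {(⟨k.1 / 2, hk⟩ : Fin (n / 2))}) {⟨l.1 / 2, hl⟩} := by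
          rw [symmDiff_assoc, symmDiff_assoc, symmDiff_comm {_} {_}]
        simp only [gammaOp, hk, hl, dif_pos, flip, LinearMap.add_apply, Module.End.mul_apply,
          LinearMap.coe_mk, AddHom.coe_mk, PiLp.add_apply, LinearMap.zero_apply, PiLp.zero_apply,
          koszul_symmDiff_of_lt hlt', koszul_symmDiff_of_le hlt'.le, hcomm, Finset.mem_symmDiff,
          Finset.mem_singleton, hne, hne.symm, not_false_eq_true, and_true, false_and, or_false]
        ring
      · have heq : l.1 / 2 = k.1 / 2 := by omega
        have hk0 : k.1 % 2 = 0 := by omega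
        have hl1 : ¬ l.1 % 2 = 0 := by omega
        ext φ I
        by_cases hI : (⟨k.1 / 2, hk⟩ : Fin (n / 2)) ∈ I <;>
        · simp [gammaOp, hk, heq, hk0, hl1, flip, koszul_symmDiff_of_le, Finset.mem_symmDiff, hI]
          ring
    · have h1 := parity_gammaOp n k hk
      have h2 : gammaOp n l = (-Complex.I) • parity (n / 2) := by simp [gammaOp, hl]
      rw [h2, mul_smul_comm, smul_mul_assoc, h1, smul_neg, add_neg_cancel]
  · omega

theorem gammaOp_anticomm (n : ℕ) {k l : Fin n} (hkl : k ≠ l) :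
    gammaOp n k * gammaOp n l + gammaOp n l * gammaOp n k = 0 := by
  rcases lt_or_gt_of_ne hkl with h | h
  · exact gammaOp_anticomm_aux n h
  · rw [add_comm]; exact gammaOp_anticomm_aux n h

/-- Clifford multiplication by a vector on the spinor space. -/
def cliffordVec (n : ℕ) : Euc n →ₗ[ℝ] Module.End ℂ (Spinor n) where
  toFun v := ∑ k, v k • gammaOp n k
  map_add' v w := by simp [add_smul, Finset.sum_add_distrib]
  map_smul' c v := by simp [Finset.smul_sum, mul_smul]

theorem cliffordVec_sq (n : ℕ) (v : Euc n) :
    cliffordVec n v * cliffordVec n v = algebraMap ℝ _ (negQ n v) := by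
  have h1 : cliffordVec n v * cliffordVec n v =
      ∑ k, ∑ l, (v k * v l) • (gammaOp n k * gammaOp n l) := by
    simp only [cliffordVec, LinearMap.coe_mk, AddHom.coe_mk, Finset.sum_mul_sum, smul_mul_smul_comm]
  have h2 : (2 : ℝ) • (cliffordVec n v * cliffordVec n v) =
      ∑ k, ∑ l, (v k * v l) • (gammaOp n k * gammaOp n l + gammaOp n l * gammaOp n k) := by
    rw [two_smul]
    nth_rewrite 2 [h1]
    rw [Finset.sum_comm, h1, ← Finset.sum_add_distrib]
    refine Finset.sum_congr rfl fun k _ => ?_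
    rw [← Finset.sum_add_distrib]
    refine Finset.sum_congr rfl fun l _ => ?_
    rw [smul_add, mul_comm (v l) (v k)]
  have h3 : ∀ k : Fin n, ∑ l, (v k * v l) •
      (gammaOp n k * gammaOp n l + gammaOp n l * gammaOp n k) =
        (2 : ℝ) • ((-(v k * v k)) • (1 : Module.End ℂ (Spinor n))) := by
    intro k
    rw [Finset.sum_eq_single k]
    · rw [gammaOp_sq, two_smul, smul_add, neg_smul, smul_neg]
    · intro l _ hl
      rw [gammaOp_anticomm n (Ne.symm hl), smul_zero]
    · simp
  simp_rw [h3, ← Finset.smul_sum, ← Finset.sum_smul] at h2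
  have h4 := smul_right_injective (Module.End ℂ (Spinor n)) (two_ne_zero (α := ℝ)) h2
  rw [h4, negQ_apply, Algebra.algebraMap_eq_smul_one, Finset.sum_neg_distrib]

/-- The (irreducible complex) Clifford module structure on the spinor space. -/
def cliffordRep (n : ℕ) : Cl n →ₐ[ℝ] Module.End ℂ (Spinor n) :=
  CliffordAlgebra.lift (negQ n) ⟨cliffordVec n, cliffordVec_sq n⟩

/-- The spin representation `(L_n, S_n)` of `Spin(n)`. -/
def spinRep (n : ℕ) : Representation ℂ (Spin n) (Spinor n) where
  toFun g := cliffordRep n g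
  map_one' := by simp
  map_mul' g h := by simp

/-- The half-spin spaces `S_n^+` (`s = 1`), spanned by the `δ_I` with `|I|` even, and `S_n^-`
(`s = -1`), spanned by the `δ_I` with `|I|` odd. -/
def halfSpinor (n : ℕ) (s : ℤˣ) : Submodule ℂ (Spinor n) where
  carrier := {φ | ∀ I : Finset (Fin (n / 2)), (-1 : ℤˣ) ^ I.card ≠ s → φ I = 0}
  zero_mem' := by intro I _; simp
  add_mem' := by
    intro φ ψ hφ hψ I hI
    simp [hφ I hI, hψ I hI]
  smul_mem' := by
    intro c φ hφ I hI
    simp [hφ I hI]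

theorem mem_halfSpinor_iff (n : ℕ) (s : ℤˣ) (φ : Spinor n) :
    φ ∈ halfSpinor n s ↔ parity (n / 2) φ = ((s : ℤ) : ℂ) • φ := by
  have hp : ∀ I : Finset (Fin (n / 2)), ((-1 : ℂ) ^ I.card) = (((-1 : ℤˣ) ^ I.card : ℤˣ) : ℤ) := by
    intro I; push_cast; rfl
  have hpar : ∀ I, (parity (n / 2) φ) I = (((-1 : ℤˣ) ^ I.card : ℤˣ) : ℤ) * φ I := by
    intro I; rw [← hp]; rfl
  have hcoord : parity (n / 2) φ = ((s : ℤ) : ℂ) • φ ↔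
      ∀ I, (((-1 : ℤˣ) ^ I.card : ℤˣ) : ℤ) * φ I = ((s : ℤ) : ℂ) * φ I := by
    constructor
    · intro h I
      rw [← hpar, h, PiLp.smul_apply, smul_eq_mul]
    · intro h
      ext I
      rw [hpar, h, PiLp.smul_apply, smul_eq_mul]
  rw [hcoord]
  constructor
  · intro h I
    by_cases hI : (-1 : ℤˣ) ^ I.card = s
    · rw [hI]
    · rw [h I hI]; simp
  · intro h I hI
    have h1 := h I
    rcases Int.units_eq_one_or ((-1 : ℤˣ) ^ I.card) with h2 | h2 <;>
      rcases Int.units_eq_one_or s with h3 | h3 <;> rw [h2, h3] at h1 hI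
    · exact absurd rfl hI
    · norm_num at h1
      linear_combination h1 / 2
    · norm_num at h1
      linear_combination (-1 / 2 : ℂ) * h1
    · exact absurd rfl hI

theorem parity_cliffordVec (n : ℕ) (hn : Even n) (v : Euc n) :
    parity (n / 2) * cliffordVec n v = -(cliffordVec n v * parity (n / 2)) := by
  simp only [cliffordVec, LinearMap.coe_mk, AddHom.coe_mk, Finset.mul_sum, Finset.sum_mul,
    ← Finset.sum_neg_distrib]
  refine Finset.sum_congr rfl fun k _ => ?_
  have hk : k.1 / 2 < n / 2 := by
    obtain ⟨r, hr⟩ := hn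
    have := k.2
    omega
  rw [mul_smul_comm, smul_mul_assoc, parity_gammaOp n k hk, smul_neg]

theorem parity_cliffordRep (n : ℕ) (hn : Even n) (x : Cl n)
    (hx : x ∈ CliffordAlgebra.evenOdd (negQ n) 0) :
    parity (n / 2) * cliffordRep n x = cliffordRep n x * parity (n / 2) := by
  induction x, hx using CliffordAlgebra.even_induction with
  | algebraMap r => simp [Algebra.commutes]
  | add x y hx hy h1 h2 => simp [mul_add, add_mul, h1, h2]
  | ι_mul_ι_mul v w x hx h =>
    have e : ∀ u : Euc n, cliffordRep n (CliffordAlgebra.ι (negQ n) u) = cliffordVec n u := by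
      intro u; simp [cliffordRep]
    simp only [map_mul, e]
    have hv := parity_cliffordVec n hn v
    have hw := parity_cliffordVec n hn w
    rw [← mul_assoc, ← mul_assoc, hv, neg_mul, mul_assoc (cliffordVec n v), hw]
    simp only [mul_neg, neg_neg, mul_assoc, h]

theorem spinRep_mem_halfSpinor (n : ℕ) (hn : Even n) (s : ℤˣ) (g : Spin n) :
    ∀ φ ∈ halfSpinor n s, spinRep n g φ ∈ halfSpinor n s := by
  intro φ hφ
  rw [mem_halfSpinor_iff] at hφ ⊢
  have h := parity_cliffordRep n hn g (spinGroup.mem_even g.2)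
  have h2 := congrArg (fun A : Module.End ℂ (Spinor n) => A φ) h
  simp only [Module.End.mul_apply, hφ, map_smul] at h2
  exact h2

/-- The half-spin representations `(L_n^±, S_n^±)` of `Spin(n)`, for even `n`. -/
def halfSpinRep (n : ℕ) (hn : Even n) (s : ℤˣ) :
    Representation ℂ (Spin n) (halfSpinor n s) where
  toFun g := (spinRep n g).restrict (spinRep_mem_halfSpinor n hn s g)
  map_one' := by ext φ; simp
  map_mul' g h := by ext φ; simp

/-! ### Bieberbach groups -/

variable {n : ℕ}

/-- The isometry group `I(ℝⁿ)`. -/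
abbrev Isom (n : ℕ) := Euc n ≃ᵃⁱ[ℝ] Euc n

/-- The homomorphism `r : Γ → O(n)`, `B L_b ↦ B`. -/
def rot (Γ : Subgroup (Isom n)) : Γ →* (Euc n ≃ₗᵢ[ℝ] Euc n) where
  toFun γ := γ.1.linearIsometryEquiv
  map_one' := rfl
  map_mul' _ _ := rfl

/-- The vector `b` with `γ = B L_b`, that is, `γ x = B (x + b)`. -/
def transl {Γ : Subgroup (Isom n)} (γ : Γ) : Euc n := (rot Γ γ).symm (γ.1 0)

/-- A Bieberbach group: a discrete, cocompact, torsion-free subgroup of `I(ℝⁿ)`. The topology of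
`I(ℝⁿ)` is that of the pairs (linear part, image of the origin). -/
structure IsBieberbach (Γ : Subgroup (Isom n)) : Prop where
  discrete : DiscreteTopology (Set.range fun γ : Γ =>
    (((rot Γ γ : Euc n ≃L[ℝ] Euc n) : Euc n →L[ℝ] Euc n), γ.1 0))
  cocompact : ∃ K : Set (Euc n), IsCompact K ∧ ∀ x : Euc n, ∃ γ : Γ, γ.1 x ∈ K
  torsionFree : ∀ γ : Γ, ∀ k : ℕ, 0 < k → γ ^ k = 1 → γ = 1

/-- The subgroup `L_Λ` of the translations in `Γ`; `Λ` consists of the vectors `transl γ` with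
`γ` in this subgroup. -/
abbrev latt (Γ : Subgroup (Isom n)) : Subgroup Γ := (rot Γ).ker

/-- The holonomy group `F = r(Γ)`. -/
abbrev holonomy (Γ : Subgroup (Isom n)) : Subgroup (Euc n ≃ₗᵢ[ℝ] Euc n) := (rot Γ).range

/-- `n_B = dim ker (B - Id)`. -/
def fixDim (B : Euc n ≃ₗᵢ[ℝ] Euc n) : ℕ :=
  Module.finrank ℝ (LinearMap.ker ((B.toLinearEquiv : Euc n →ₗ[ℝ] Euc n) - LinearMap.id))

/-- `F₁ = {B ∈ F : n_B = 1}`. -/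
def holonomyOne (Γ : Subgroup (Isom n)) : Set (Euc n ≃ₗᵢ[ℝ] Euc n) :=
  {B | B ∈ holonomy Γ ∧ fixDim B = 1}

/-- `ε : Γ → Spin(n)` defines a spin structure on `Γ \ ℝⁿ` if `ε(γ) v ε(γ)⁻¹ = r(γ) v` for all
vectors `v`. (In particular `F ⊆ SO(n)`.) -/
def IsSpinStructure {Γ : Subgroup (Isom n)} (ε : Γ →* Spin n) : Prop :=
  ∀ (γ : Γ) (v : Euc n),
    (ε γ : Cl n) * vec v * ((ε γ)⁻¹ : Spin n) = vec (rot Γ γ v)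

open Classical in
/-- The character `δ_ε` of `Λ` with `ε(L_λ) = δ_ε(λ) ∈ {1, -1}`. -/
def delta {Γ : Subgroup (Isom n)} (ε : Γ →* Spin n) (γ : latt Γ) : ℂ :=
  if ε γ = 1 then 1 else -1

/-- `Λ*_ε = {u : e^{2πi λ·u} = δ_ε(λ) for all λ ∈ Λ}`, a translate of the dual lattice. -/
def shiftedDual {Γ : Subgroup (Isom n)} (ε : Γ →* Spin n) : Set (Euc n) :=
  {u | ∀ γ : latt Γ,
    Complex.exp (2 * Real.pi * Complex.I * (inner ℝ (transl γ.1) u : ℝ)) = delta ε γ}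

/-- `Λ*_{ε,μ} = {u ∈ Λ*_ε : ‖u‖ = μ}`. -/
def shiftedDualNorm {Γ : Subgroup (Isom n)} (ε : Γ →* Spin n) (μ : ℝ) : Set (Euc n) :=
  {u | u ∈ shiftedDual ε ∧ ‖u‖ = μ}

/-- `(Λ*_{ε,μ})^B` for `γ = B L_b`. -/
def fixedDual {Γ : Subgroup (Isom n)} (ε : Γ →* Spin n) (μ : ℝ) (γ : Γ) : Set (Euc n) :=
  {u | u ∈ shiftedDualNorm ε μ ∧ rot Γ γ u = u}

/-- `e^{-2πi u·b}` for `γ = B L_b`. -/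
def phase {Γ : Subgroup (Isom n)} (γ : Γ) (u : Euc n) : ℂ :=
  Complex.exp (-(2 * Real.pi * Complex.I * (inner ℝ u (transl γ) : ℝ)))

/-- `e_{μ,γ}(δ_ε) = ∑_{u ∈ (Λ*_{ε,μ})^B} e^{-2πi u·b}` for `γ = B L_b`. -/
def expSum {Γ : Subgroup (Isom n)} (ε : Γ →* Spin n) (μ : ℝ) (γ : Γ) : ℂ :=
  ∑ᶠ u ∈ fixedDual ε μ γ, phase γ u

/-! ### The elements `x_γ` and the signs -/

/-- `x` may be taken as `x_γ`, where `y = ε(γ)`: it lies in the maximal torus of `Spin(N)` and is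
conjugate to `y` in `Spin(N+1)`. -/
def IsTorusRep {N : ℕ} (y : Spin (N + 1)) (x : Spin N) : Prop :=
  x ∈ maxTorus N ∧
    ∃ g : Spin (N + 1), (y : Cl (N + 1)) = g * incl N x * (g⁻¹ : Spin (N + 1))

open Classical in
/-- The sign `σ(u, x_γ)`, where `y = ε(γ)`: it is `1` if `h_u y h_u⁻¹` is conjugate to `x` in
`Spin(N)`, where `h_u ∈ Spin(N+1)` satisfies `h_u u h_u⁻¹ = ‖u‖ e_{N+1}`, and `-1` otherwise. -/
def sigma {N : ℕ} (y : Spin (N + 1)) (u : Euc (N + 1)) (x : Spin N) : ℤˣ :=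
  if ∃ h : Spin (N + 1),
      (h : Cl (N + 1)) * vec u * (h⁻¹ : Spin (N + 1)) = vec (‖u‖ • stdVec (Fin.last N)) ∧
      ∃ g : Spin N,
        (h : Cl (N + 1)) * y * (h⁻¹ : Spin (N + 1)) = incl N (g * x * (g⁻¹ : Spin N))
  then 1 else -1

/-! ### The twisted Dirac operator -/

section Dirac

variable {V : Type*} [NormedAddCommGroup V] [InnerProductSpace ℂ V]
variable {Γ : Subgroup (Isom n)}

/-- The representation `L ∘ ε ⊗ ρ` of `Γ` on `S ⊗ V`. -/
def twistedRep (ε : Γ →* Spin n) (ρ : Representation ℂ Γ V) :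
    Representation ℂ Γ (Spinor n ⊗[ℂ] V) :=
  Representation.tprod (MonoidHom.comp (spinRep n) ε) ρ

/-- The smooth sections of the twisted spinor bundle `Γ \ (ℝⁿ × (S ⊗ V))`, that is, the smooth
`f : ℝⁿ → S ⊗ V` with `f (γ x) = (L ∘ ε ⊗ ρ)(γ) (f x)`. -/
def IsSpinorField (ε : Γ →* Spin n) (ρ : Representation ℂ Γ V)
    (f : Euc n → Spinor n ⊗[ℂ] V) : Prop :=
  ContDiff ℝ ∞ f ∧ ∀ (γ : Γ) (x : Euc n), f (γ.1 x) = twistedRep ε ρ γ (f x)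

/-- The twisted Dirac operator `D_ρ f = ∑ᵢ eᵢ · ∂f/∂xᵢ`, where `eᵢ` acts by `L(eᵢ) ⊗ Id`. -/
def dirac (f : Euc n → Spinor n ⊗[ℂ] V) (x : Euc n) : Spinor n ⊗[ℂ] V :=
  ∑ k : Fin n, LinearMap.rTensor V (cliffordRep n (vec (stdVec k))) (fderiv ℝ f x (stdVec k))

/-- The eigenspace of `D_ρ`, acting on the smooth sections of the twisted spinor bundle, for the
eigenvalue `c`. -/
def diracEigenspace (ε : Γ →* Spin n) (ρ : Representation ℂ Γ V) (c : ℂ) :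
    Submodule ℂ (Euc n → Spinor n ⊗[ℂ] V) where
  carrier := {f | IsSpinorField ε ρ f ∧ ∀ x, dirac f x = c • f x}
  zero_mem' := by
    refine ⟨⟨contDiff_const, fun γ x => by simp⟩, fun x => ?_⟩
    have h : fderiv ℝ (0 : Euc n → Spinor n ⊗[ℂ] V) x = 0 := by
      simp
    simp [dirac, h]
  add_mem' := by
    rintro f g ⟨hf, hf'⟩ ⟨hg, hg'⟩
    refine ⟨⟨hf.1.add hg.1, fun γ x => by simp [hf.2, hg.2]⟩, fun x => ?_⟩
    have h1 := (hf.1.differentiable (by simp)) x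
    have h2 := (hg.1.differentiable (by simp)) x
    have h3 : dirac (f + g) x = dirac f x + dirac g x := by
      have h4 : fderiv ℝ (f + g) x = fderiv ℝ f x + fderiv ℝ g x := fderiv_add h1 h2
      unfold dirac
      rw [h4, ← Finset.sum_add_distrib]
      exact Finset.sum_congr rfl fun k _ => map_add _ _ _
    rw [h3, hf', hg', Pi.add_apply, smul_add]
  smul_mem' := by
    rintro a f ⟨hf, hf'⟩
    refine ⟨⟨contDiff_const.smul hf.1, fun γ x => by simp [hf.2]⟩, fun x => ?_⟩
    have h1 := (hf.1.differentiable (by simp)) x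
    have h3 : dirac (a • f) x = a • dirac f x := by
      have h4 : fderiv ℝ (a • f) x = a • fderiv ℝ f x := fderiv_const_smul h1 a
      unfold dirac
      rw [h4, Finset.smul_sum]
      exact Finset.sum_congr rfl fun k _ => LinearMap.map_smul _ a (fderiv ℝ f x (stdVec k))
    rw [h3, hf', Pi.smul_apply, smul_comm]

/-- If `ε` and `ρ` are trivial on `Λ`, then `L ∘ ε ⊗ ρ` is a representation of the holonomy
group `F ≃ Λ \ Γ`. -/
def holonomyRep (ε : Γ →* Spin n) (ρ : Representation ℂ Γ V)
    (hε : ∀ γ ∈ latt Γ, ε γ = 1) (hρ : ∀ γ ∈ latt Γ, ρ γ = 1) :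
    Representation ℂ (Γ ⧸ latt Γ) (Spinor n ⊗[ℂ] V) :=
  QuotientGroup.lift (latt Γ) (twistedRep ε ρ) (by
    intro γ hγ
    simp [twistedRep, Representation.tprod, hε γ hγ, hρ γ hγ])

end Dirac

/-! ### The summands of the multiplicity formulas -/

section Summands

variable {V : Type*} [NormedAddCommGroup V] [InnerProductSpace ℂ V] {N : ℕ}
variable {Γ : Subgroup (Isom (N + 1))}

/-- `χ_ρ(γ) e_{μ,γ}(δ_ε) χ_{L_N}(x)`. -/
def evenSummand (ε : Γ →* Spin (N + 1)) (ρ : Representation ℂ Γ V) (μ : ℝ) (γ : Γ)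
    (x : Spin N) : ℂ :=
  ρ.character γ * expSum ε μ γ * (spinRep N).character x

/-- `χ_ρ(γ) e_{μ,γ}(δ_ε) χ_{L_N^s}(x)`. -/
def oddSummand (ε : Γ →* Spin (N + 1)) (ρ : Representation ℂ Γ V) (hN : Even N) (μ : ℝ) (s : ℤˣ)
    (γ : Γ) (x : Spin N) : ℂ :=
  ρ.character γ * expSum ε μ γ * (halfSpinRep N hN s).character x

/-- `χ_ρ(γ) ∑_{u ∈ (Λ*_{ε,μ})^B} e^{-2πi u·b} χ_{L_N^{s σ(u, x)}}(x)`. -/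
def oddSummandOne (ε : Γ →* Spin (N + 1)) (ρ : Representation ℂ Γ V) (hN : Even N) (μ : ℝ)
    (s : ℤˣ) (γ : Γ) (x : Spin N) : ℂ :=
  ρ.character γ * ∑ᶠ u ∈ fixedDual ε μ γ,
    phase γ u * (halfSpinRep N hN (s * sigma (ε γ) u x)).character x

end Summands

end FlatDirac

end

open scoped TensorProduct ContDiff

noncomputable section

namespace FlatDirac

/-! ### Clifford algebra and spin group -/

section Clifford

open CliffordAlgebra

variable {n : ℕ}

/-! Since `ρ` is trivial on the lattice and `ε` is `±1` there, a section is periodic under the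
kernel of `ε` on `Λ`, which spans `ℝⁿ` (`IsBieberbach.span_latt`, `IsBieberbach.exists_basis`).
Hence it has a Fourier expansion. Equivariance under all of `Λ` puts the frequencies into `Λ*_ε`.
The Dirac equation says that the coefficient `w` at `u` satisfies `2πi u·w = ±2πμ w`, and applying
it twice gives `‖u‖ = μ`. An eigensection is therefore a finite sum of plane waves whose amplitudes
lie in the range of `(1 ± i u/‖u‖)/2` (`mem_range_waveSum`, `waveSum_mem_diracEigenspace_iff`).

On amplitudes, `γ = B L_b` moves the value at `u` to `Bu` with the factor `e^{-2πi u·b} L(ε(γ)) ⊗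
ρ(γ)`. This action factors through `Λ\Γ` and commutes with the projections above, so the eigenspace
is a space of invariants of a finite group (`diracEigenspace_eq_map`). Its dimension is an average
of traces (`finrank_invariants_inf_range`), and only the `u` fixed by `B` contribute
(`trace_waveAct_mul_amplitudeProj`). Each summand is the trace `waveTrace` of an operator that
depends only on the class of `γ`. This is why the summands do not depend on the choices although
their factors do.

What remains are the traces of `y` and of `y u` on spinors, for `y = ε(γ)` and `B u = u`. The first
is a multiple of the spin character of `x_γ`. For even `n` the second vanishes, because `y u`
anticommutes with the parity operator. For odd `n`, `e_n` acts as `-i` times parity, so the second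
trace is, up to sign, a difference of half-spin characters. If `B` fixes a vector orthogonal to `u`,
it vanishes by a conjugation argument. If `B` fixes only a line, the sign records the direction of
`u` in that line, and it is `σ(u, x_γ)` (`IsTorusRep.trace_mul_spinProj_of_fixDim_eq_one`).

Torsion-freeness makes every `B` fix a unit vector (`IsBieberbach.exists_fixed`). The normal form of
`B` on its complement (`exists_rotatesPairs`), together with the uniqueness of spin lifts up to
sign, then gives `x_γ` (`exists_isTorusRep`). Finiteness of the holonomy is the first Bieberbach
theorem, proved by a minimality argument with commutators (`IsBieberbach.rot_eq_one_of_rotDev_le`).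
Harmonic spinors are the case `μ = 0` of the same argument, where `Λ*_{ε,0}` is empty or `{0}`. -/

theorem vec_add (v w : Euc n) : vec (v + w) = vec v + vec w := map_add _ v w

theorem vec_sub (v w : Euc n) : vec (v - w) = vec v - vec w := map_sub _ v w

theorem vec_smul (c : ℝ) (v : Euc n) : vec (c • v) = c • vec v := map_smul _ c v

theorem involute_vec (v : Euc n) : involute (vec v) = -vec v := involute_ι v

theorem negQ_eq_neg_norm_sq (v : Euc n) : negQ n v = -‖v‖ ^ 2 := by
  rw [negQ_apply, EuclideanSpace.real_norm_sq_eq]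
  simp [sq]

theorem polar_negQ (v w : Euc n) : QuadraticMap.polar (negQ n) v w = -(2 * inner ℝ v w) := by
  simp only [QuadraticMap.polar, negQ_eq_neg_norm_sq, norm_add_sq_real]
  ring

theorem vec_mul_self (v : Euc n) : vec v * vec v = algebraMap ℝ (Cl n) (-‖v‖ ^ 2) := by
  rw [ι_sq_scalar, negQ_eq_neg_norm_sq]

theorem vec_mul_vec_add_swap (v w : Euc n) :
    vec v * vec w + vec w * vec v = algebraMap ℝ (Cl n) (-(2 * inner ℝ v w)) := by
  rw [ι_mul_ι_add_swap, polar_negQ]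

theorem vec_mul_vec_of_inner_eq_zero {v w : Euc n} (h : inner ℝ v w = 0) :
    vec v * vec w = -(vec w * vec v) := by
  rw [eq_neg_iff_add_eq_zero, vec_mul_vec_add_swap, h]
  simp

theorem vec_mul_self_of_norm_one {v : Euc n} (h : ‖v‖ = 1) : vec v * vec v = -1 := by
  rw [vec_mul_self, h]
  simp

/-- The Clifford algebra acts on a nonzero spinor space, so `1 ≠ 0` in it. -/
instance : Nontrivial (Cl n) := (cliffordRep n).toRingHom.domain_nontrivial

theorem algebraMap_cl_injective : Function.Injective (algebraMap ℝ (Cl n)) :=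
  (algebraMap ℝ (Cl n)).injective

theorem vec_injective : Function.Injective (vec : Euc n → Cl n) := by
  refine (injective_iff_map_eq_zero (ι (negQ n))).2 fun v hv => ?_
  have h := vec_mul_self v
  have hv' : vec v = 0 := hv
  rw [hv', mul_zero, eq_comm, map_eq_zero_iff _ algebraMap_cl_injective] at h
  simpa using h

theorem stdVec_mul_self (k : Fin n) : vec (stdVec k) * vec (stdVec k) = -1 :=
  vec_mul_self_of_norm_one (by simp)

theorem inner_stdVec_of_ne {k l : Fin n} (h : k ≠ l) :
    inner ℝ (stdVec k) (stdVec l) = (0 : ℝ) := by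
  rw [EuclideanSpace.inner_single_left]
  simp [h]

theorem stdVec_mul_stdVec {k l : Fin n} (h : k ≠ l) :
    vec (stdVec k) * vec (stdVec l) = -(vec (stdVec l) * vec (stdVec k)) :=
  vec_mul_vec_of_inner_eq_zero (inner_stdVec_of_ne h)

/-- The subalgebra generated by the first `j` canonical basis vectors. -/
def initialSubalgebra (n j : ℕ) : Subalgebra ℝ (Cl n) :=
  Algebra.adjoin ℝ {x | ∃ k : Fin n, k.1 < j ∧ x = vec (stdVec k)}

theorem stdVec_mem_initialSubalgebra {k : Fin n} {j : ℕ} (h : k.1 < j) :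
    vec (stdVec k) ∈ initialSubalgebra n j :=
  Algebra.subset_adjoin ⟨k, h, rfl⟩

theorem involute_mem_initialSubalgebra {j : ℕ} {x : Cl n} (hx : x ∈ initialSubalgebra n j) :
    involute x ∈ initialSubalgebra n j := by
  induction hx using Algebra.adjoin_induction with
  | mem x hx =>
    obtain ⟨k, hk, rfl⟩ := hx
    rw [involute_ι]
    exact neg_mem (stdVec_mem_initialSubalgebra hk)
  | algebraMap r => simp
  | add x y _ _ hx hy => simpa using add_mem hx hy
  | mul x y _ _ hx hy => simpa using mul_mem hx hy

theorem stdVec_mul_of_mem_initialSubalgebra {k : Fin n} {x : Cl n}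
    (hx : x ∈ initialSubalgebra n k) :
    vec (stdVec k) * x = involute x * vec (stdVec k) := by
  induction hx using Algebra.adjoin_induction with
  | mem x hx =>
    obtain ⟨l, hl, rfl⟩ := hx
    rw [involute_ι, neg_mul, stdVec_mul_stdVec (by rintro rfl; exact lt_irrefl _ hl)]
  | algebraMap r => simp [Algebra.commutes]
  | add x y _ _ hx hy => simp [mul_add, add_mul, hx, hy]
  | mul x y _ _ hx hy => rw [← mul_assoc, hx, mul_assoc, hy, ← mul_assoc, map_mul]

/-- Moving `e_k` past the earlier generators only applies the grading involution, and `e_k² = -1`;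
so the elements of this form are closed under products. -/
theorem exists_of_mem_initialSubalgebra_succ {k : Fin n} {x : Cl n}
    (hx : x ∈ initialSubalgebra n (k + 1)) :
    ∃ a ∈ initialSubalgebra n k, ∃ b ∈ initialSubalgebra n k, x = a + b * vec (stdVec k) := by
  induction hx using Algebra.adjoin_induction with
  | mem x hx =>
    obtain ⟨l, hl, rfl⟩ := hx
    rcases Nat.lt_succ_iff_lt_or_eq.1 hl with h | h
    · exact ⟨_, stdVec_mem_initialSubalgebra h, 0, zero_mem _, by simp⟩
    · obtain rfl : l = k := Fin.ext h
      exact ⟨0, zero_mem _, 1, one_mem _, by simp⟩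
  | algebraMap r => exact ⟨_, Subalgebra.algebraMap_mem _ r, 0, zero_mem _, by simp⟩
  | add x y _ _ hx hy =>
    obtain ⟨a, ha, b, hb, rfl⟩ := hx
    obtain ⟨c, hc, d, hd, rfl⟩ := hy
    exact ⟨a + c, add_mem ha hc, b + d, add_mem hb hd, by rw [add_mul]; abel⟩
  | mul x y _ _ hx hy =>
    obtain ⟨a, ha, b, hb, rfl⟩ := hx
    obtain ⟨c, hc, d, hd, rfl⟩ := hy
    refine ⟨a * c - b * involute d,
      sub_mem (mul_mem ha hc) (mul_mem hb (involute_mem_initialSubalgebra hd)),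
      a * d + b * involute c,
      add_mem (mul_mem ha hd) (mul_mem hb (involute_mem_initialSubalgebra hc)), ?_⟩
    have h1 := stdVec_mul_of_mem_initialSubalgebra hc
    have h2 := stdVec_mul_of_mem_initialSubalgebra hd
    have h3 := stdVec_mul_self k
    calc (a + b * vec (stdVec k)) * (c + d * vec (stdVec k))
        = a * c + a * d * vec (stdVec k) + b * (vec (stdVec k) * c) +
          b * (vec (stdVec k) * d) * vec (stdVec k) := by noncomm_ring
      _ = a * c + a * d * vec (stdVec k) + b * (involute c * vec (stdVec k)) +
          b * involute d * (vec (stdVec k) * vec (stdVec k)) := by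
            rw [h1, h2]; noncomm_ring
      _ = _ := by rw [h3]; noncomm_ring

/-- For `x = a + b e_k` the two sides of the hypothesis differ by twice the involute of `b`, which
forces `b = 0`. -/
theorem mem_initialSubalgebra_of_involute_mul {k : Fin n} {x : Cl n}
    (hx : x ∈ initialSubalgebra n (k + 1))
    (h : involute x * vec (stdVec k) = vec (stdVec k) * x) : x ∈ initialSubalgebra n k := by
  obtain ⟨a, ha, b, hb, rfl⟩ := exists_of_mem_initialSubalgebra_succ hx
  have h1 := stdVec_mul_of_mem_initialSubalgebra ha
  have h2 := stdVec_mul_of_mem_initialSubalgebra hb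
  have h3 := stdVec_mul_self k
  have h4 : (2 : ℝ) • involute b = 0 := by
    have e1 : involute (a + b * vec (stdVec k)) * vec (stdVec k) =
        involute a * vec (stdVec k) + involute b := by
      rw [map_add, map_mul, involute_ι, add_mul, mul_assoc, neg_mul, h3]
      simp
    have e2 : vec (stdVec k) * (a + b * vec (stdVec k)) =
        involute a * vec (stdVec k) - involute b := by
      rw [mul_add, h1, ← mul_assoc, h2, mul_assoc, h3]
      simp [sub_eq_add_neg]
    rw [e1, e2] at h
    rw [two_smul]
    have := congrArg (fun y => y - (involute a * vec (stdVec k) - involute b)) h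
    simpa using this
  have h5 : involute b = 0 := by simpa using h4
  have h6 : b = 0 := by
    have := congrArg involute h5
    simpa using this
  simpa [h6] using ha

theorem initialSubalgebra_eq_top : initialSubalgebra n n = ⊤ := by
  rw [eq_top_iff, ← CliffordAlgebra.adjoin_range_ι]
  refine Algebra.adjoin_le ?_
  rintro _ ⟨v, rfl⟩
  have hv : v = ∑ k, v k • stdVec k := by
    ext i
    simp [Pi.single_apply]
  rw [hv, map_sum]
  refine sum_mem fun k _ => ?_
  rw [map_smul]
  exact Subalgebra.smul_mem _ (stdVec_mem_initialSubalgebra k.2) _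

/-- An element of the twisted centre of the Clifford algebra is a scalar. -/
theorem exists_eq_algebraMap_of_involute_mul {x : Cl n}
    (h : ∀ v : Euc n, involute x * vec v = vec v * x) : ∃ c : ℝ, x = algebraMap ℝ (Cl n) c := by
  -- The generators are removed one at a time, starting with the last; after `n` steps only scalars
  -- are left.
  have key : ∀ j : ℕ, j ≤ n → x ∈ initialSubalgebra n (n - j) := by
    intro j
    induction j with
    | zero => intro _; rw [Nat.sub_zero, initialSubalgebra_eq_top]; trivial
    | succ j ih =>
      intro hj
      have hk : n - (j + 1) < n := by omega
      refine mem_initialSubalgebra_of_involute_mul (k := ⟨n - (j + 1), hk⟩) ?_ (h _)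
      have : n - (j + 1) + 1 = n - j := by omega
      simpa [this] using ih (by omega)
  have h0 := key n le_rfl
  have hb : initialSubalgebra n (n - n) = ⊥ := by simp [initialSubalgebra]
  rw [hb, Algebra.mem_bot] at h0
  obtain ⟨c, hc⟩ := h0
  exact ⟨c, hc.symm⟩

theorem star_vec (v : Euc n) : star (vec v) = -vec v := by
  rw [CliffordAlgebra.star_def, involute_ι, map_neg, reverse_ι]

theorem vec_mem_pinGroup {v : Euc n} (h : ‖v‖ = 1) : vec v ∈ pinGroup (negQ n) := by
  have h1 := vec_mul_self_of_norm_one h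
  rw [pinGroup.mem_iff]
  refine ⟨?_, ?_⟩
  · let u : (Cl n)ˣ := ⟨vec v, -vec v, by simp [h1], by simp [h1]⟩
    refine ⟨u, Subgroup.subset_closure ⟨v, rfl⟩, rfl⟩
  · rw [Unitary.mem_iff, star_vec]
    simp [h1]

/-- Every isometry of `ℝⁿ` is the twisted action of a homogeneous element of the pin group. -/
theorem exists_pin_lift (R : Euc n ≃ₗᵢ[ℝ] Euc n) :
    ∃ p ∈ pinGroup (negQ n), (∃ i, p ∈ evenOdd (negQ n) i) ∧
      ∀ v, involute p * vec v = vec (R v) * p := by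
  -- Cartan–Dieudonné: `R` is a product of reflections, and the reflection in the hyperplane
  -- orthogonal to a unit vector is the twisted action of that vector.
  obtain ⟨l, -, rfl⟩ := R.reflections_generate_dim
  induction l with
  | nil => exact ⟨1, one_mem _, ⟨0, SetLike.one_mem_graded _⟩, fun v => by simp⟩
  | cons u l ih =>
    obtain ⟨p, hp, ⟨i, hi⟩, hpv⟩ := ih
    rw [List.map_cons, List.prod_cons]
    -- The list of reflecting vectors may contain `0`, whose "reflection" is the identity.
    by_cases hu : u = 0
    · refine ⟨p, hp, ⟨i, hi⟩, fun v => ?_⟩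
      rw [hpv]
      congr 2
      rw [LinearIsometryEquiv.coe_mul, Function.comp_apply]
      subst hu
      have : (Submodule.span ℝ {(0 : Euc n)})ᗮ = ⊤ := by simp
      rw [eq_comm, Submodule.reflection_eq_self_iff, this]
      trivial
    · have hw : ‖(‖u‖⁻¹ • u)‖ = 1 := by
        rw [norm_smul, norm_inv, norm_norm, inv_mul_cancel₀ (norm_ne_zero_iff.2 hu)]
      set w := ‖u‖⁻¹ • u with hwdef
      have hrefl : ∀ v, Submodule.reflection (ℝ ∙ u)ᗮ v = v - (2 * inner ℝ w v) • w := by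
        intro v
        rw [Submodule.reflection_orthogonal_apply, Submodule.reflection_singleton_apply, hwdef,
          real_inner_smul_left, ← Nat.cast_smul_eq_nsmul ℝ 2, smul_smul, smul_smul, neg_sub]
        congr 2
        simp only [RCLike.ofReal_real_eq_id, id]
        push_cast
        field_simp
      clear_value w
      refine ⟨vec w * p, mul_mem (vec_mem_pinGroup hw) hp,
        ⟨1 + i, SetLike.mul_mem_graded (ι_mem_evenOdd_one _ _) hi⟩, fun v => ?_⟩
      rw [map_mul, mul_assoc, hpv, LinearIsometryEquiv.coe_mul, Function.comp_apply, hrefl]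
      set x := (List.map (fun v => (ℝ ∙ v)ᗮ.reflection) l).prod v
      have h1 := vec_mul_vec_add_swap w x
      have h2 := vec_mul_self_of_norm_one hw
      rw [involute_vec, ← mul_assoc, ← mul_assoc]
      congr 1
      rw [vec_sub, vec_smul, sub_mul, smul_mul_assoc, h2, neg_mul,
        eq_sub_of_add_eq h1, Algebra.algebraMap_eq_smul_one]
      module

/-- The quotient `star p * q` lies in the twisted centre, hence is a real scalar; being unitary, it
squares to `1`. -/
theorem eq_or_eq_neg_of_twisted_action_eq {p q : Cl n} (hp : p ∈ pinGroup (negQ n))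
    (hq : q ∈ pinGroup (negQ n)) {R : Euc n → Euc n}
    (hpR : ∀ v, involute p * vec v = vec (R v) * p)
    (hqR : ∀ v, involute q * vec v = vec (R v) * q) : q = p ∨ q = -p := by
  have h1 : star p * p = 1 := pinGroup.star_mul_self_of_mem hp
  have h2 : p * star p = 1 := pinGroup.mul_star_self_of_mem hp
  have h3 : star q * q = 1 := pinGroup.star_mul_self_of_mem hq
  have h4 : involute (star p) * involute p = 1 := by rw [← map_mul, h1, map_one]
  obtain ⟨c, hc⟩ := exists_eq_algebraMap_of_involute_mul (x := star p * q) (fun v => by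
    have e : vec v * star p = involute (star p) * vec (R v) := by
      calc vec v * star p = involute (star p) * (involute p * vec v) * star p := by
            rw [← mul_assoc, h4, one_mul]
        _ = involute (star p) * vec (R v) * (p * star p) := by rw [hpR]; simp only [mul_assoc]
        _ = _ := by rw [h2, mul_one]
    rw [map_mul, mul_assoc, hqR, ← mul_assoc, ← mul_assoc, e])
  have hq' : q = algebraMap ℝ (Cl n) c * p := by
    rw [← hc, hc, Algebra.commutes, ← hc, ← mul_assoc, h2, one_mul]
  have hcc : c * c = 1 := by
    apply algebraMap_cl_injective (n := n)
    rw [map_mul, map_one]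
    calc algebraMap ℝ (Cl n) c * algebraMap ℝ (Cl n) c
        = star (star p * q) * (star p * q) := by
          rw [hc, CliffordAlgebra.star_def]; simp
      _ = star q * (p * star p) * q := by rw [star_mul, star_star]; simp only [mul_assoc]
      _ = 1 := by rw [h2, mul_one, h3]
  rcases mul_self_eq_one_iff.1 hcc with rfl | rfl
  · left; simpa using hq'
  · right; simpa using hq'

theorem spin_coe_mul_inv (g : Spin n) : (g : Cl n) * ((g⁻¹ : Spin n) : Cl n) = 1 := by
  rw [← Submonoid.coe_mul, mul_inv_cancel, Submonoid.coe_one]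

theorem spin_inv_mul_coe (g : Spin n) : ((g⁻¹ : Spin n) : Cl n) * (g : Cl n) = 1 := by
  rw [← Submonoid.coe_mul, inv_mul_cancel, Submonoid.coe_one]

/-- The action of `Spin(n)` on `ℝⁿ`. -/
theorem exists_rotation (g : Spin n) :
    ∃ R : Euc n ≃ₗᵢ[ℝ] Euc n, ∀ v, (g : Cl n) * vec v = vec (R v) * g := by
  have h1 : ∀ v : Euc n, ∃ w : Euc n, vec w = (g : Cl n) * vec v * ((g⁻¹ : Spin n) : Cl n) := by
    intro v
    have := spinGroup.conjAct_smul_ι_mem_range_ι (x := spinGroup.toUnits g) g.2 v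
    rw [ConjAct.units_smul_def] at this
    exact this
  choose R hR using h1
  have hadd : ∀ v w, R (v + w) = R v + R w := fun v w => vec_injective (by
    simp only [hR, map_add, mul_add, add_mul])
  have hsmul : ∀ (c : ℝ) v, R (c • v) = c • R v := fun c v => vec_injective (by
    simp only [hR, map_smul, mul_smul_comm, smul_mul_assoc])
  have hnorm : ∀ v, ‖R v‖ = ‖v‖ := by
    intro v
    have h2 : algebraMap ℝ (Cl n) (-‖R v‖ ^ 2) = algebraMap ℝ (Cl n) (-‖v‖ ^ 2) := by
      rw [← vec_mul_self, hR]
      calc (g : Cl n) * vec v * ((g⁻¹ : Spin n) : Cl n) *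
            ((g : Cl n) * vec v * ((g⁻¹ : Spin n) : Cl n))
          = (g : Cl n) * vec v * (((g⁻¹ : Spin n) : Cl n) * (g : Cl n)) * vec v *
            ((g⁻¹ : Spin n) : Cl n) := by simp only [mul_assoc]
        _ = (g : Cl n) * (vec v * vec v) * ((g⁻¹ : Spin n) : Cl n) := by
          rw [spin_inv_mul_coe, mul_one]; simp only [mul_assoc]
        _ = _ := by
          rw [vec_mul_self, ← Algebra.commutes, mul_assoc, spin_coe_mul_inv, mul_one]
    have h3 := algebraMap_cl_injective h2
    have h4 : ‖R v‖ ^ 2 = ‖v‖ ^ 2 := by linarith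
    exact (sq_eq_sq₀ (norm_nonneg _) (norm_nonneg _)).1 h4
  let L : Euc n →ₗᵢ[ℝ] Euc n := ⟨⟨⟨R, hadd⟩, hsmul⟩, hnorm⟩
  refine ⟨L.toLinearIsometryEquiv rfl, fun v => ?_⟩
  have : vec (L v) = (g : Cl n) * vec v * ((g⁻¹ : Spin n) : Cl n) := hR v
  simp only [LinearIsometry.coe_toLinearIsometryEquiv, this, mul_assoc, spin_inv_mul_coe, mul_one]

theorem spin_eq_or_eq_neg {g h : Spin n} {R : Euc n → Euc n}
    (hg : ∀ v, (g : Cl n) * vec v = vec (R v) * g) (hh : ∀ v, (h : Cl n) * vec v = vec (R v) * h) :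
    (h : Cl n) = g ∨ (h : Cl n) = -g := by
  refine eq_or_eq_neg_of_twisted_action_eq (spinGroup.mem_pin g.2) (spinGroup.mem_pin h.2)
    (R := R) ?_ ?_
  · simpa only [spinGroup.involute_eq g.2] using hg
  · simpa only [spinGroup.involute_eq h.2] using hh

theorem mem_spinGroup_of_mem_pinGroup {p : Cl n} (hp : p ∈ pinGroup (negQ n))
    (he : p ∈ evenOdd (negQ n) 0) : p ∈ spinGroup (negQ n) :=
  ⟨hp, he⟩

end Clifford

/-! ### Spin structures on the translation lattice -/

section SpinStructure

variable {n : ℕ} {Γ : Subgroup (Isom n)} {ε : Γ →* Spin n}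

theorem IsSpinStructure.mul_vec (hε : IsSpinStructure ε) (γ : Γ) (v : Euc n) :
    (ε γ : Cl n) * vec v = vec (rot Γ γ v) * ε γ := by
  rw [← hε γ v, mul_assoc, spin_inv_mul_coe, mul_one]

/-- A translation has trivial linear part, so its lift acts on vectors as `1` does. -/
theorem IsSpinStructure.latt_eq (hε : IsSpinStructure ε) {γ : Γ} (hγ : γ ∈ latt Γ) :
    (ε γ : Cl n) = 1 ∨ (ε γ : Cl n) = -1 := by
  have h := spin_eq_or_eq_neg (g := 1) (h := ε γ) (R := fun v => v) (by simp) (fun v => by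
    have h1 := hε.mul_vec γ v
    rw [MonoidHom.mem_ker.1 hγ] at h1
    simpa using h1)
  simpa using h

end SpinStructure

/-! ### Normal form of an orthogonal transformation -/

section NormalForm

variable {E : Type*} [NormedAddCommGroup E] [InnerProductSpace ℝ E]

/-- In the orthonormal pair `(v, w)`, `B` acts as the rotation by the angle `θ`. -/
def RotatesPlane (B : E ≃ₗᵢ[ℝ] E) (v w : E) (θ : ℝ) : Prop :=
  B v = Real.cos θ • v + Real.sin θ • w ∧ B w = -Real.sin θ • v + Real.cos θ • w

/-- `B` rotates the planes spanned by the consecutive pairs of the family `b`, and fixes the last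
member if their number is odd. -/
def RotatesPairs (B : E ≃ₗᵢ[ℝ] E) {n : ℕ} (b : Fin n → E) (θ : ℕ → ℝ) : Prop :=
  (∀ (j : ℕ) (h : 2 * j + 1 < n),
    RotatesPlane B (b ⟨2 * j, by omega⟩) (b ⟨2 * j + 1, h⟩) (θ j)) ∧
  ∀ (j : ℕ) (h : 2 * j < n), n = 2 * j + 1 → B (b ⟨2 * j, h⟩) = b ⟨2 * j, h⟩

/-- Applying `B` to the eigenvector equation gives `B²v = 2c Bv - v` with `c = ⟨Bv, v⟩`, so `v` and
`Bv` span an invariant plane. The second vector is the normalized component of `Bv` orthogonal to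
`v`, and the angle is `arccos c`, whose sine is the non-negative number `‖d‖`. -/
theorem rotatesPlane_of_eigenvector {B : E ≃ₗᵢ[ℝ] E} {v : E} {a : ℝ} (hv : ‖v‖ = 1)
    (hva : B v + B.symm v = a • v) (hne : B v ≠ inner ℝ (B v) v • v) :
    ∃ w ∈ Submodule.span ℝ {v, B v}, ∃ θ : ℝ, ‖w‖ = 1 ∧ inner ℝ v w = 0 ∧
      RotatesPlane B v w θ := by
  set c : ℝ := inner ℝ (B v) v with hc
  have hvv : inner ℝ v v = (1 : ℝ) := by rw [real_inner_self_eq_norm_sq, hv]; norm_num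
  have h1 : inner ℝ (B.symm v) v = c := by
    rw [hc, ← B.inner_map_map, B.apply_symm_apply, real_inner_comm]
  have ha : a = 2 * c := by
    have := congrArg (fun x => inner ℝ x v) hva
    simp only [inner_add_left, real_inner_smul_left, h1, hvv] at this
    linarith
  have hB2 : B (B v) = (2 * c) • B v - v := by
    have := congrArg B hva
    rw [map_add, B.apply_symm_apply, map_smul, ha] at this
    rw [← this]; abel
  set d := B v - c • v with hd
  have hd0 : d ≠ 0 := sub_ne_zero.2 hne
  have hs : ‖d‖ ≠ 0 := norm_ne_zero_iff.2 hd0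
  have hdv : inner ℝ v d = (0 : ℝ) := by
    rw [hd, inner_sub_right, real_inner_smul_right, hvv, real_inner_comm, ← hc]; ring
  have hBv : B v = c • v + d := by rw [hd]; abel
  have hcs : c ^ 2 + ‖d‖ ^ 2 = 1 := by
    have h2 : ‖B v‖ ^ 2 = 1 := by rw [B.norm_map, hv]; norm_num
    rw [hBv, norm_add_sq_real, real_inner_smul_left, hdv, norm_smul, hv] at h2
    simp at h2
    linarith
  have hcle : -1 ≤ c ∧ c ≤ 1 := abs_le.1 ((sq_le_one_iff_abs_le_one c).1 (by nlinarith [sq_nonneg ‖d‖]))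
  have hcos : Real.cos (Real.arccos c) = c := Real.cos_arccos hcle.1 hcle.2
  have hsin : Real.sin (Real.arccos c) = ‖d‖ := by
    rw [Real.sin_arccos, show 1 - c ^ 2 = ‖d‖ ^ 2 by linarith, Real.sqrt_sq (norm_nonneg _)]
  refine ⟨‖d‖⁻¹ • d, ?_, Real.arccos c, ?_, ?_, ?_, ?_⟩
  · refine Submodule.smul_mem _ _ (Submodule.sub_mem _ (Submodule.subset_span (by simp))
      (Submodule.smul_mem _ _ (Submodule.subset_span (by simp))))
  · rw [norm_smul, norm_inv, norm_norm, inv_mul_cancel₀ hs]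
  · rw [real_inner_smul_right, hdv, mul_zero]
  · rw [hcos, hsin, smul_smul, mul_inv_cancel₀ hs, one_smul, hBv]
  · rw [hcos, hsin, map_smul, smul_smul]
    have h3 : B d = c • d + (c ^ 2 - 1) • v := by
      rw [hd, map_sub, map_smul, hB2, hBv]
      module
    have h4 : c ^ 2 - 1 = -‖d‖ * ‖d‖ := by linarith
    rw [h3, h4, smul_add, smul_smul, smul_smul, add_comm]
    congr 2
    · field_simp
    · ring

/-- The operator `B + B⁻¹` is symmetric and can be diagonalized on `K`. An eigenvector of it that is
not one of `B` spans a rotated plane with its image. Otherwise `B` is `±1` on the whole eigenbasis,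
and two vectors with equal signs span a plane rotated by `0` or `π`. Only a plane with two different
signs escapes, whence the second alternative. -/
theorem exists_rotatesPlane [FiniteDimensional ℝ E] {B : E ≃ₗᵢ[ℝ] E} {K : Submodule ℝ E} {n : ℕ}
    (hn : Module.finrank ℝ K = n + 2) (hK : ∀ x ∈ K, B x ∈ K) (hK' : ∀ x ∈ K, B.symm x ∈ K) :
    (∃ v ∈ K, ∃ w ∈ K, ∃ θ : ℝ, ‖v‖ = 1 ∧ ‖w‖ = 1 ∧ inner ℝ v w = 0 ∧ RotatesPlane B v w θ) ∨
    (n = 0 ∧ ∃ v ∈ K, ∃ w ∈ K, ‖v‖ = 1 ∧ ‖w‖ = 1 ∧ inner ℝ v w = 0 ∧ B v = v ∧ B w = -w) := by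
  let B₀ : E →ₗ[ℝ] E := B.toLinearEquiv
  let B₁ : E →ₗ[ℝ] E := B.symm.toLinearEquiv
  let T : K →ₗ[ℝ] K := B₀.restrict hK + B₁.restrict hK'
  have hTapp : ∀ x : K, ((T x : K) : E) = B x + B.symm x := fun x => rfl
  have hT : T.IsSymmetric := by
    intro x y
    have e1 : inner ℝ (B x) (y : E) = inner ℝ (x : E) (B.symm y) := by
      rw [← B.inner_map_map x, B.apply_symm_apply]
    have e2 : inner ℝ (B.symm x) (y : E) = inner ℝ (x : E) (B y) := by
      rw [← B.inner_map_map, B.apply_symm_apply]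
    rw [Submodule.coe_inner, Submodule.coe_inner, hTapp, hTapp, inner_add_left, inner_add_right,
      e1, e2, add_comm]
  let b := hT.eigenvectorBasis hn
  have hb : ∀ i, B (b i : E) + B.symm (b i : E) = hT.eigenvalues hn i • (b i : E) := by
    intro i
    have := hT.apply_eigenvectorBasis hn i
    rw [← hTapp, this]
    rfl
  have hnorm : ∀ i, ‖(b i : E)‖ = 1 := fun i => b.orthonormal.1 i
  have hinner : ∀ i j, i ≠ j → inner ℝ (b i : E) (b j : E) = (0 : ℝ) :=
    fun i j hij => b.orthonormal.2 hij
  by_cases h : ∃ i, B (b i : E) ≠ inner ℝ (B (b i : E)) (b i : E) • (b i : E)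
  · obtain ⟨i, hi⟩ := h
    obtain ⟨w, hw, θ, h1, h2, h3⟩ := rotatesPlane_of_eigenvector (hnorm i) (hb i) hi
    refine Or.inl ⟨b i, (b i).2, w, ?_, θ, hnorm i, h1, h2, h3⟩
    refine Submodule.span_le.2 ?_ hw
    rintro x (rfl | rfl)
    · exact (b i).2
    · exact hK _ (b i).2
  · push Not at h
    have hpm : ∀ i, B (b i : E) = (b i : E) ∨ B (b i : E) = -(b i : E) := by
      intro i
      have h1 : ‖B (b i : E)‖ = 1 := by rw [B.norm_map, hnorm]
      rw [h i, norm_smul, hnorm, mul_one, Real.norm_eq_abs] at h1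
      rcases eq_or_eq_neg_of_abs_eq h1 with h2 | h2
      · left; rw [h i, h2, one_smul]
      · right; rw [h i, h2, neg_smul, one_smul]
    have hplus : ∀ i j, i ≠ j → B (b i : E) = (b i : E) → B (b j : E) = (b j : E) →
        ∃ v ∈ K, ∃ w ∈ K, ∃ θ : ℝ, ‖v‖ = 1 ∧ ‖w‖ = 1 ∧ inner ℝ v w = 0 ∧
          RotatesPlane B v w θ := fun i j hij hi hj =>
      ⟨b i, (b i).2, b j, (b j).2, 0, hnorm i, hnorm j, hinner i j hij, by simp [hi], by simp [hj]⟩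
    have hminus : ∀ i j, i ≠ j → B (b i : E) = -(b i : E) → B (b j : E) = -(b j : E) →
        ∃ v ∈ K, ∃ w ∈ K, ∃ θ : ℝ, ‖v‖ = 1 ∧ ‖w‖ = 1 ∧ inner ℝ v w = 0 ∧
          RotatesPlane B v w θ := fun i j hij hi hj =>
      ⟨b i, (b i).2, b j, (b j).2, Real.pi, hnorm i, hnorm j, hinner i j hij,
        by simp [hi], by simp [hj]⟩
    have h01 : (0 : Fin (n + 2)) ≠ 1 := by simp
    rcases Nat.eq_zero_or_pos n with rfl | hpos
    · rcases hpm 0 with h0 | h0 <;> rcases hpm 1 with h1 | h1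
      · exact Or.inl (hplus 0 1 h01 h0 h1)
      · exact Or.inr ⟨rfl, b 0, (b 0).2, b 1, (b 1).2, hnorm 0, hnorm 1, hinner 0 1 h01, h0, h1⟩
      · exact Or.inr ⟨rfl, b 1, (b 1).2, b 0, (b 0).2, hnorm 1, hnorm 0, hinner 1 0 h01.symm,
          h1, h0⟩
      · exact Or.inl (hminus 0 1 h01 h0 h1)
    -- Among three signs two agree.
    · left
      have h02 : (0 : Fin (n + 2)) ≠ ⟨2, by omega⟩ := by simp [Fin.ext_iff]
      have h12 : (1 : Fin (n + 2)) ≠ ⟨2, by omega⟩ := by simp [Fin.ext_iff]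
      rcases hpm 0 with h0 | h0 <;> rcases hpm 1 with h1 | h1 <;>
        rcases hpm ⟨2, by omega⟩ with h2 | h2
      · exact hplus _ _ h01 h0 h1
      · exact hplus _ _ h01 h0 h1
      · exact hplus _ _ h02 h0 h2
      · exact hminus _ _ h12 h1 h2
      · exact hplus _ _ h12 h1 h2
      · exact hminus _ _ h02 h0 h2
      · exact hminus _ _ h01 h0 h1
      · exact hminus _ _ h01 h0 h1

theorem orthonormal_cons {n : ℕ} {v : E} {b : Fin n → E} (hv : ‖v‖ = 1)
    (hb : Orthonormal ℝ b) (h : ∀ i, inner ℝ v (b i) = (0 : ℝ)) :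
    Orthonormal ℝ (Fin.cons v b : Fin (n + 1) → E) := by
  rw [orthonormal_iff_ite] at hb ⊢
  intro i j
  refine Fin.cases ?_ (fun i => ?_) i <;> refine Fin.cases ?_ (fun j => ?_) j
  · simp [hv]
  · simpa [Fin.succ_ne_zero, eq_comm] using h j
  · simpa [Fin.succ_ne_zero, real_inner_comm] using h i
  · simpa using hb i j

theorem RotatesPairs.cons {B : E ≃ₗᵢ[ℝ] E} {n : ℕ} {b : Fin n → E} {θ : ℕ → ℝ} {v w : E} {η : ℝ}
    (h : RotatesPairs B b θ) (hvw : RotatesPlane B v w η) :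
    RotatesPairs B (Fin.cons v (Fin.cons w b : Fin (n + 1) → E) : Fin (n + 2) → E)
      (fun j => Nat.casesOn j η θ) := by
  refine ⟨fun j hj => ?_, fun j hj hn => ?_⟩
  · cases j with
    | zero => exact hvw
    | succ j => exact h.1 j (by omega)
  · cases j with
    | zero => omega
    | succ j => exact h.2 j (by omega) (by omega)

theorem reflection_eq_self_of_inner_eq_zero {c x : E} (h : inner ℝ c x = (0 : ℝ)) :
    Submodule.reflection (ℝ ∙ c)ᗮ x = x := by
  rw [Submodule.reflection_eq_self_iff, Submodule.mem_orthogonal_singleton_iff_inner_right]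
  exact h

/-- Normal form of an orthogonal transformation on an invariant subspace, up to a reflection. -/
theorem exists_rotatesPairs [FiniteDimensional ℝ E] (B : E ≃ₗᵢ[ℝ] E) (n : ℕ) : ∀ (K : Submodule ℝ E),
    Module.finrank ℝ K = n → (∀ x ∈ K, B x ∈ K) → (∀ x ∈ K, B.symm x ∈ K) →
    ∃ (b : Fin n → E) (θ : ℕ → ℝ), Orthonormal ℝ b ∧ (∀ i, b i ∈ K) ∧
      (RotatesPairs B b θ ∨
        ∃ c ∈ K, ‖c‖ = 1 ∧ RotatesPairs (B * Submodule.reflection (ℝ ∙ c)ᗮ) b θ) := by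
  induction n using Nat.twoStepInduction with
  | zero =>
    intro K _ _ _
    refine ⟨Fin.elim0, 0, ⟨fun i => i.elim0, fun i => i.elim0⟩, fun i => i.elim0, Or.inl ⟨?_, ?_⟩⟩
    · intro j h; omega
    · intro j h; omega
  | one =>
    intro K hn hK _
    obtain ⟨⟨x, hx⟩, hx0, hspan⟩ := finrank_eq_one_iff'.1 hn
    have hx0' : x ≠ 0 := fun h => hx0 (Subtype.ext h)
    set v := ‖x‖⁻¹ • x with hv
    have hv1 : ‖v‖ = 1 := by
      rw [hv, norm_smul, norm_inv, norm_norm, inv_mul_cancel₀ (norm_ne_zero_iff.2 hx0')]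
    have hvK : v ∈ K := K.smul_mem _ hx
    obtain ⟨a, ha⟩ : ∃ a : ℝ, B v = a • v := by
      obtain ⟨a, ha⟩ := hspan ⟨B x, hK x hx⟩
      refine ⟨a, ?_⟩
      have : a • x = B x := congrArg Subtype.val ha
      rw [hv, map_smul, ← this, smul_comm]
    have ha1 : |a| = 1 := by
      have : ‖B v‖ = 1 := by rw [B.norm_map, hv1]
      rwa [ha, norm_smul, hv1, mul_one] at this
    refine ⟨fun _ => v, 0, ⟨fun _ => hv1, fun i j hij => absurd (Subsingleton.elim i j) hij⟩,
      fun _ => hvK, ?_⟩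
    rcases eq_or_eq_neg_of_abs_eq ha1 with h | h
    · left
      refine ⟨fun j hj => by omega, fun j hj _ => ?_⟩
      change B v = v
      rw [ha, h, one_smul]
    · right
      refine ⟨v, hvK, hv1, fun j hj => by omega, fun j hj _ => ?_⟩
      change B (Submodule.reflection (ℝ ∙ v)ᗮ v) = v
      rw [Submodule.reflection_orthogonalComplement_singleton_eq_neg, map_neg, ha, h]
      simp
  | more n ih _ =>
    intro K hn hK hK'
    -- A rotated plane `P` is split off, and the induction continues on its complement in `K`.
    rcases exists_rotatesPlane hn hK hK' with
      ⟨v, hv, w, hw, θ, hv1, hw1, hvw, hr⟩ | ⟨rfl, v, hv, w, hw, hv1, hw1, hvw, hBv, hBw⟩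
    · have hr' : B.symm v = Real.cos θ • v - Real.sin θ • w ∧
          B.symm w = Real.sin θ • v + Real.cos θ • w := by
        have hcs := Real.cos_sq_add_sin_sq θ
        constructor <;> rw [LinearIsometryEquiv.symm_apply_eq]
        · rw [map_sub, map_smul, map_smul, hr.1, hr.2]
          have : v = (Real.cos θ ^ 2 + Real.sin θ ^ 2) • v := by rw [hcs, one_smul]
          nth_rewrite 1 [this]
          module
        · rw [map_add, map_smul, map_smul, hr.1, hr.2]
          have : w = (Real.cos θ ^ 2 + Real.sin θ ^ 2) • w := by rw [hcs, one_smul]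
          nth_rewrite 1 [this]
          module
      let P : Submodule ℝ E := Submodule.span ℝ (Set.range ![v, w])
      have hon : Orthonormal ℝ ![v, w] := by
        rw [orthonormal_iff_ite]
        intro i j
        fin_cases i <;> fin_cases j <;> simp [hv1, hw1, hvw, real_inner_comm v w]
      have hPK : P ≤ K := by
        refine Submodule.span_le.2 ?_
        rintro _ ⟨i, rfl⟩
        fin_cases i
        · exact hv
        · exact hw
      have hPfin : Module.finrank ℝ P = 2 := by
        rw [finrank_span_eq_card hon.linearIndependent, Fintype.card_fin]
      have hmem : ∀ x, x ∈ Pᗮ ↔ inner ℝ v x = (0 : ℝ) ∧ inner ℝ w x = (0 : ℝ) := by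
        intro x
        constructor
        · intro h
          exact ⟨h v (Submodule.subset_span ⟨0, rfl⟩), h w (Submodule.subset_span ⟨1, rfl⟩)⟩
        · rintro ⟨h1, h2⟩ y hy
          induction hy using Submodule.span_induction with
          | mem y hy =>
            obtain ⟨i, rfl⟩ := hy
            fin_cases i
            · exact h1
            · exact h2
          | zero => simp
          | add y z _ _ hy hz => rw [inner_add_left, hy, hz, add_zero]
          | smul a y _ hy => rw [real_inner_smul_left, hy, mul_zero]
      have hfin : Module.finrank ℝ (Pᗮ ⊓ K : Submodule ℝ E) = n := by
        have := Submodule.finrank_add_inf_finrank_orthogonal hPK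
        omega
      obtain ⟨b, φ, hb, hbK, hB⟩ := ih (Pᗮ ⊓ K) hfin (by
          rintro x ⟨hx, hxK⟩
          refine ⟨(hmem _).2 ?_, hK x hxK⟩
          obtain ⟨h1, h2⟩ := (hmem _).1 hx
          rw [← B.symm.inner_map_map, ← B.symm.inner_map_map w, B.symm_apply_apply, hr'.1, hr'.2,
            inner_sub_left, inner_add_left]
          simp only [real_inner_smul_left, h1, h2, mul_zero, sub_zero, add_zero, and_self]) (by
          rintro x ⟨hx, hxK⟩
          refine ⟨(hmem _).2 ?_, hK' x hxK⟩
          obtain ⟨h1, h2⟩ := (hmem _).1 hx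
          rw [← B.inner_map_map, ← B.inner_map_map w, B.apply_symm_apply, hr.1, hr.2,
            inner_add_left, inner_add_left]
          simp only [real_inner_smul_left, h1, h2, mul_zero, add_zero, and_self])
      have hbP : ∀ i, inner ℝ v (b i) = (0 : ℝ) ∧ inner ℝ w (b i) = (0 : ℝ) :=
        fun i => (hmem _).1 (hbK i).1
      refine ⟨Fin.cons v (Fin.cons w b : Fin (n + 1) → E), fun j => Nat.casesOn j θ φ, ?_, ?_, ?_⟩
      · refine orthonormal_cons hv1 (orthonormal_cons hw1 hb fun i => (hbP i).2) fun i => ?_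
        refine Fin.cases ?_ (fun i => ?_) i
        · simpa using hvw
        · simpa using (hbP i).1
      · intro i
        refine Fin.cases ?_ (fun i => ?_) i
        · simpa using hv
        · refine Fin.cases ?_ (fun i => ?_) i
          · simpa using hw
          · simpa using (hbK i).2
      · rcases hB with hB | ⟨c, hc, hc1, hB⟩
        · exact Or.inl (hB.cons hr)
        -- The reflecting vector is orthogonal to `P`, so the reflection leaves the plane just split
        -- off untouched.
        · refine Or.inr ⟨c, hc.2, hc1, hB.cons ?_⟩
          obtain ⟨h1, h2⟩ := (hmem _).1 hc.1
          rw [real_inner_comm] at h1 h2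
          refine ⟨?_, ?_⟩
          · rw [LinearIsometryEquiv.coe_mul, Function.comp_apply,
              reflection_eq_self_of_inner_eq_zero h1, hr.1]
          · rw [LinearIsometryEquiv.coe_mul, Function.comp_apply,
              reflection_eq_self_of_inner_eq_zero h2, hr.2]
    -- With signs `+` and `-`, composing with the reflection along the negative vector gives the
    -- identity of the plane.
    · refine ⟨![v, w], 0, ?_, ?_, Or.inr ⟨w, hw, hw1, ?_, fun j _ h => by omega⟩⟩
      · rw [orthonormal_iff_ite]
        intro i j
        fin_cases i <;> fin_cases j <;> simp [hv1, hw1, hvw]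
        rw [real_inner_comm]; exact hvw
      · intro i
        fin_cases i
        · exact hv
        · exact hw
      · intro j hj
        obtain rfl : j = 0 := by omega
        rw [real_inner_comm] at hvw
        refine ⟨?_, ?_⟩
        · change B (Submodule.reflection (ℝ ∙ w)ᗮ v) = Real.cos 0 • v + Real.sin 0 • w
          rw [reflection_eq_self_of_inner_eq_zero hvw, hBv]
          simp
        · change B (Submodule.reflection (ℝ ∙ w)ᗮ w) = -Real.sin 0 • v + Real.cos 0 • w
          rw [Submodule.reflection_orthogonalComplement_singleton_eq_neg, map_neg, hBw]
          simp

end NormalForm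

/-! ### Elements of the maximal torus -/

section Torus

open CliffordAlgebra

variable {n : ℕ}

/-- The factor `cos t + sin t e_{2j-1} e_{2j}` of a torus element. -/
def torusFactor (n j : ℕ) (t : ℝ) : Cl n :=
  if h : 2 * j + 1 < n then
    algebraMap ℝ (Cl n) (Real.cos t) + Real.sin t •
      (vec (stdVec (⟨2 * j, by omega⟩ : Fin n)) * vec (stdVec (⟨2 * j + 1, h⟩ : Fin n)))
  else 1

/-- The product of the first `m` factors of a torus element. -/
def torusProd (n : ℕ) (t : ℕ → ℝ) : ℕ → Cl n
  | 0 => 1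
  | m + 1 => torusProd n t m * torusFactor n m (t m)

theorem torusElt_eq_torusProd (t : ℕ → ℝ) :
    torusElt n (fun j => t j) = torusProd n t (n / 2) := by
  have key : ∀ m : ℕ, ∀ hm : m ≤ n / 2,
      (List.ofFn fun j : Fin m => algebraMap ℝ (Cl n) (Real.cos (t j)) +
        Real.sin (t j) • (vec (stdVec (⟨2 * j.1, by omega⟩ : Fin n)) *
        vec (stdVec (⟨2 * j.1 + 1, by omega⟩ : Fin n)))).prod = torusProd n t m := by
    intro m
    induction m with
    | zero => intro _; simp [torusProd]
    | succ m ih =>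
      intro hm
      rw [List.ofFn_succ_last, List.prod_append, List.prod_singleton, torusProd, ← ih (by omega)]
      congr 1
      rw [torusFactor, dif_pos (by omega)]
      rfl
  exact key _ le_rfl

theorem exists_nat_extension (t : Fin (n / 2) → ℝ) : ∃ t' : ℕ → ℝ, t = fun j : Fin (n / 2) => t' j :=
  ⟨fun j => if h : j < n / 2 then t ⟨j, h⟩ else 0, by ext j; simp⟩

/-- The element is the product of the unit vectors `v` and `-cos t v + sin t w`. -/
theorem cos_add_sin_mem_spinGroup {v w : Euc n} (hv : ‖v‖ = 1) (hw : ‖w‖ = 1)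
    (hvw : inner ℝ v w = (0 : ℝ)) (t : ℝ) :
    algebraMap ℝ (Cl n) (Real.cos t) + Real.sin t • (vec v * vec w) ∈ spinGroup (negQ n) := by
  set x : Euc n := -Real.cos t • v + Real.sin t • w with hx
  have hx1 : ‖x‖ = 1 := by
    have h : ‖x‖ ^ 2 = 1 := by
      rw [hx, norm_add_sq_real, real_inner_smul_left, real_inner_smul_right, hvw, norm_smul,
        norm_smul, hv, hw]
      simp
    exact (pow_eq_one_iff_of_nonneg (norm_nonneg _) two_ne_zero).1 h
  have he : algebraMap ℝ (Cl n) (Real.cos t) + Real.sin t • (vec v * vec w) = vec v * vec x := by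
    rw [hx, vec_add, vec_smul, vec_smul, mul_add, mul_smul_comm, mul_smul_comm,
      vec_mul_self_of_norm_one hv, Algebra.algebraMap_eq_smul_one]
    module
  rw [he]
  refine mem_spinGroup_of_mem_pinGroup (mul_mem (vec_mem_pinGroup hv) (vec_mem_pinGroup hx1)) ?_
  have := SetLike.mul_mem_graded (A := evenOdd (negQ n)) (ι_mem_evenOdd_one (negQ n) v)
    (ι_mem_evenOdd_one (negQ n) x)
  exact this

theorem torusFactor_mem_spinGroup (j : ℕ) (t : ℝ) : torusFactor n j t ∈ spinGroup (negQ n) := by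
  unfold torusFactor
  split_ifs with h
  · exact cos_add_sin_mem_spinGroup (by simp) (by simp) (inner_stdVec_of_ne (by simp)) t
  · exact one_mem _

theorem torusProd_mem_spinGroup (t : ℕ → ℝ) (m : ℕ) : torusProd n t m ∈ spinGroup (negQ n) := by
  induction m with
  | zero => exact one_mem _
  | succ m ih => exact mul_mem ih (torusFactor_mem_spinGroup _ _)

theorem vec_mul_vec_mul_comm {v w x : Euc n} (hv : inner ℝ v x = (0 : ℝ))
    (hw : inner ℝ w x = (0 : ℝ)) : vec v * vec w * vec x = vec x * (vec v * vec w) := by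
  rw [mul_assoc, vec_mul_vec_of_inner_eq_zero hw, mul_neg, ← mul_assoc,
    vec_mul_vec_of_inner_eq_zero hv, neg_mul, neg_neg, mul_assoc]

theorem torusFactor_mul_stdVec_of_ne {j : ℕ} {k : Fin n} (h0 : k.1 ≠ 2 * j)
    (h1 : k.1 ≠ 2 * j + 1) (t : ℝ) :
    torusFactor n j t * vec (stdVec k) = vec (stdVec k) * torusFactor n j t := by
  unfold torusFactor
  split_ifs with h
  · rw [add_mul, mul_add, Algebra.commutes, smul_mul_assoc, mul_smul_comm, vec_mul_vec_mul_comm]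
    · exact inner_stdVec_of_ne (fun e => h0 (by rw [← e]))
    · exact inner_stdVec_of_ne (fun e => h1 (by rw [← e]))
  · simp

/-- This is the double covering of the rotation group: the parameter `t` upstairs rotates the plane
by `2 * t`, because `e f` anticommutes with both `e` and `f`. -/
theorem torusFactor_mul_stdVec {j : ℕ} (h : 2 * j + 1 < n) (t : ℝ) :
    torusFactor n j t * vec (stdVec (⟨2 * j, by omega⟩ : Fin n)) =
      vec (Real.cos (2 * t) • stdVec (⟨2 * j, by omega⟩ : Fin n) +
        Real.sin (2 * t) • stdVec (⟨2 * j + 1, h⟩ : Fin n)) * torusFactor n j t ∧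
    torusFactor n j t * vec (stdVec (⟨2 * j + 1, h⟩ : Fin n)) =
      vec (-Real.sin (2 * t) • stdVec (⟨2 * j, by omega⟩ : Fin n) +
        Real.cos (2 * t) • stdVec (⟨2 * j + 1, h⟩ : Fin n)) * torusFactor n j t := by
  rw [torusFactor, dif_pos h]
  have he := stdVec_mul_self (⟨2 * j, by omega⟩ : Fin n)
  have hf := stdVec_mul_self (⟨2 * j + 1, h⟩ : Fin n)
  have hef := stdVec_mul_stdVec (k := (⟨2 * j + 1, h⟩ : Fin n)) (l := ⟨2 * j, by omega⟩)
    (by simp)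
  simp only [vec_add, vec_smul]
  generalize vec (stdVec (⟨2 * j, by omega⟩ : Fin n)) = e at *
  generalize vec (stdVec (⟨2 * j + 1, h⟩ : Fin n)) = f at *
  have h1 : e * f * e = f := by rw [mul_assoc, hef, mul_neg, ← mul_assoc, he]; simp
  have h2 : e * f * f = -e := by rw [mul_assoc, hf]; simp
  have h3 : e * (e * f) = -f := by rw [← mul_assoc, he]; simp
  have h4 : f * (e * f) = e := by rw [← mul_assoc, hef, neg_mul, h2, neg_neg]
  have hcs := Real.cos_sq_add_sin_sq t
  rw [Real.cos_two_mul', Real.sin_two_mul, Algebra.algebraMap_eq_smul_one]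
  constructor
  · simp only [add_mul, mul_add, smul_mul_assoc, mul_smul_comm, one_mul, mul_one, h1, h3, h4]
    have h5 : Real.cos t • e = (Real.cos t * (Real.cos t ^ 2 + Real.sin t ^ 2)) • e := by
      rw [hcs, mul_one]
    have h6 : Real.sin t • f = (Real.sin t * (Real.cos t ^ 2 + Real.sin t ^ 2)) • f := by
      rw [hcs, mul_one]
    rw [h5, h6]
    module
  · simp only [add_mul, mul_add, smul_mul_assoc, mul_smul_comm, one_mul, mul_one, h2, h3, h4,
      smul_neg]
    have h5 : Real.cos t • f = (Real.cos t * (Real.cos t ^ 2 + Real.sin t ^ 2)) • f := by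
      rw [hcs, mul_one]
    have h6 : Real.sin t • e = (Real.sin t * (Real.cos t ^ 2 + Real.sin t ^ 2)) • e := by
      rw [hcs, mul_one]
    rw [h5, h6]
    module

theorem torusProd_mul_stdVec_of_le {m : ℕ} {k : Fin n} (h : 2 * m ≤ k.1) (t : ℕ → ℝ) :
    torusProd n t m * vec (stdVec k) = vec (stdVec k) * torusProd n t m := by
  induction m with
  | zero => simp [torusProd]
  | succ m ih =>
    rw [torusProd, mul_assoc, torusFactor_mul_stdVec_of_ne (by omega) (by omega), ← mul_assoc,
      ih (by omega), mul_assoc]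

theorem torusProd_mul_stdVec {j : ℕ} (h : 2 * j + 1 < n) (t : ℕ → ℝ) {m : ℕ} (hm : j < m) :
    torusProd n t m * vec (stdVec (⟨2 * j, by omega⟩ : Fin n)) =
      vec (Real.cos (2 * t j) • stdVec (⟨2 * j, by omega⟩ : Fin n) +
        Real.sin (2 * t j) • stdVec (⟨2 * j + 1, h⟩ : Fin n)) * torusProd n t m ∧
    torusProd n t m * vec (stdVec (⟨2 * j + 1, h⟩ : Fin n)) =
      vec (-Real.sin (2 * t j) • stdVec (⟨2 * j, by omega⟩ : Fin n) +
        Real.cos (2 * t j) • stdVec (⟨2 * j + 1, h⟩ : Fin n)) * torusProd n t m := by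
  induction m with
  | zero => omega
  | succ m ih =>
    rcases Nat.lt_succ_iff_lt_or_eq.1 hm with h' | rfl
    · obtain ⟨i1, i2⟩ := ih h'
      constructor
      · rw [torusProd, mul_assoc, torusFactor_mul_stdVec_of_ne (by simp; omega) (by simp; omega),
          ← mul_assoc, i1, mul_assoc]
      · rw [torusProd, mul_assoc, torusFactor_mul_stdVec_of_ne (by simp; omega) (by simp; omega),
          ← mul_assoc, i2, mul_assoc]
    · obtain ⟨i1, i2⟩ := torusFactor_mul_stdVec h (t j)
      have c1 := torusProd_mul_stdVec_of_le (n := n) (m := j) (k := ⟨2 * j, by omega⟩) le_rfl t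
      have c2 := torusProd_mul_stdVec_of_le (n := n) (m := j) (k := ⟨2 * j + 1, h⟩)
        (Nat.le_succ _) t
      constructor
      · rw [torusProd, mul_assoc, i1, ← mul_assoc, ← mul_assoc]
        simp only [vec_add, vec_smul, mul_add, add_mul, mul_smul_comm, smul_mul_assoc, c1, c2]
      · rw [torusProd, mul_assoc, i2, ← mul_assoc, ← mul_assoc]
        simp only [vec_add, vec_smul, mul_add, add_mul, mul_smul_comm, smul_mul_assoc, c1, c2]

/-- As soon as there is one plane, `-1` lies in the torus. So `x_γ` can absorb the sign ambiguity of
a spin lift. -/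
theorem torusProd_update_zero_add_pi (h : 1 < n) (t : ℕ → ℝ) (m : ℕ) :
    torusProd n (Function.update t 0 (t 0 + Real.pi)) (m + 1) = -torusProd n t (m + 1) := by
  induction m with
  | zero =>
    simp only [torusProd, one_mul, Function.update_self, torusFactor]
    rw [dif_pos (by omega), dif_pos (by omega), Real.cos_add_pi, Real.sin_add_pi, map_neg, neg_smul,
      neg_add]
  | succ m ih =>
    rw [torusProd, ih, torusProd, neg_mul, Function.update_of_ne (by simp)]
    rfl

theorem incl_vec (N : ℕ) (v : Euc N) : incl N (vec v) = vec (inclVec N v) :=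
  CliffordAlgebra.map_apply_ι _ _

theorem inclVec_stdVec (N : ℕ) (k : Fin N) : inclVec N (stdVec k) = stdVec k.castSucc := by
  ext i
  refine Fin.lastCases ?_ (fun j => ?_) i
  · simp [inclVec, (Fin.castSucc_lt_last k).ne']
  · simp [inclVec]

theorem incl_stdVec (N : ℕ) (k : Fin N) : incl N (vec (stdVec k)) = vec (stdVec k.castSucc) := by
  rw [incl_vec, inclVec_stdVec]

theorem incl_torusFactor {N j : ℕ} (h : 2 * j + 1 < N) (t : ℝ) :
    incl N (torusFactor N j t) = torusFactor (N + 1) j t := by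
  rw [torusFactor, torusFactor, dif_pos h, dif_pos (by omega), map_add, map_smul, map_mul,
    incl_stdVec, incl_stdVec, AlgHom.commutes]
  rfl

theorem incl_torusProd {N : ℕ} (t : ℕ → ℝ) {m : ℕ} (hm : m ≤ N / 2) :
    incl N (torusProd N t m) = torusProd (N + 1) t m := by
  induction m with
  | zero => simp [torusProd]
  | succ m ih =>
    rw [torusProd, map_mul, ih (by omega), incl_torusFactor (by omega), torusProd]

theorem mem_maxTorus_iff {x : Spin n} :
    x ∈ maxTorus n ↔ ∃ t : ℕ → ℝ, (x : Cl n) = torusProd n t (n / 2) := by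
  constructor
  · rintro ⟨t, ht⟩
    obtain ⟨t', rfl⟩ := exists_nat_extension t
    exact ⟨t', by rw [ht, torusElt_eq_torusProd]⟩
  · rintro ⟨t, ht⟩
    exact ⟨_, by rw [ht, torusElt_eq_torusProd]⟩

end Torus

/-! ### Conjugation of spin elements into the torus -/

section TorusRep

open CliffordAlgebra

theorem isTorusRep_iff_mul {N : ℕ} {y : Spin (N + 1)} {x : Spin N} :
    IsTorusRep y x ↔ x ∈ maxTorus N ∧
      ∃ g : Spin (N + 1), (y : Cl (N + 1)) * g = g * incl N x := by
  refine and_congr_right fun _ => exists_congr fun g => ⟨fun h => ?_, fun h => ?_⟩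
  · rw [h, mul_assoc, spin_inv_mul_coe, mul_one]
  · rw [← h, mul_assoc, spin_coe_mul_inv, mul_one]

/-- An orthonormal basis of `ℝⁿ` is, up to the sign of its last member, the image of the canonical
basis under an element of `Spin(n)`. -/
theorem exists_spin_frame {N : ℕ} {b : Fin N → Euc (N + 1)} {u : Euc (N + 1)}
    (hb : Orthonormal ℝ (Fin.snoc b u : Fin (N + 1) → Euc (N + 1))) :
    ∃ (g : Spin (N + 1)) (s : ℝ), (s = 1 ∨ s = -1) ∧
      (∀ i : Fin N, (g : Cl (N + 1)) * vec (stdVec i.castSucc) = vec (b i) * g) ∧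
      (g : Cl (N + 1)) * vec (stdVec (Fin.last N)) = vec (s • u) * g := by
  let B : OrthonormalBasis (Fin (N + 1)) ℝ (Euc (N + 1)) :=
    (basisOfOrthonormalOfCardEqFinrank hb (by simp)).toOrthonormalBasis (by
      rw [coe_basisOfOrthonormalOfCardEqFinrank]; exact hb)
  have hB : ∀ i, B i = (Fin.snoc b u : Fin (N + 1) → Euc (N + 1)) i := by
    intro i
    simp [B]
  let O := (EuclideanSpace.basisFun (Fin (N + 1)) ℝ).equiv B (Equiv.refl _)
  have hO : ∀ i, O (stdVec i) = (Fin.snoc b u : Fin (N + 1) → Euc (N + 1)) i := by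
    intro i
    rw [← hB, show stdVec i = EuclideanSpace.basisFun (Fin (N + 1)) ℝ i by simp, OrthonormalBasis.equiv_apply_basis,
      Equiv.refl_apply]
  obtain ⟨p, hp, ⟨i, hi⟩, hpv⟩ := exists_pin_lift O
  have h1 : ∀ i : Fin N, involute p * vec (stdVec i.castSucc) = vec (b i) * p := fun i => by
    rw [hpv, hO, Fin.snoc_castSucc]
  have h2 : involute p * vec (stdVec (Fin.last N)) = vec u * p := by
    rw [hpv, hO, Fin.snoc_last]
  have hi' : i = 0 ∨ i = 1 := by clear hi; revert i; decide
  rcases hi' with rfl | rfl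
  · have he : involute p = p := involute_eq_of_mem_even hi
    rw [he] at h1 h2
    exact ⟨⟨p, mem_spinGroup_of_mem_pinGroup hp hi⟩, 1, Or.inl rfl, h1, by simpa using h2⟩
  -- Multiplying an odd lift on the right by the last basis vector makes it even and reverses only
  -- the last vector of the frame.
  · have he : involute p = -p := involute_eq_of_mem_odd hi
    have hev : p * vec (stdVec (Fin.last N)) ∈ evenOdd (negQ (N + 1)) 0 := by
      have := SetLike.mul_mem_graded (A := evenOdd (negQ (N + 1))) hi
        (ι_mem_evenOdd_one (negQ (N + 1)) (stdVec (Fin.last N)))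
      exact this
    refine ⟨⟨p * vec (stdVec (Fin.last N)), mem_spinGroup_of_mem_pinGroup
      (mul_mem hp (vec_mem_pinGroup (by simp))) hev⟩, -1, Or.inr rfl, fun i => ?_, ?_⟩
    · change p * vec (stdVec (Fin.last N)) * vec (stdVec i.castSucc) =
        vec (b i) * (p * vec (stdVec (Fin.last N)))
      rw [mul_assoc, stdVec_mul_stdVec (Fin.castSucc_lt_last i).ne', mul_neg, ← mul_assoc,
        ← mul_assoc, ← h1, he, neg_mul, neg_mul]
    · change p * vec (stdVec (Fin.last N)) * vec (stdVec (Fin.last N)) =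
        vec ((-1 : ℝ) • u) * (p * vec (stdVec (Fin.last N)))
      rw [vec_smul, smul_mul_assoc, ← mul_assoc, ← h2, he]
      simp

theorem orthonormal_snoc {E : Type*} [NormedAddCommGroup E] [InnerProductSpace ℝ E] {n : ℕ}
    {v : E} {b : Fin n → E} (hv : ‖v‖ = 1) (hb : Orthonormal ℝ b)
    (h : ∀ i, inner ℝ v (b i) = (0 : ℝ)) :
    Orthonormal ℝ (Fin.snoc b v : Fin (n + 1) → E) := by
  rw [orthonormal_iff_ite] at hb ⊢
  intro i j
  refine Fin.lastCases ?_ (fun i => ?_) i <;> refine Fin.lastCases ?_ (fun j => ?_) j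
  · simp [hv]
  · simpa [(Fin.castSucc_lt_last j).ne'] using h j
  · simpa [real_inner_comm] using h i
  · simpa using hb i j

/-- Every element of `Spin(N+1)`, `N ≥ 2`, that fixes a unit vector is conjugate to an element of
the maximal torus of `Spin(N)`. -/
theorem exists_isTorusRep {N : ℕ} (hN : 2 ≤ N) (y : Spin (N + 1))
    (B : Euc (N + 1) ≃ₗᵢ[ℝ] Euc (N + 1)) (hB : ∀ v, (y : Cl (N + 1)) * vec v = vec (B v) * y)
    {u : Euc (N + 1)} (hu : ‖u‖ = 1) (hBu : B u = u) : ∃ x : Spin N, IsTorusRep y x := by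
  have hBu' : B.symm u = u := by rw [LinearIsometryEquiv.symm_apply_eq, hBu]
  have hmem : ∀ x, x ∈ (ℝ ∙ u)ᗮ ↔ inner ℝ u x = (0 : ℝ) :=
    fun x => Submodule.mem_orthogonal_singleton_iff_inner_right
  obtain ⟨b, θ, hb, hbK, hR⟩ := exists_rotatesPairs B N (ℝ ∙ u)ᗮ
    (by
      have h1 := Submodule.finrank_add_finrank_orthogonal (ℝ ∙ u)
      rw [finrank_span_singleton (by rintro rfl; simp at hu), finrank_euclideanSpace_fin] at h1
      omega)
    (by intro x hx; rw [hmem] at hx ⊢; rw [← hBu, B.inner_map_map, hx])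
    (by intro x hx; rw [hmem] at hx ⊢; rw [← hBu', B.symm.inner_map_map, hx])
  have hub : ∀ i, inner ℝ u (b i) = (0 : ℝ) := fun i => (hmem _).1 (hbK i)
  obtain ⟨g, s, hs, hgb, hgu⟩ := exists_spin_frame (orthonormal_snoc hu hb hub)
  -- Identities that are linear in a vector need only be checked on the frame formed by the `b i`
  -- and `u`.
  have hbasis : ∀ P : Euc (N + 1) → Prop, (∀ i, P (b i)) → P u → (∀ v w, P v → P w → P (v + w)) →
      (∀ (c : ℝ) v, P v → P (c • v)) → ∀ v, P v := by
    intro P h1 h2 h3 h4 v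
    let Bs := basisOfOrthonormalOfCardEqFinrank (orthonormal_snoc hu hb hub) (by simp)
    have hv : v ∈ Submodule.span ℝ (Set.range Bs) := by rw [Bs.span_eq]; trivial
    induction hv using Submodule.span_induction with
    | mem x hx =>
      obtain ⟨i, rfl⟩ := hx
      rw [coe_basisOfOrthonormalOfCardEqFinrank]
      refine Fin.lastCases ?_ (fun i => ?_) i
      · simpa using h2
      · simpa using h1 i
    | zero => simpa using h4 0 u h2
    | add x y _ _ hx hy => exact h3 _ _ hx hy
    | smul c x _ hx => exact h4 _ _ hx
  -- the standard model of the rotation, conjugated to the frame `b`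
  let t : ℕ → ℝ := fun j => θ j / 2
  -- The angles are halved to compensate the doubling by the covering.
  have ht : ∀ j, 2 * t j = θ j := fun j => by simp only [t]; ring
  let X : Spin N := ⟨torusProd N t (N / 2), torusProd_mem_spinGroup _ _⟩
  let X' : Spin (N + 1) := ⟨torusProd (N + 1) t (N / 2), torusProd_mem_spinGroup _ _⟩
  have hXX : incl N X = X' := incl_torusProd t le_rfl
  let q : Spin (N + 1) := g * X' * g⁻¹
  have hqv : ∀ v w v' w' : Euc (N + 1), (g : Cl (N + 1)) * vec v = vec v' * g →
      (g : Cl (N + 1)) * vec w = vec w' * g → (X' : Cl (N + 1)) * vec v = vec w * X' →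
      (q : Cl (N + 1)) * vec v' = vec w' * q := by
    intro v w v' w' h1 h2 h3
    have h4 : ((g⁻¹ : Spin (N + 1)) : Cl (N + 1)) * vec v' = vec v * (g⁻¹ : Spin (N + 1)) := by
      calc ((g⁻¹ : Spin (N + 1)) : Cl (N + 1)) * vec v'
          = (g⁻¹ : Spin (N + 1)) * (vec v' * g) * (g⁻¹ : Spin (N + 1)) := by
            rw [mul_assoc, mul_assoc, spin_coe_mul_inv, mul_one]
        _ = _ := by rw [← h1, ← mul_assoc, spin_inv_mul_coe, one_mul]
    change (g : Cl (N + 1)) * X' * (g⁻¹ : Spin (N + 1)) * vec v' =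
      vec w' * (g * X' * (g⁻¹ : Spin (N + 1)))
    rw [mul_assoc, h4, ← mul_assoc, mul_assoc (g : Cl (N + 1)), h3, ← mul_assoc, h2]
    simp only [mul_assoc]
  have hq_pairs : ∀ R : Euc (N + 1) ≃ₗᵢ[ℝ] Euc (N + 1), RotatesPairs R b θ → R u = u →
      ∀ v, (q : Cl (N + 1)) * vec v = vec (R v) * q := by
    intro R hR hRu
    refine hbasis _ (fun i => ?_) ?_ (fun v w hv hw => ?_) (fun c v hv => ?_)
    · obtain ⟨k, hk⟩ := i
      rcases Nat.even_or_odd' k with ⟨j, rfl | rfl⟩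
      · by_cases hj : 2 * j + 1 < N
        · rw [(hR.1 j hj).1]
          refine hqv _ _ _ _ (hgb ⟨2 * j, hk⟩) ?_
            (torusProd_mul_stdVec (n := N + 1) (j := j) (by omega) t (by omega)).1
          simp only [vec_add, vec_smul, mul_add, add_mul, mul_smul_comm, smul_mul_assoc, ht]
          rw [← hgb, ← hgb]
          rfl
        · rw [hR.2 j hk (by omega)]
          refine hqv _ _ _ _ (hgb ⟨2 * j, hk⟩) (hgb ⟨2 * j, hk⟩)
            (torusProd_mul_stdVec_of_le (by simp; omega) t)
      · rw [(hR.1 j hk).2]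
        refine hqv _ _ _ _ (hgb ⟨2 * j + 1, hk⟩) ?_
          (torusProd_mul_stdVec (n := N + 1) (j := j) (by omega) t (by omega)).2
        simp only [vec_add, vec_smul, mul_add, add_mul, mul_smul_comm, smul_mul_assoc, ht]
        rw [← hgb, ← hgb]
        rfl
    · rw [hRu]
      have hgu' : (g : Cl (N + 1)) * vec (s • stdVec (Fin.last N)) = vec u * g := by
        rw [vec_smul, mul_smul_comm, hgu, vec_smul, smul_mul_assoc, smul_smul]
        rcases hs with rfl | rfl <;> simp
      refine hqv _ _ _ _ hgu' hgu' ?_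
      rw [vec_smul, mul_smul_comm, smul_mul_assoc]
      congr 1
      exact torusProd_mul_stdVec_of_le (by simp; omega) t
    · rw [vec_add, mul_add, hv, hw, map_add, vec_add, add_mul]
    · rw [vec_smul, mul_smul_comm, hv, map_smul, vec_smul, smul_mul_assoc]
  rcases hR with hR | ⟨c, hc, hc1, hR⟩
  · rcases spin_eq_or_eq_neg (hq_pairs B hR hBu) hB with h | h
    · exact ⟨X, mem_maxTorus_iff.2 ⟨t, rfl⟩, g, by rw [h, hXX]; rfl⟩
    -- The other lift, with the opposite sign, is reached by shifting the first angle by `π`; this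
    -- needs a torus of positive dimension, hence `2 ≤ N`.
    · obtain ⟨m, hm⟩ : ∃ m, N / 2 = m + 1 := ⟨N / 2 - 1, by omega⟩
      let Y : Spin N := ⟨torusProd N (Function.update t 0 (t 0 + Real.pi)) (N / 2),
        torusProd_mem_spinGroup _ _⟩
      have hY : (Y : Cl N) = -(X : Cl N) := by
        change torusProd N (Function.update t 0 (t 0 + Real.pi)) (N / 2) = -torusProd N t (N / 2)
        rw [hm]
        exact torusProd_update_zero_add_pi (by omega) t m
      refine ⟨Y, mem_maxTorus_iff.2 ⟨_, rfl⟩, g, ?_⟩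
      rw [h, hY, map_neg, hXX, mul_neg, neg_mul]
      rfl
  -- In the reflection case the odd element `y c` and the even element `q` have the same twisted
  -- action, so they agree up to sign; then `y c` is both even and odd, hence zero.
  · exfalso
    have hcu : inner ℝ c u = (0 : ℝ) := by rw [real_inner_comm]; exact (hmem _).1 hc
    have hyp := hq_pairs _ hR (by
      rw [LinearIsometryEquiv.coe_mul, Function.comp_apply,
        reflection_eq_self_of_inner_eq_zero hcu, hBu])
    have hrefl : ∀ v, Submodule.reflection (ℝ ∙ c)ᗮ v = v - (2 * inner ℝ c v) • c := by
      intro v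
      rw [Submodule.reflection_orthogonal_apply, Submodule.reflection_singleton_apply, hc1,
        ← Nat.cast_smul_eq_nsmul ℝ 2, smul_smul, neg_sub]
      simp
    have hyc : (y : Cl (N + 1)) * vec c ∈ pinGroup (negQ (N + 1)) :=
      mul_mem (spinGroup.mem_pin y.2) (vec_mem_pinGroup hc1)
    have hinv : involute ((y : Cl (N + 1)) * vec c) = -((y : Cl (N + 1)) * vec c) := by
      rw [map_mul, spinGroup.involute_eq y.2, involute_vec, mul_neg]
    have h1 := eq_or_eq_neg_of_twisted_action_eq (spinGroup.mem_pin q.2) hyc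
      (R := ⇑(B * Submodule.reflection (ℝ ∙ c)ᗮ))
      (fun v => by rw [spinGroup.involute_eq q.2]; exact hyp v)
      (fun v => by
        rw [hinv, LinearIsometryEquiv.coe_mul, Function.comp_apply, ← mul_assoc, ← hB, hrefl,
          neg_mul, mul_assoc, mul_assoc, ← mul_neg]
        congr 1
        rw [vec_sub, vec_smul, sub_mul, smul_mul_assoc, vec_mul_self_of_norm_one hc1,
          eq_sub_of_add_eq (vec_mul_vec_add_swap c v), Algebra.algebraMap_eq_smul_one]
        module)
    have h2 : involute ((y : Cl (N + 1)) * vec c) = (y : Cl (N + 1)) * vec c := by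
      rcases h1 with h1 | h1 <;> rw [h1]
      · exact spinGroup.involute_eq q.2
      · rw [map_neg, spinGroup.involute_eq q.2]
    rw [hinv, neg_eq_iff_add_eq_zero, ← two_smul ℝ] at h2
    have h3 : (y : Cl (N + 1)) * vec c = 0 := by simpa using h2
    have h4 := pinGroup.star_mul_self_of_mem hyc
    rw [h3, mul_zero] at h4
    exact zero_ne_one h4

end TorusRep

/-! ### Traces on the spinor spaces -/

section Traces

open CliffordAlgebra

variable {n : ℕ}

theorem cliffordRep_vec (v : Euc n) : cliffordRep n (vec v) = cliffordVec n v := by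
  simp [cliffordRep]

theorem cliffordRep_stdVec (k : Fin n) : cliffordRep n (vec (stdVec k)) = gammaOp n k := by
  rw [cliffordRep_vec]
  simp only [cliffordVec, LinearMap.coe_mk, AddHom.coe_mk]
  rw [Finset.sum_eq_single k]
  · simp
  · intro l _ hl
    simp [hl]
  · simp

theorem gammaOp_mul_gammaOp_apply {j : ℕ} (h : 2 * j + 1 < n) (φ : Spinor n)
    (I : Finset (Fin (n / 2))) :
    (gammaOp n ⟨2 * j, by omega⟩ * gammaOp n ⟨2 * j + 1, h⟩) φ I =
      (if ∃ h : j < n / 2, (⟨j, h⟩ : Fin (n / 2)) ∈ I then -Complex.I else Complex.I) * φ I := by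
  have hj : j < n / 2 := by omega
  have h1 : 2 * j / 2 = j := by omega
  have h2 : (2 * j + 1) / 2 = j := by omega
  have h3 : ¬ (2 * j + 1) % 2 = 0 := by omega
  have hs := koszul_sq ⟨j, hj⟩ I
  by_cases hI : (⟨j, hj⟩ : Fin (n / 2)) ∈ I
  · simp [gammaOp, hj, h1, h2, flip, koszul_symmDiff_of_le, hI, Finset.mem_symmDiff]
    linear_combination (Complex.I * φ I) * hs
  · simp [gammaOp, hj, h1, h2, flip, koszul_symmDiff_of_le, hI, Finset.mem_symmDiff]
    linear_combination (Complex.I * φ I) * hs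

/-- The weights of a torus element on the canonical basis of the spinor space. -/
def torusWeight (n : ℕ) (t : ℕ → ℝ) (I : Finset (Fin (n / 2))) (j : ℕ) : ℂ :=
  if ∃ h : j < n / 2, (⟨j, h⟩ : Fin (n / 2)) ∈ I then Complex.exp (-(t j * Complex.I))
  else Complex.exp (t j * Complex.I)

theorem cliffordRep_torusFactor_apply {j : ℕ} (h : 2 * j + 1 < n) (t : ℕ → ℝ) (φ : Spinor n)
    (I : Finset (Fin (n / 2))) :
    cliffordRep n (torusFactor n j (t j)) φ I = torusWeight n t I j * φ I := by
  rw [torusFactor, dif_pos h, map_add, map_smul, map_mul, cliffordRep_stdVec, cliffordRep_stdVec,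
    AlgHom.commutes, Algebra.algebraMap_eq_smul_one, LinearMap.add_apply, LinearMap.smul_apply,
    LinearMap.smul_apply, PiLp.add_apply, PiLp.smul_apply, PiLp.smul_apply,
    gammaOp_mul_gammaOp_apply h, torusWeight, ← neg_mul, Complex.exp_mul_I, Complex.exp_mul_I,
    Complex.cos_neg, Complex.sin_neg]
  simp only [Complex.real_smul, Module.End.one_apply, Complex.ofReal_cos, Complex.ofReal_sin]
  split_ifs <;> ring

theorem cliffordRep_torusProd_apply (t : ℕ → ℝ) {m : ℕ} (hm : m ≤ n / 2) (φ : Spinor n)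
    (I : Finset (Fin (n / 2))) :
    cliffordRep n (torusProd n t m) φ I = (∏ j ∈ Finset.range m, torusWeight n t I j) * φ I := by
  induction m generalizing φ with
  | zero => simp [torusProd]
  | succ m ih =>
    rw [torusProd, map_mul, Module.End.mul_apply, ih (by omega),
      cliffordRep_torusFactor_apply (by omega), Finset.prod_range_succ, mul_assoc]

theorem trace_of_diagonal {ι : Type*} [Fintype ι] [DecidableEq ι]
    {A : Module.End ℂ (EuclideanSpace ℂ ι)} {d : ι → ℂ} (h : ∀ φ i, A φ i = d i * φ i) :
    LinearMap.trace ℂ _ A = ∑ i, d i := by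
  rw [LinearMap.trace_eq_matrix_trace ℂ (EuclideanSpace.basisFun ι ℂ).toBasis, Matrix.trace]
  refine Finset.sum_congr rfl fun i _ => ?_
  simp [LinearMap.toMatrix_apply, h]

/-- Expanding the product on the right chooses for each `j` one of the two summands, that is, a
subset `I`. The value `e = 1` gives the trace of a torus element, `e = -1` its trace against parity.
-/
theorem sum_prod_torusWeight (n : ℕ) (t : ℕ → ℝ) (e : ℂ) :
    ∑ I : Finset (Fin (n / 2)), e ^ I.card * ∏ j ∈ Finset.range (n / 2), torusWeight n t I j =
      ∏ j ∈ Finset.range (n / 2),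
        (e * Complex.exp (-(t j * Complex.I)) + Complex.exp (t j * Complex.I)) := by
  rw [Finset.prod_range, Finset.prod_add]
  refine Finset.sum_congr (by simp) fun I _ => ?_
  rw [Finset.prod_range, ← Finset.prod_sdiff (Finset.subset_univ I), Finset.prod_mul_distrib,
    Finset.prod_const, mul_assoc, mul_comm (∏ j ∈ Finset.univ \ I, _)]
  congr 2
  · refine Finset.prod_congr rfl fun j hj => ?_
    rw [torusWeight, if_pos ⟨j.2, hj⟩]
  · refine Finset.prod_congr rfl fun j hj => ?_
    rw [torusWeight, if_neg (by simpa using hj)]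

theorem trace_torusProd (t : ℕ → ℝ) :
    LinearMap.trace ℂ _ (cliffordRep n (torusProd n t (n / 2))) =
      ∏ j ∈ Finset.range (n / 2), (2 * Complex.cos (t j)) := by
  rw [trace_of_diagonal fun φ I => cliffordRep_torusProd_apply t le_rfl φ I]
  have h := sum_prod_torusWeight n t 1
  simp only [one_pow, one_mul] at h
  rw [h]
  refine Finset.prod_congr rfl fun j _ => ?_
  rw [Complex.two_cos, neg_mul, add_comm]

theorem trace_torusProd_mul_parity (t : ℕ → ℝ) :
    LinearMap.trace ℂ _ (cliffordRep n (torusProd n t (n / 2)) * parity (n / 2)) =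
      ∏ j ∈ Finset.range (n / 2), (2 * Complex.I * Complex.sin (t j)) := by
  have h1 := trace_of_diagonal (A := cliffordRep n (torusProd n t (n / 2)) * parity (n / 2))
    (d := fun I => (-1) ^ I.card * ∏ j ∈ Finset.range (n / 2), torusWeight n t I j)
    (fun φ I => by
      rw [Module.End.mul_apply, cliffordRep_torusProd_apply t le_rfl]
      simp only [parity, LinearMap.coe_mk, AddHom.coe_mk]
      ring)
  rw [h1, sum_prod_torusWeight]
  refine Finset.prod_congr rfl fun j _ => ?_
  rw [Complex.sin, show -(t j : ℂ) * Complex.I = -(t j * Complex.I) from neg_mul _ _]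
  linear_combination (Complex.exp (t j * Complex.I) - Complex.exp (-(t j * Complex.I))) *
    Complex.I_mul_I

theorem torusFactor_zero (j : ℕ) : torusFactor n j 0 = 1 := by
  unfold torusFactor
  split_ifs <;> simp

theorem torusProd_congr {t t' : ℕ → ℝ} {m : ℕ} (h : ∀ j < m, t j = t' j) :
    torusProd n t m = torusProd n t' m := by
  induction m with
  | zero => rfl
  | succ m ih => rw [torusProd, torusProd, ih fun j hj => h j (by omega), h m (by omega)]

/-- The trace of a linear map that preserves the range of a projection. -/
theorem trace_restrict_eq {K M : Type*} [Field K] [AddCommGroup M] [Module K M]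
    [FiniteDimensional K M] {p : Submodule K M} {P f : Module.End K M} (hP : LinearMap.IsProj p P)
    (hf : ∀ x ∈ p, f x ∈ p) :
    LinearMap.trace K p (f.restrict hf) = LinearMap.trace K M (f * P) := by
  have h1 : f * P = p.subtype ∘ₗ (f.restrict hf ∘ₗ hP.codRestrict) := by
    ext x
    rfl
  have h2 : (f.restrict hf ∘ₗ hP.codRestrict) ∘ₗ p.subtype = f.restrict hf := by
    ext x
    simp
  rw [h1, LinearMap.trace_comp_comm', h2]

theorem parity_mul_self (m : ℕ) : parity m * parity m = 1 := by
  ext φ I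
  simp only [parity, Module.End.mul_apply, LinearMap.coe_mk, AddHom.coe_mk, Module.End.one_apply]
  rw [← mul_assoc, ← mul_pow]
  simp

theorem isProj_halfSpinor (n : ℕ) (s : ℤˣ) :
    LinearMap.IsProj (halfSpinor n s) ((1 / 2 : ℂ) • (1 + ((s : ℤ) : ℂ) • parity (n / 2))) := by
  have hs : ((s : ℤ) : ℂ) * ((s : ℤ) : ℂ) = 1 := by
    rcases Int.units_eq_one_or s with rfl | rfl <;> simp
  have hpp : ∀ φ, parity (n / 2) (parity (n / 2) φ) = φ := fun φ => by
    rw [← Module.End.mul_apply, parity_mul_self, Module.End.one_apply]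
  refine ⟨fun φ => ?_, fun φ hφ => ?_⟩
  · rw [mem_halfSpinor_iff]
    simp only [LinearMap.smul_apply, LinearMap.add_apply, Module.End.one_apply, map_smul, map_add,
      hpp, smul_add, smul_smul]
    rw [add_comm]
    congr 2
    · ring
    · linear_combination (-1 / 2 : ℂ) * hs
  · rw [mem_halfSpinor_iff] at hφ
    simp only [LinearMap.smul_apply, LinearMap.add_apply, Module.End.one_apply, hφ, smul_smul, hs]
    module

/-- The half-spin space is the range of the projection `(1 + s · parity) / 2`, and the trace of a
restriction is the trace after composing with the projection. -/
theorem character_halfSpinRep (hn : Even n) (s : ℤˣ) (x : Spin n) :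
    (halfSpinRep n hn s).character x = (1 / 2 : ℂ) *
      (LinearMap.trace ℂ _ (cliffordRep n x) +
        ((s : ℤ) : ℂ) * LinearMap.trace ℂ _ (cliffordRep n x * parity (n / 2))) := by
  have h := trace_restrict_eq (isProj_halfSpinor n s) (spinRep_mem_halfSpinor n hn s x)
  have h' : (halfSpinRep n hn s).character x =
      LinearMap.trace ℂ _ (spinRep n x * ((1 / 2 : ℂ) • (1 + ((s : ℤ) : ℂ) • parity (n / 2)))) := h
  rw [h', mul_smul_comm, mul_add, mul_one, mul_smul_comm, map_smul, map_add, map_smul]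
  rfl

theorem trace_cliffordRep_conj {g : Spin n} {y x : Cl n} (h : y * g = g * x) :
    LinearMap.trace ℂ _ (cliffordRep n y) = LinearMap.trace ℂ _ (cliffordRep n x) := by
  have hy : y = g * x * ((g⁻¹ : Spin n) : Cl n) := by
    rw [← h, mul_assoc, spin_coe_mul_inv, mul_one]
  have hx : x = ((g⁻¹ : Spin n) : Cl n) * (g * x) := by
    rw [← mul_assoc, spin_inv_mul_coe, one_mul]
  rw [hy, map_mul, LinearMap.trace_mul_comm, ← map_mul, ← hx]

/-- Parity commutes with `y` and anticommutes with `u`, so conjugation by it reverses the operator.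
-/
theorem trace_mul_vec_of_even (hn : Even n) {y : Cl n} (hy : y ∈ evenOdd (negQ n) 0) (u : Euc n) :
    LinearMap.trace ℂ _ (cliffordRep n (y * vec u)) = 0 := by
  have h1 := parity_cliffordRep n hn y hy
  have h2 := parity_cliffordVec n hn u
  have h3 := parity_mul_self (n / 2)
  have h4 : cliffordRep n (y * vec u) =
      -(parity (n / 2) * (cliffordRep n (y * vec u) * parity (n / 2))) := by
    rw [map_mul, cliffordRep_vec, ← mul_assoc, ← mul_assoc, h1, mul_assoc (cliffordRep n y), h2,
      mul_neg, neg_mul, neg_neg]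
    simp only [mul_assoc, h3, mul_one]
  have h5 := congrArg (LinearMap.trace ℂ _) h4
  rw [map_neg, LinearMap.trace_mul_comm, mul_assoc, h3, mul_one] at h5
  exact self_eq_neg.1 h5

/-- Conjugation by `v` fixes `y` and reverses `u`, so the trace equals its negative. This disposes
of the `B` with a second fixed direction. -/
theorem trace_mul_vec_of_commute {y : Cl n} {u v : Euc n} (hv : ‖v‖ = 1)
    (huv : inner ℝ u v = (0 : ℝ)) (hy : y * vec v = vec v * y) :
    LinearMap.trace ℂ _ (cliffordRep n (y * vec u)) = 0 := by
  have hvv := vec_mul_self_of_norm_one hv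
  have h1 : y * vec u = vec v * (y * vec u * vec v) := by
    rw [mul_assoc, vec_mul_vec_of_inner_eq_zero huv, mul_neg, mul_neg, ← mul_assoc y, hy]
    simp only [← mul_assoc, hvv]
    simp
  have h2 : LinearMap.trace ℂ _ (cliffordRep n (y * vec u)) =
      -LinearMap.trace ℂ _ (cliffordRep n (y * vec u)) := by
    nth_rewrite 1 [h1]
    rw [map_mul, LinearMap.trace_mul_comm, ← map_mul, mul_assoc, hvv, mul_neg, mul_one, map_neg,
      map_neg]
  exact self_eq_neg.1 h2

end Traces

/-! ### Fixed vectors of an isometry -/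

section FixedVectors

variable {n : ℕ}

theorem exists_fixed_orthogonal {B : Euc n ≃ₗᵢ[ℝ] Euc n} (hB : fixDim B ≠ 1) {u : Euc n}
    (hu : u ≠ 0) (hBu : B u = u) : ∃ v, ‖v‖ = 1 ∧ inner ℝ u v = (0 : ℝ) ∧ B v = v := by
  by_contra! hcon
  apply hB
  have hmem : ∀ x, x ∈ LinearMap.ker ((B.toLinearEquiv : Euc n →ₗ[ℝ] Euc n) - LinearMap.id) ↔
      B x = x := fun x => by
    rw [LinearMap.mem_ker, LinearMap.sub_apply, sub_eq_zero]
    rfl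
  refine finrank_eq_one_iff'.2 ⟨⟨u, (hmem u).2 hBu⟩, fun h => hu (congrArg Subtype.val h), ?_⟩
  rintro ⟨x, hx⟩
  rw [hmem] at hx
  have huu : ‖u‖ ^ 2 ≠ 0 := pow_ne_zero 2 (norm_ne_zero_iff.2 hu)
  set w := x - (inner ℝ u x / ‖u‖ ^ 2) • u with hw
  have hBw : B w = w := by rw [hw, map_sub, map_smul, hx, hBu]
  have huw : inner ℝ u w = (0 : ℝ) := by
    rw [hw, inner_sub_right, real_inner_smul_right, real_inner_self_eq_norm_sq,
      div_mul_cancel₀ _ huu, sub_self]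
  have hw0 : w = 0 := by
    by_contra hw0
    refine hcon (‖w‖⁻¹ • w) ?_ ?_ ?_
    · rw [norm_smul, norm_inv, norm_norm, inv_mul_cancel₀ (norm_ne_zero_iff.2 hw0)]
    · rw [real_inner_smul_right, huw, mul_zero]
    · rw [map_smul, hBw]
  exact ⟨inner ℝ u x / ‖u‖ ^ 2, Subtype.ext (sub_eq_zero.1 (hw ▸ hw0)).symm⟩

theorem exists_smul_of_fixDim_eq_one {B : Euc n ≃ₗᵢ[ℝ] Euc n} (hB : fixDim B = 1) {u v : Euc n}
    (hv : v ≠ 0) (hBv : B v = v) (hBu : B u = u) : ∃ c : ℝ, u = c • v := by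
  have hmem : ∀ x, x ∈ LinearMap.ker ((B.toLinearEquiv : Euc n →ₗ[ℝ] Euc n) - LinearMap.id) ↔
      B x = x := fun x => by
    rw [LinearMap.mem_ker, LinearMap.sub_apply, sub_eq_zero]
    rfl
  obtain ⟨c, hc⟩ := (finrank_eq_one_iff_of_nonzero'
    (⟨v, (hmem v).2 hBv⟩ : LinearMap.ker ((B.toLinearEquiv : Euc n →ₗ[ℝ] Euc n) - LinearMap.id))
    (fun h => hv (congrArg Subtype.val h))).1 hB ⟨u, (hmem u).2 hBu⟩
  exact ⟨c, (congrArg Subtype.val hc).symm⟩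

end FixedVectors

/-! ### Characters of the elements `x_γ` -/

section TorusRepTraces

open CliffordAlgebra

variable {N : ℕ}

theorem spin_inv_mul_eq {n : ℕ} {g : Spin n} {a b : Cl n} (h : (g : Cl n) * a = b * g) :
    ((g⁻¹ : Spin n) : Cl n) * b = a * (g⁻¹ : Spin n) := by
  have h1 : b = g * a * ((g⁻¹ : Spin n) : Cl n) := by
    rw [h, mul_assoc, spin_coe_mul_inv, mul_one]
  rw [h1, ← mul_assoc, ← mul_assoc, spin_inv_mul_coe, one_mul]

/-- An even element is built from products of pairs of vectors orthogonal to the last one, and each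
such pair commutes with it. -/
theorem incl_mul_last (z : Spin N) :
    incl N z * vec (stdVec (Fin.last N)) = vec (stdVec (Fin.last N)) * incl N z := by
  have hz : (z : Cl N) ∈ evenOdd (negQ N) 0 := spinGroup.mem_even z.2
  have hin : ∀ v : Euc N, inner ℝ (inclVec N v) (stdVec (Fin.last N)) = (0 : ℝ) := by
    intro v
    rw [EuclideanSpace.inner_single_right]
    simp [inclVec]
  generalize (z : Cl N) = a at hz
  induction a, hz using CliffordAlgebra.even_induction with
  | algebraMap r => rw [AlgHom.commutes, Algebra.commutes]
  | add a b _ _ ha hb => rw [map_add, mul_add, add_mul, ha, hb]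
  | ι_mul_ι_mul v w a _ ha =>
    have := vec_mul_vec_mul_comm (hin v) (hin w)
    rw [map_mul, map_mul, incl_vec, incl_vec, mul_assoc, ha, ← mul_assoc, this, mul_assoc]

/-- For even `N` the two spinor spaces involve the same planes. For odd `N` the larger one has an
additional plane, on which the angle is `0`, contributing the factor `2 cos 0`. -/
theorem trace_incl_of_mem_maxTorus {x : Spin N} (hx : x ∈ maxTorus N) :
    LinearMap.trace ℂ _ (cliffordRep (N + 1) (incl N x)) =
      (if Even N then 1 else 2) * LinearMap.trace ℂ _ (cliffordRep N x) := by
  obtain ⟨t, ht⟩ := mem_maxTorus_iff.1 hx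
  rw [ht, incl_torusProd t le_rfl, trace_torusProd]
  split_ifs with hN
  · have h : (N + 1) / 2 = N / 2 := by obtain ⟨r, hr⟩ := hN; omega
    rw [← h, trace_torusProd, one_mul]
  · have h : (N + 1) / 2 = N / 2 + 1 := by
      obtain ⟨r, hr⟩ := Nat.not_even_iff_odd.1 hN; omega
    set t' : ℕ → ℝ := Function.update t (N / 2) 0 with ht'
    have e : torusProd (N + 1) t (N / 2) = torusProd (N + 1) t' ((N + 1) / 2) := by
      rw [h, torusProd, ht', Function.update_self, torusFactor_zero, mul_one]
      exact torusProd_congr fun j hj => by rw [Function.update_of_ne hj.ne]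
    rw [e, trace_torusProd, h, Finset.prod_range_succ, mul_comm]
    congr 1
    · simp [ht']
    · refine Finset.prod_congr rfl fun j hj => ?_
      rw [ht', Function.update_of_ne (Finset.mem_range.1 hj).ne]

/-- The last vector of an odd-dimensional space is unpaired and acts as `-i` times parity. This is
how the half-spin characters enter. -/
theorem trace_incl_mul_last {x : Spin N} (hN : Even N) (hx : x ∈ maxTorus N) :
    LinearMap.trace ℂ _ (cliffordRep (N + 1) (incl N x * vec (stdVec (Fin.last N)))) =
      -Complex.I * LinearMap.trace ℂ _ (cliffordRep N x * parity (N / 2)) := by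
  obtain ⟨t, ht⟩ := mem_maxTorus_iff.1 hx
  have h : (N + 1) / 2 = N / 2 := by obtain ⟨r, hr⟩ := hN; omega
  have hg : gammaOp (N + 1) (Fin.last N) = (-Complex.I) • parity ((N + 1) / 2) := by
    rw [gammaOp, dif_neg (by simp [h])]
  rw [ht, incl_torusProd t le_rfl, trace_torusProd_mul_parity, map_mul, cliffordRep_stdVec, hg,
    mul_smul_comm, map_smul, ← h, trace_torusProd_mul_parity, smul_eq_mul]

theorem IsTorusRep.trace_eq {y : Spin (N + 1)} {x : Spin N} (h : IsTorusRep y x) :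
    LinearMap.trace ℂ _ (cliffordRep (N + 1) y) =
      (if Even N then 1 else 2) * (spinRep N).character x := by
  obtain ⟨hx, g, hg⟩ := isTorusRep_iff_mul.1 h
  rw [trace_cliffordRep_conj hg, trace_incl_of_mem_maxTorus hx]
  rfl

/-- The projection of the spinor space onto the eigenspace of `i L(u)` for `s ‖u‖`. -/
def spinProj {n : ℕ} (s : ℤˣ) (u : Euc n) : Module.End ℂ (Spinor n) :=
  (1 / 2 : ℂ) • (1 + (((s : ℤ) : ℂ) * Complex.I * (‖u‖ : ℂ)⁻¹) • cliffordRep n (vec u))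

theorem trace_mul_spinProj {n : ℕ} (s : ℤˣ) (u : Euc n) (y : Cl n) :
    LinearMap.trace ℂ _ (cliffordRep n y * spinProj s u) =
      (1 / 2 : ℂ) * (LinearMap.trace ℂ _ (cliffordRep n y) +
        ((s : ℤ) : ℂ) * Complex.I * (‖u‖ : ℂ)⁻¹ *
          LinearMap.trace ℂ _ (cliffordRep n (y * vec u))) := by
  rw [spinProj, mul_smul_comm, mul_add, mul_one, mul_smul_comm, ← map_mul, map_smul, map_add,
    map_smul]
  rfl

theorem IsTorusRep.trace_mul_spinProj_of_even {y : Spin (N + 1)} {x : Spin N}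
    (h : IsTorusRep y x) (hN : Even (N + 1)) (s : ℤˣ) (u : Euc (N + 1)) :
    LinearMap.trace ℂ _ (cliffordRep (N + 1) y * spinProj s u) = (spinRep N).character x := by
  rw [trace_mul_spinProj, h.trace_eq, trace_mul_vec_of_even hN (spinGroup.mem_even y.2),
    if_neg (by rwa [← Nat.even_add_one])]
  ring

/-- The odd-dimensional case reduces to finding a sign `τ`: since `i · (-i) = 1`, the vector term of
the projection becomes `s τ` times the trace of `x` against parity. -/
theorem trace_mul_spinProj_of_sign {y : Spin (N + 1)} {x : Spin N}
    (h : IsTorusRep y x) (hN : Even N) {s τ : ℤˣ} {u : Euc (N + 1)} (hu : u ≠ 0)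
    (hτ : LinearMap.trace ℂ _ (cliffordRep (N + 1) (y * vec u)) = ((τ : ℤ) : ℂ) * ‖u‖ *
      LinearMap.trace ℂ _ (cliffordRep (N + 1) (incl N x * vec (stdVec (Fin.last N))))) :
    LinearMap.trace ℂ _ (cliffordRep (N + 1) y * spinProj s u) =
      (halfSpinRep N hN (s * τ)).character x := by
  have hu' : (‖u‖ : ℂ) ≠ 0 := by simpa using hu
  rw [trace_mul_spinProj, h.trace_eq, hτ, trace_incl_mul_last hN h.1, if_pos hN,
    character_halfSpinRep, one_mul]
  have e : (spinRep N).character x = LinearMap.trace ℂ _ (cliffordRep N x) := rfl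
  rw [e]
  congr 2
  push_cast
  have h1 := inv_mul_cancel₀ hu'
  linear_combination (-Complex.I ^ 2 * ((s : ℤ) : ℂ) * ((τ : ℤ) : ℂ) *
    LinearMap.trace ℂ _ (cliffordRep N x * parity (N / 2))) * h1 - ((s : ℤ) : ℂ) *
    ((τ : ℤ) : ℂ) * LinearMap.trace ℂ _ (cliffordRep N x * parity (N / 2)) * Complex.I_sq

/-- Conjugating the relation between `x` and `v` by `g` shows that `y` commutes with `w`. -/
theorem fixed_of_conj {y g : Spin (N + 1)} {x : Spin N}
    {B : Euc (N + 1) ≃ₗᵢ[ℝ] Euc (N + 1)}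
    (hB : ∀ v, (y : Cl (N + 1)) * vec v = vec (B v) * y)
    (hg : (y : Cl (N + 1)) * g = g * incl N x) {v w : Euc (N + 1)}
    (hv : incl N x * vec v = vec v * incl N x) (hw : (g : Cl (N + 1)) * vec v = vec w * g) :
    B w = w := by
  apply vec_injective
  have h1 : vec (B w) * (y : Cl (N + 1)) = vec w * (y : Cl (N + 1)) := by
    rw [← hB]
    calc (y : Cl (N + 1)) * vec w
        = y * (vec w * g) * ((g⁻¹ : Spin (N + 1)) : Cl (N + 1)) := by
          rw [mul_assoc, mul_assoc, spin_coe_mul_inv, mul_one]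
      _ = g * (incl N x * vec v) * ((g⁻¹ : Spin (N + 1)) : Cl (N + 1)) := by
          rw [← hw, ← mul_assoc, hg]; simp only [mul_assoc]
      _ = (g * vec v) * incl N x * ((g⁻¹ : Spin (N + 1)) : Cl (N + 1)) := by
          rw [hv]; simp only [mul_assoc]
      _ = vec w * (y * g) * ((g⁻¹ : Spin (N + 1)) : Cl (N + 1)) := by
          rw [hw, hg]; simp only [mul_assoc]
      _ = vec w * y := by rw [mul_assoc, mul_assoc, spin_coe_mul_inv, mul_one]
  calc vec (B w) = vec (B w) * (y : Cl (N + 1)) * ((y⁻¹ : Spin (N + 1)) : Cl (N + 1)) := by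
        rw [mul_assoc, spin_coe_mul_inv, mul_one]
    _ = vec w := by rw [h1, mul_assoc, spin_coe_mul_inv, mul_one]

theorem trace_conj_mul_vec {y g : Spin (N + 1)} {x : Cl (N + 1)}
    (hg : (y : Cl (N + 1)) * g = g * x) {v w : Euc (N + 1)}
    (hw : (g : Cl (N + 1)) * vec v = vec w * g) :
    LinearMap.trace ℂ _ (cliffordRep (N + 1) (y * vec w)) =
      LinearMap.trace ℂ _ (cliffordRep (N + 1) (x * vec v)) := by
  refine trace_cliffordRep_conj (g := g) ?_
  rw [mul_assoc, ← hw, ← mul_assoc, hg, mul_assoc]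

theorem trace_cliffordRep_mul_comm {n : ℕ} (a b : Cl n) :
    LinearMap.trace ℂ _ (cliffordRep n (a * b)) = LinearMap.trace ℂ _ (cliffordRep n (b * a)) := by
  rw [map_mul, LinearMap.trace_mul_comm, ← map_mul]

theorem trace_mul_vec_smul {n : ℕ} (y : Cl n) (c : ℝ) (u : Euc n) :
    LinearMap.trace ℂ _ (cliffordRep n (y * vec (c • u))) =
      (c : ℂ) * LinearMap.trace ℂ _ (cliffordRep n (y * vec u)) := by
  have h : cliffordRep n (y * vec (c • u)) = (c : ℂ) • cliffordRep n (y * vec u) := by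
    rw [vec_smul, mul_smul_comm, map_smul, Complex.coe_smul]
  rw [h, map_smul, smul_eq_mul]

theorem IsTorusRep.trace_mul_spinProj_of_fixDim_ne_one {y : Spin (N + 1)} {x : Spin N}
    (h : IsTorusRep y x) (hN : Even N) (s : ℤˣ) {u : Euc (N + 1)} (hu : u ≠ 0)
    {B : Euc (N + 1) ≃ₗᵢ[ℝ] Euc (N + 1)}
    (hB : ∀ v, (y : Cl (N + 1)) * vec v = vec (B v) * y) (hBu : B u = u) (hfix : fixDim B ≠ 1) :
    LinearMap.trace ℂ _ (cliffordRep (N + 1) y * spinProj s u) =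
      (halfSpinRep N hN s).character x := by
  have hzero : ∀ w, w ≠ 0 → B w = w →
      LinearMap.trace ℂ _ (cliffordRep (N + 1) (y * vec w)) = 0 := by
    intro w hw hBw
    obtain ⟨v, hv, hwv, hBv⟩ := exists_fixed_orthogonal hfix hw hBw
    exact trace_mul_vec_of_commute hv hwv (by rw [hB, hBv])
  obtain ⟨hx, g, hg⟩ := isTorusRep_iff_mul.1 h
  obtain ⟨R, hR⟩ := exists_rotation g
  have h1 := fixed_of_conj hB hg (incl_mul_last x) (hR _)
  have h2 := trace_conj_mul_vec hg (hR (stdVec (Fin.last N)))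
  rw [hzero _ (by simp) h1] at h2
  -- Both traces vanish, so the two half-spin characters of `x` coincide and either sign would do.
  have h3 := trace_mul_spinProj_of_sign h hN (s := s) (τ := 1) hu (by
    rw [hzero u hu hBu, ← h2, mul_zero])
  rwa [mul_one] at h3

/-- If `g` conjugates `x` to `y`, the rotation of `g` sends `e_{N+1}` into the fixed line of `B`, so
`u` is `±‖u‖` times the image. An `h_u` as in the definition of `σ` forces the trace with the sign
`+`; without one, the sign must be `-`. -/
theorem IsTorusRep.trace_mul_spinProj_of_fixDim_eq_one {y : Spin (N + 1)} {x : Spin N}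
    (h : IsTorusRep y x) (hN : Even N) (s : ℤˣ) {u : Euc (N + 1)} (hu : u ≠ 0)
    {B : Euc (N + 1) ≃ₗᵢ[ℝ] Euc (N + 1)}
    (hB : ∀ v, (y : Cl (N + 1)) * vec v = vec (B v) * y) (hBu : B u = u) (hfix : fixDim B = 1) :
    LinearMap.trace ℂ _ (cliffordRep (N + 1) y * spinProj s u) =
      (halfSpinRep N hN (s * sigma y u x)).character x := by
  obtain ⟨hx, g, hg⟩ := isTorusRep_iff_mul.1 h
  refine trace_mul_spinProj_of_sign h hN hu ?_
  have hpos : ∀ k : Spin (N + 1), (k : Cl (N + 1)) * vec u = vec (‖u‖ • stdVec (Fin.last N)) * k →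
      ((∃ z : Spin N, (k : Cl (N + 1)) * y = incl N (z * x * (z⁻¹ : Spin N)) * k)) →
      LinearMap.trace ℂ _ (cliffordRep (N + 1) (y * vec u)) = ‖u‖ *
        LinearMap.trace ℂ _ (cliffordRep (N + 1) (incl N x * vec (stdVec (Fin.last N)))) := by
    rintro k hk ⟨z, hz⟩
    rw [trace_conj_mul_vec (spin_inv_mul_eq hz).symm (spin_inv_mul_eq hk), trace_mul_vec_smul]
    congr 1
    rw [map_mul (incl N), map_mul (incl N), mul_assoc, incl_mul_last, mul_assoc,
      trace_cliffordRep_mul_comm]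
    simp only [mul_assoc]
    rw [← map_mul (incl N), spin_inv_mul_coe, map_one, mul_one]
  unfold sigma
  split_ifs with hσ
  · obtain ⟨k, hk, z, hz⟩ := hσ
    rw [hpos k (by rw [← hk, mul_assoc, spin_inv_mul_coe, mul_one])
      ⟨z, by rw [← hz, mul_assoc, spin_inv_mul_coe, mul_one]⟩]
    simp
  · obtain ⟨R, hR⟩ := exists_rotation g
    have hBR := fixed_of_conj hB hg (incl_mul_last x) (hR _)
    have hR1 : ‖R (stdVec (Fin.last N))‖ = 1 := by rw [R.norm_map]; simp
    obtain ⟨c, hc⟩ := exists_smul_of_fixDim_eq_one hfix (norm_ne_zero_iff.1 (by rw [hR1]; simp))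
      hBR hBu
    have hcn : ‖u‖ = |c| := by rw [hc, norm_smul, hR1, mul_one, Real.norm_eq_abs]
    rcases le_or_gt 0 c with h0 | h0
    -- For `0 ≤ c` the inverse of `g` would be an admissible `h_u`.
    · exfalso
      rw [abs_of_nonneg h0] at hcn
      refine hσ ⟨g⁻¹, ?_, 1, ?_⟩
      · rw [inv_inv, mul_assoc, hcn, hc, vec_smul, vec_smul, smul_mul_assoc, ← hR,
          mul_smul_comm, ← mul_assoc, spin_inv_mul_coe, one_mul]
      · rw [inv_inv, mul_assoc, hg, ← mul_assoc, spin_inv_mul_coe]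
        simp
    · rw [abs_of_neg h0] at hcn
      have e : ((c : ℝ) : ℂ) = -(‖u‖ : ℂ) := by rw [hcn]; push_cast; ring
      have h2 := trace_conj_mul_vec hg (hR (stdVec (Fin.last N)))
      nth_rewrite 1 [hc]
      rw [trace_mul_vec_smul, h2, e]
      simp

end TorusRepTraces

/-! ### Dependence of the characters on the choices -/

section ChoiceDependence

open CliffordAlgebra

/-- The first basis vector anticommutes with the bivector of the first plane and commutes with the
others, so conjugation by it reverses the first angle only. -/
theorem stdVec_zero_mul_torusProd {n : ℕ} (hn : 1 < n) (t : ℕ → ℝ) (m : ℕ) :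
    vec (stdVec (⟨0, by omega⟩ : Fin n)) * torusProd n t (m + 1) =
      torusProd n (Function.update t 0 (-t 0)) (m + 1) * vec (stdVec ⟨0, by omega⟩) := by
  induction m with
  | zero =>
    simp only [torusProd, one_mul, Function.update_self, torusFactor]
    rw [dif_pos (by omega), dif_pos (by omega), Real.cos_neg, Real.sin_neg, mul_add, add_mul,
      Algebra.commutes, mul_smul_comm, smul_mul_assoc, neg_smul, mul_assoc,
      stdVec_mul_stdVec (k := (⟨2 * 0 + 1, by omega⟩ : Fin n)) (l := ⟨0, by omega⟩) (by simp),
      mul_neg, smul_neg, neg_neg]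
  | succ m ih =>
    have hc := torusFactor_mul_stdVec_of_ne (j := m + 1) (k := (⟨0, by omega⟩ : Fin n))
      (by simp) (by simp) (t (m + 1))
    have h1 : ∀ t, torusProd n t (m + 1 + 1) =
      torusProd n t (m + 1) * torusFactor n (m + 1) (t (m + 1)) := fun _ => rfl
    rw [h1, h1, ← mul_assoc, ih, mul_assoc, mul_assoc, ← hc, Function.update_of_ne (by simp)]

/-- If `B` fixes only a line, `x_γ` can be replaced by an element on which the half-spin
characters are different. -/
theorem exists_isTorusRep_character_ne {N : ℕ} (hN : Even N) (hpos : 0 < N) {y : Spin (N + 1)}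
    {x : Spin N} (h : IsTorusRep y x) {B : Euc (N + 1) ≃ₗᵢ[ℝ] Euc (N + 1)}
    (hB : ∀ v, (y : Cl (N + 1)) * vec v = vec (B v) * y) (hfix : fixDim B = 1) :
    ∃ x' : Spin N, IsTorusRep y x' ∧
      ∀ s : ℤˣ, (halfSpinRep N hN s).character x ≠ (halfSpinRep N hN s).character x' := by
  obtain ⟨hx, g, hg⟩ := isTorusRep_iff_mul.1 h
  obtain ⟨t, ht⟩ := mem_maxTorus_iff.1 hx
  have hN2 : 2 ≤ N := by obtain ⟨r, hr⟩ := hN; omega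
  obtain ⟨m, hm⟩ : ∃ m, N / 2 = m + 1 := ⟨N / 2 - 1, by omega⟩
  let t' : ℕ → ℝ := Function.update t 0 (-t 0)
  let x' : Spin N := ⟨torusProd N t' (N / 2), torusProd_mem_spinGroup _ _⟩
  have hx' : (x' : Cl N) = torusProd N t' (N / 2) := rfl
  -- A vanishing sine would make `x` commute with the basis vector of index `2 * j`, and `B` would
  -- fix a second direction.
  have hsin : ∀ j, j < N / 2 → Real.sin (t j) ≠ 0 := by
    intro j hj h0
    have h2j : 2 * j + 1 < N + 1 := by omega
    have h1 := (torusProd_mul_stdVec h2j t hj).1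
    rw [Real.cos_two_mul', Real.sin_two_mul, h0, Real.cos_sq', h0] at h1
    simp only [ne_eq, OfNat.ofNat_ne_zero, not_false_eq_true, zero_pow, sub_zero, one_smul,
      mul_zero, zero_mul, zero_smul, add_zero] at h1
    rw [← incl_torusProd t le_rfl, ← ht] at h1
    obtain ⟨R, hR⟩ := exists_rotation g
    have e1 := fixed_of_conj hB hg h1 (hR _)
    have e2 := fixed_of_conj hB hg (incl_mul_last x) (hR _)
    obtain ⟨c, hc⟩ := exists_smul_of_fixDim_eq_one hfix (by simp) e2 e1
    rw [← map_smul] at hc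
    have hc' := R.injective hc
    have := congrArg (fun v : Euc (N + 1) => v ⟨2 * j, by omega⟩) hc'
    have hne : (⟨2 * j, by omega⟩ : Fin (N + 1)) ≠ Fin.last N := by
      simp [Fin.ext_iff]; omega
    simp [hne] at this
  refine ⟨x', isTorusRep_iff_mul.2 ⟨mem_maxTorus_iff.2 ⟨t', rfl⟩, ?_⟩, fun s => ?_⟩
  · let e0 : Cl (N + 1) := vec (stdVec (⟨0, by omega⟩ : Fin (N + 1)))
    have h0 : e0 * incl N x = incl N x' * e0 := by
      change e0 * incl N x = incl N (torusProd N t' (N / 2)) * e0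
      rw [ht, incl_torusProd t le_rfl, incl_torusProd t' le_rfl, hm]
      exact stdVec_zero_mul_torusProd (by omega) t m
    -- The conjugating vector is odd; the last basis vector, which commutes with `x`, is added to
    -- obtain an element of the spin group.
    have hk : e0 * vec (stdVec (Fin.last N)) ∈ spinGroup (negQ (N + 1)) := by
      refine mem_spinGroup_of_mem_pinGroup
        (mul_mem (vec_mem_pinGroup (by simp)) (vec_mem_pinGroup (by simp))) ?_
      have := SetLike.mul_mem_graded (A := evenOdd (negQ (N + 1)))
        (ι_mem_evenOdd_one (negQ (N + 1)) (stdVec (⟨0, by omega⟩ : Fin (N + 1))))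
        (ι_mem_evenOdd_one (negQ (N + 1)) (stdVec (Fin.last N)))
      exact this
    let k : Spin (N + 1) := ⟨_, hk⟩
    have hkx : (k : Cl (N + 1)) * incl N x = incl N x' * k := by
      change e0 * vec (stdVec (Fin.last N)) * incl N x =
        incl N x' * (e0 * vec (stdVec (Fin.last N)))
      rw [mul_assoc, ← incl_mul_last, ← mul_assoc, h0, mul_assoc]
    refine ⟨g * k⁻¹, ?_⟩
    rw [Submonoid.coe_mul, ← mul_assoc, hg, mul_assoc, mul_assoc, spin_inv_mul_eq hkx]
  -- Reversing one angle preserves the product of the cosines and changes the sign of the product of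
  -- the sines, which is not zero.
  · have hP : LinearMap.trace ℂ _ (cliffordRep N x' * parity (N / 2)) =
        -LinearMap.trace ℂ _ (cliffordRep N x * parity (N / 2)) := by
      rw [hx', ht, trace_torusProd_mul_parity, trace_torusProd_mul_parity, hm, Finset.prod_range_succ', Finset.prod_range_succ']
      simp [t']
    have hC : LinearMap.trace ℂ _ (cliffordRep N x') = LinearMap.trace ℂ _ (cliffordRep N x) := by
      rw [hx', ht, trace_torusProd, trace_torusProd, hm, Finset.prod_range_succ', Finset.prod_range_succ']
      simp [t']
    have hne : LinearMap.trace ℂ _ (cliffordRep N x * parity (N / 2)) ≠ 0 := by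
      rw [ht, trace_torusProd_mul_parity]
      refine Finset.prod_ne_zero_iff.2 fun j hj => ?_
      have := hsin j (Finset.mem_range.1 hj)
      rw [← Complex.ofReal_sin]
      exact mul_ne_zero (mul_ne_zero two_ne_zero Complex.I_ne_zero) (Complex.ofReal_ne_zero.2 this)
    rw [character_halfSpinRep, character_halfSpinRep, hP, hC]
    intro heq
    apply hne
    have hs : ((s : ℤ) : ℂ) * ((s : ℤ) : ℂ) = 1 := by
      rcases Int.units_eq_one_or s with rfl | rfl <;> simp
    linear_combination ((s : ℤ) : ℂ) * heq -
      LinearMap.trace ℂ _ (cliffordRep N x * parity (N / 2)) * hs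

/-- The spin characters of `x_γ` and `x_{γ'}` differ if `ε(γ) = 1` and `ε(γ') = -1`. -/
theorem character_ne_of_eq_one_of_eq_neg_one {N : ℕ} {y y' : Spin (N + 1)} {x x' : Spin N}
    (h : IsTorusRep y x) (h' : IsTorusRep y' x') (hy : (y : Cl (N + 1)) = 1)
    (hy' : (y' : Cl (N + 1)) = -1) : (spinRep N).character x ≠ (spinRep N).character x' := by
  intro heq
  have h1 := h.trace_eq
  have h2 := h'.trace_eq
  rw [← heq, ← h1, hy, hy', map_neg, map_neg, map_one] at h2
  have h3 := self_eq_neg.1 h2.symm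
  rw [LinearMap.trace_one] at h3
  have h4 : Module.finrank ℂ (Spinor (N + 1)) = 0 := by exact_mod_cast h3
  rw [finrank_euclideanSpace] at h4
  simp at h4

end ChoiceDependence

/-! ### The first Bieberbach theorem -/

section Bieberbach

variable {n : ℕ} {Γ : Subgroup (Isom n)}

/-- A uniformly separated family in a bounded region is finite. -/
theorem finite_of_separated {X ι : Type*} [PseudoMetricSpace X] [ProperSpace X] {f : ι → X}
    {S : Set ι} {x₀ : X} {C δ : ℝ} (hδ : 0 < δ) (hC : ∀ i ∈ S, dist (f i) x₀ ≤ C)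
    (hS : ∀ i ∈ S, ∀ j ∈ S, dist (f i) (f j) < δ → i = j) : S.Finite := by
  obtain ⟨t, -, ht, hcov⟩ := (isCompact_closedBall x₀ C).finite_cover_balls (half_pos hδ)
  refine (ht.biUnion (t := fun x => {i ∈ S | f i ∈ Metric.ball x (δ / 2)}) fun x _ => ?_).subset
    fun i hi => ?_
  · refine Set.Subsingleton.finite ?_
    rintro i ⟨hi, hix⟩ j ⟨hj, hjx⟩
    refine hS i hi j hj ?_
    calc dist (f i) (f j) ≤ dist (f i) x + dist (f j) x := dist_triangle_right _ _ _
      _ < δ / 2 + δ / 2 := add_lt_add hix hjx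
      _ = δ := add_halves δ
  · obtain ⟨x, hx, hix⟩ := Set.mem_iUnion₂.1 (hcov (Metric.mem_closedBall.2 (hC i hi)))
    exact Set.mem_iUnion₂.2 ⟨x, hx, hi, hix⟩

/-- The linear part of an isometry in `Γ`, as a continuous linear map. -/
def rotCLM (γ : Γ) : Euc n →L[ℝ] Euc n := ((rot Γ γ : Euc n ≃L[ℝ] Euc n) : Euc n →L[ℝ] Euc n)

theorem rotCLM_apply (γ : Γ) (x : Euc n) : rotCLM γ x = rot Γ γ x := rfl

theorem isom_apply (γ : Γ) (x : Euc n) : γ.1 x = rot Γ γ x + γ.1 0 := by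
  have := γ.1.map_vadd 0 x
  simp only [vadd_eq_add, add_zero] at this
  exact this

theorem isom_mul_zero (γ δ : Γ) : (γ * δ).1 0 = rot Γ γ (δ.1 0) + γ.1 0 := by
  rw [← isom_apply]
  rfl

theorem rot_mul_apply (γ δ : Γ) (x : Euc n) : rot Γ (γ * δ) x = rot Γ γ (rot Γ δ x) := by
  rw [map_mul]
  rfl

theorem rot_one_apply (x : Euc n) : rot Γ 1 x = x := by
  rw [map_one]
  rfl

theorem rot_inv_apply_self (γ : Γ) (x : Euc n) : rot Γ γ⁻¹ (rot Γ γ x) = x := by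
  rw [← rot_mul_apply, inv_mul_cancel, rot_one_apply]

theorem rot_apply_inv_self (γ : Γ) (x : Euc n) : rot Γ γ (rot Γ γ⁻¹ x) = x := by
  rw [← rot_mul_apply, mul_inv_cancel, rot_one_apply]

theorem rot_symm_apply (γ : Γ) (x : Euc n) : (rot Γ γ).symm x = rot Γ γ⁻¹ x := by
  rw [LinearIsometryEquiv.symm_apply_eq, rot_apply_inv_self]

theorem isom_inv_zero (γ : Γ) : (γ⁻¹).1 0 = -rot Γ γ⁻¹ (γ.1 0) := by
  have h := isom_mul_zero γ⁻¹ γ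
  rw [inv_mul_cancel] at h
  exact eq_neg_of_add_eq_zero_right h.symm

theorem eq_one_of_rot_eq_one {γ : Γ} (h : rot Γ γ = 1) (h0 : γ.1 0 = 0) : γ = 1 := by
  apply Subtype.ext
  ext1 x
  rw [isom_apply, h, h0, add_zero]
  rfl

/-- The distance of the linear part to the identity. -/
def rotDev (γ : Γ) : ℝ := ‖rotCLM γ - 1‖

theorem rotDev_nonneg (γ : Γ) : 0 ≤ rotDev γ := norm_nonneg _

theorem norm_rot_sub_le (γ : Γ) (x : Euc n) : ‖rot Γ γ x - x‖ ≤ rotDev γ * ‖x‖ :=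
  (rotCLM γ - 1).le_opNorm x

theorem rotDev_le {γ : Γ} {c : ℝ} (hc : 0 ≤ c) (h : ∀ x, ‖rot Γ γ x - x‖ ≤ c * ‖x‖) :
    rotDev γ ≤ c :=
  ContinuousLinearMap.opNorm_le_bound _ hc h

theorem rot_eq_one_of_rotDev_eq_zero {γ : Γ} (h : rotDev γ = 0) : rot Γ γ = 1 := by
  ext1 x
  have := norm_rot_sub_le γ x
  rw [h, zero_mul, norm_le_zero_iff, sub_eq_zero] at this
  exact this

theorem rotDev_inv_mul_le (γ δ : Γ) : rotDev (γ⁻¹ * δ) ≤ ‖rotCLM γ - rotCLM δ‖ := by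
  refine rotDev_le (norm_nonneg _) fun x => ?_
  have h1 : rot Γ (γ⁻¹ * δ) x - x = rot Γ γ⁻¹ (rot Γ δ x - rot Γ γ x) := by
    rw [rot_mul_apply, map_sub, rot_inv_apply_self]
  rw [h1, LinearIsometryEquiv.norm_map, norm_sub_rev]
  exact (rotCLM γ - rotCLM δ).le_opNorm x

theorem norm_rotCLM_le (γ : Γ) : ‖rotCLM γ‖ ≤ 1 :=
  ContinuousLinearMap.opNorm_le_bound _ zero_le_one fun x => by
    rw [rotCLM_apply, LinearIsometryEquiv.norm_map, one_mul]

/-- An isolating ball around the identity; discreteness of `Γ` enters the argument only in this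
form. -/
theorem IsBieberbach.exists_isolation (hΓ : IsBieberbach Γ) :
    ∃ δ > 0, ∀ γ : Γ, rotDev γ < δ → ‖γ.1 0‖ < δ → γ = 1 := by
  have hd := hΓ.discrete
  let f : Γ → (Euc n →L[ℝ] Euc n) × Euc n := fun γ => (rotCLM γ, γ.1 0)
  have hd' : DiscreteTopology (Set.range f) := hd
  have ho : IsOpen ({⟨f 1, 1, rfl⟩} : Set (Set.range f)) := isOpen_discrete _
  obtain ⟨U, hU, hU1⟩ := isOpen_induced_iff.1 ho
  have h1U : f 1 ∈ U := by
    have : (⟨f 1, 1, rfl⟩ : Set.range f) ∈ Subtype.val ⁻¹' U := by rw [hU1]; rfl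
    exact this
  obtain ⟨δ, hδ, hball⟩ := Metric.isOpen_iff.1 hU _ h1U
  refine ⟨δ, hδ, fun γ h1 h2 => ?_⟩
  have hf1 : f 1 = (1, 0) := by
    refine Prod.ext ?_ rfl
    ext1 x
    exact rot_one_apply (Γ := Γ) x
  have hmem : f γ ∈ Metric.ball (f 1) δ := by
    rw [hf1, Metric.mem_ball, Prod.dist_eq, max_lt_iff, dist_eq_norm, dist_zero_right]
    exact ⟨h1, h2⟩
  have : (⟨f γ, γ, rfl⟩ : Set.range f) ∈ ({⟨f 1, 1, rfl⟩} : Set (Set.range f)) := by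
    rw [← hU1]
    exact hball hmem
  have he : f γ = f 1 := congrArg Subtype.val this
  rw [hf1] at he
  refine eq_one_of_rot_eq_one ?_ (congrArg Prod.snd he)
  ext1 x
  exact congrArg (fun p : (Euc n →L[ℝ] Euc n) × Euc n => p.1 x) he

/-- Multiplication by inverses carries the isolating ball to every element, so `Γ` is uniformly
separated; linear parts have norm at most `1`, so a bound on the translation parts makes the set
bounded. -/
theorem IsBieberbach.finite_norm_le (hΓ : IsBieberbach Γ) (C : ℝ) :
    {γ : Γ | ‖γ.1 0‖ ≤ C}.Finite := by
  obtain ⟨δ, hδ, h⟩ := hΓ.exists_isolation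
  have : ProperSpace ((Euc n →L[ℝ] Euc n) × Euc n) := FiniteDimensional.proper ℝ _
  refine finite_of_separated (f := fun γ => (rotCLM γ, γ.1 0)) (x₀ := 0) (C := max 1 C) hδ
    (fun γ hγ => ?_) (fun γ _ γ' _ hd => ?_)
  · rw [dist_zero_right, Prod.norm_def]
    exact max_le_max (norm_rotCLM_le γ) hγ
  · rw [Prod.dist_eq, max_lt_iff, dist_eq_norm, dist_eq_norm] at hd
    have h1 := h (γ⁻¹ * γ') ((rotDev_inv_mul_le _ _).trans_lt hd.1) (by
      have e : (γ⁻¹ * γ').1 0 = rot Γ γ⁻¹ (γ'.1 0 - γ.1 0) := by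
        rw [isom_mul_zero, isom_inv_zero, map_sub]
        abel
      rw [e, LinearIsometryEquiv.norm_map, norm_sub_rev]
      exact hd.2)
    rw [← mul_one γ, ← h1, mul_inv_cancel_left]

theorem IsBieberbach.exists_min (hΓ : IsBieberbach Γ) {P : Γ → Prop} (h : ∃ γ, P γ) :
    ∃ γ, P γ ∧ ∀ γ', P γ' → ‖γ.1 0‖ ≤ ‖γ'.1 0‖ := by
  obtain ⟨γ₀, h₀⟩ := h
  obtain ⟨γ, ⟨hγ, hle⟩, hmin⟩ := Set.exists_min_image {γ : Γ | P γ ∧ ‖γ.1 0‖ ≤ ‖γ₀.1 0‖}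
    (fun γ => ‖γ.1 0‖) ((hΓ.finite_norm_le ‖γ₀.1 0‖).subset fun _ h => h.2) ⟨γ₀, h₀, le_rfl⟩
  refine ⟨γ, hγ, fun γ' hγ' => ?_⟩
  rcases le_total ‖γ'.1 0‖ ‖γ₀.1 0‖ with h | h
  · exact hmin γ' ⟨hγ', h⟩
  · exact hle.trans h

theorem IsBieberbach.exists_norm_sub_le (hΓ : IsBieberbach Γ) :
    ∃ d : ℝ, ∀ x : Euc n, ∃ γ : Γ, ‖γ.1 0 - x‖ ≤ d := by
  obtain ⟨K, hK, h⟩ := hΓ.cocompact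
  obtain ⟨d, hd⟩ := hK.isBounded.subset_closedBall (0 : Euc n)
  refine ⟨d, fun x => ?_⟩
  obtain ⟨γ, hγ⟩ := h x
  refine ⟨γ⁻¹, ?_⟩
  have h1 := hd hγ
  rw [mem_closedBall_zero_iff] at h1
  have e : (γ⁻¹).1 0 - x = -rot Γ γ⁻¹ (γ.1 x) := by
    rw [isom_inv_zero, isom_apply γ x, map_add, rot_inv_apply_self]
    abel
  rwa [e, norm_neg, LinearIsometryEquiv.norm_map]

/-- For every direction, `Γ` has elements with a translation part close to this direction and
with a linear part close to the identity. -/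
theorem IsBieberbach.exists_almost_translation (hΓ : IsBieberbach Γ) {u : Euc n} (hu : ‖u‖ = 1)
    {η : ℝ} (hη : 0 < η) :
    ∃ β : Γ, β.1 0 ≠ 0 ∧ rotDev β ≤ η ∧ ‖β.1 0 - ‖β.1 0‖ • u‖ ≤ η * ‖β.1 0‖ := by
  obtain ⟨d, hd⟩ := hΓ.exists_norm_sub_le
  -- The linear parts of these elements lie in a compact ball. Along a convergent subsequence,
  -- quotients of a far element by a fixed one have linear part close to `1` and translation part
  -- close to the direction `u`.
  choose β hβ using fun k : ℕ => hd ((k : ℝ) • u)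
  have : ProperSpace (Euc n →L[ℝ] Euc n) := FiniteDimensional.proper ℝ _
  obtain ⟨L, -, φ, hφ, hlim⟩ := tendsto_subseq_of_bounded
    (Metric.isBounded_closedBall (x := (0 : Euc n →L[ℝ] Euc n)) (r := 1))
    (x := fun k => rotCLM (β k)) (fun k => by
      rw [mem_closedBall_zero_iff]; exact norm_rotCLM_le _)
  obtain ⟨i, hi⟩ := Metric.cauchySeq_iff.1 hlim.cauchySeq η hη
  set D : ℝ := d + ‖(β (φ i)).1 0‖ with hD
  have hd0 : 0 ≤ d := (norm_nonneg _).trans (hβ 0)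
  have hD0 : 0 ≤ D := add_nonneg hd0 (norm_nonneg _)
  -- This makes the total error `2 * D` at most `η` times the length of the translation part.
  obtain ⟨j₀, hj₀⟩ := exists_nat_gt (D + 2 * D / η)
  set j := max i j₀ with hj
  have hM : D + 2 * D / η < (φ j : ℝ) :=
    hj₀.trans_le (by exact_mod_cast (le_max_right i j₀).trans (hφ.id_le j))
  set M : ℝ := (φ j : ℝ)
  let δ : Γ := β (φ j) * (β (φ i))⁻¹
  have hδ0 : ‖δ.1 0 - M • u‖ ≤ D := by
    have e : δ.1 0 - M • u = ((β (φ j)).1 0 - M • u) - rot Γ δ ((β (φ i)).1 0) := by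
      rw [isom_mul_zero, isom_inv_zero, map_neg, rot_mul_apply]
      abel
    rw [e]
    refine (norm_sub_le _ _).trans ?_
    rw [LinearIsometryEquiv.norm_map]
    exact add_le_add (hβ _) le_rfl
  have hMn : |M - ‖δ.1 0‖| ≤ D := by
    have h1 : ‖M • u‖ = M := by
      rw [norm_smul, hu, mul_one, Real.norm_of_nonneg (Nat.cast_nonneg _)]
    calc |M - ‖δ.1 0‖| = |‖M • u‖ - ‖δ.1 0‖| := by rw [h1]
      _ ≤ ‖M • u - δ.1 0‖ := abs_norm_sub_norm_le _ _
      _ ≤ D := by rw [norm_sub_rev]; exact hδ0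
  have hlow : M - D ≤ ‖δ.1 0‖ := by linarith [(abs_le.1 hMn).2]
  have h2D : 0 ≤ 2 * D / η := by positivity
  refine ⟨δ, ?_, ?_, ?_⟩
  · rw [← norm_pos_iff]
    linarith
  · refine rotDev_le hη.le fun x => ?_
    have e : rot Γ δ x - x = (rotCLM (β (φ j)) - rotCLM (β (φ i))) (rot Γ (β (φ i))⁻¹ x) := by
      rw [sub_apply, rotCLM_apply, rotCLM_apply, rot_apply_inv_self,
        rot_mul_apply]
    rw [e]
    refine (ContinuousLinearMap.le_opNorm _ _).trans ?_
    rw [LinearIsometryEquiv.norm_map]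
    have := hi j (le_max_left _ _) i le_rfl
    rw [dist_eq_norm] at this
    exact mul_le_mul_of_nonneg_right this.le (norm_nonneg _)
  · have e : δ.1 0 - ‖δ.1 0‖ • u = (δ.1 0 - M • u) + (M - ‖δ.1 0‖) • u := by module
    have h3 : ‖δ.1 0 - ‖δ.1 0‖ • u‖ ≤ D + D := by
      rw [e]
      refine (norm_add_le _ _).trans (add_le_add hδ0 ?_)
      rw [norm_smul, hu, mul_one]
      exact hMn
    have h4 : 2 * D ≤ η * ‖δ.1 0‖ := by
      have : 2 * D / η ≤ ‖δ.1 0‖ := by linarith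
      rw [div_le_iff₀ hη] at this
      linarith
    linarith

/-- With `w = Bx - x`, invariance of the inner product gives `⟨w, w⟩ = -⟨Bx, Bw - w⟩`, and
Cauchy–Schwarz applies. It bounds `(B - 1)²x` from below, which keeps commutators under control. -/
theorem sq_norm_rot_sub_le (γ : Γ) (x : Euc n) :
    ‖rot Γ γ x - x‖ ^ 2 ≤ ‖rot Γ γ (rot Γ γ x - x) - (rot Γ γ x - x)‖ * ‖x‖ := by
  set w := rot Γ γ x - x with hw
  have h1 : inner ℝ w w = -inner ℝ (rot Γ γ x) (rot Γ γ w - w) := by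
    have e := inner_sub_left (𝕜 := ℝ) (rot Γ γ x) x w
    rw [← hw] at e
    have e2 := inner_sub_right (𝕜 := ℝ) (rot Γ γ x) (rot Γ γ w) w
    have e3 := (rot Γ γ).inner_map_map x w
    linarith
  rw [← real_inner_self_eq_norm_sq, h1]
  refine (neg_le_abs _).trans ((abs_real_inner_le_norm _ _).trans ?_)
  rw [LinearIsometryEquiv.norm_map, mul_comm]

/-- For `x = BAy` the commutator minus the identity sends `x` to `(AB - BA)y`, and `AB - BA = (A -
1)(B - 1) - (B - 1)(A - 1)`. -/
theorem rotDev_commutator_le (α β : Γ) :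
    rotDev (α * β * α⁻¹ * β⁻¹) ≤ 2 * rotDev α * rotDev β := by
  refine rotDev_le (by have := rotDev_nonneg α; have := rotDev_nonneg β; positivity) fun x => ?_
  set y := rot Γ α⁻¹ (rot Γ β⁻¹ x) with hy
  have hx : x = rot Γ β (rot Γ α y) := by rw [hy, rot_apply_inv_self, rot_apply_inv_self]
  have hn : ‖x‖ = ‖y‖ := by
    rw [hx, LinearIsometryEquiv.norm_map, LinearIsometryEquiv.norm_map]
  have e : rot Γ (α * β * α⁻¹ * β⁻¹) x - x =
      (rot Γ α (rot Γ β y - y) - (rot Γ β y - y)) -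
        (rot Γ β (rot Γ α y - y) - (rot Γ α y - y)) := by
    rw [rot_mul_apply, rot_mul_apply, rot_mul_apply, ← hy]
    nth_rewrite 1 [hx]
    simp only [map_sub]
    abel
  rw [e, hn]
  have h1 := norm_rot_sub_le α (rot Γ β y - y)
  have h2 := norm_rot_sub_le β (rot Γ α y - y)
  have h3 := mul_le_mul_of_nonneg_left (norm_rot_sub_le β y) (rotDev_nonneg α)
  have h4 := mul_le_mul_of_nonneg_left (norm_rot_sub_le α y) (rotDev_nonneg β)
  refine (norm_sub_le _ _).trans ?_
  linarith

/-- The main term is `(A - 1)b`; the remaining ones are controlled by the deviations of the linear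
parts of the commutator and of `β`. -/
theorem commutator_zero (α β : Γ) :
    (α * β * α⁻¹ * β⁻¹).1 0 = (rot Γ α (β.1 0) - β.1 0) +
      ((β.1 0 - rot Γ (α * β * α⁻¹ * β⁻¹) (β.1 0)) +
        rot Γ α (rot Γ α⁻¹ (α.1 0) - rot Γ β (rot Γ α⁻¹ (α.1 0)))) := by
  simp only [isom_mul_zero, isom_inv_zero, rot_mul_apply, map_neg, map_sub, rot_apply_inv_self]
  abel

/-- Elements of `Γ` with a linear part close to the identity are translations. -/
theorem IsBieberbach.rot_eq_one_of_rotDev_le (hΓ : IsBieberbach Γ) {γ : Γ}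
    (hγ : rotDev γ ≤ 1 / 4) : rot Γ γ = 1 := by
  by_contra hne
  have hpos : 0 < rotDev γ := by
    rcases (rotDev_nonneg γ).lt_or_eq with h | h
    · exact h
    · exact absurd (rot_eq_one_of_rotDev_eq_zero h.symm) hne
  -- A counterexample with the shortest translation part.
  obtain ⟨α, ⟨hα0, hα4⟩, hαmin⟩ := hΓ.exists_min (P := fun α => 0 < rotDev α ∧ rotDev α ≤ 1 / 4)
    ⟨γ, hpos, hγ⟩
  set m := rotDev α with hm
  obtain ⟨u, hu1, hu⟩ : ∃ u : Euc n, ‖u‖ = 1 ∧ 3 / 4 * m ≤ ‖rot Γ α u - u‖ := by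
    by_contra! hcon
    have : m ≤ 3 / 4 * m := by
      refine rotDev_le (mul_nonneg (by norm_num) hα0.le) fun x => ?_
      rcases eq_or_ne x 0 with rfl | hx
      · simp
      · have hx' : ‖x‖ ≠ 0 := norm_ne_zero_iff.2 hx
        have h1 := (hcon (‖x‖⁻¹ • x) (by rw [norm_smul, norm_inv, norm_norm,
          inv_mul_cancel₀ hx'])).le
        rw [map_smul, ← smul_sub, norm_smul, norm_inv, norm_norm, inv_mul_le_iff₀ (norm_pos_iff.2 hx)]
          at h1
        linarith
    linarith
  -- The shortest `β` whose translation part is moved substantially by `α`, even after a penalty for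
  -- its own linear deviation. The commutator with `α` will be shorter and of the same kind.
  obtain ⟨β, ⟨hβ0, hβ⟩, hβmin⟩ := hΓ.exists_min
    (P := fun β => β.1 0 ≠ 0 ∧
      (m / 2 + 12 * rotDev β) * ‖β.1 0‖ ≤ ‖rot Γ α (β.1 0) - β.1 0‖) (by
    -- With `m / 96` the penalty is at most `m / 8`, so `5m / 8` is required, less than the
    -- available `3m / 4` minus a small error.
    obtain ⟨β, hβ0, hβη, hβu⟩ := hΓ.exists_almost_translation hu1
      (η := m / 96) (div_pos hα0 (by norm_num))
    refine ⟨β, hβ0, ?_⟩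
    set b := β.1 0
    have e : rot Γ α b - b = ‖b‖ • (rot Γ α u - u) +
        (rot Γ α (b - ‖b‖ • u) - (b - ‖b‖ • u)) := by
      rw [map_sub, map_smul, smul_sub]
      abel
    have h1 := norm_rot_sub_le α (b - ‖b‖ • u)
    have h2 : ‖b‖ * (3 / 4 * m) ≤ ‖‖b‖ • (rot Γ α u - u)‖ := by
      rw [norm_smul, norm_norm]
      exact mul_le_mul_of_nonneg_left hu (norm_nonneg _)
    have h3 : ‖‖b‖ • (rot Γ α u - u)‖ - ‖rot Γ α (b - ‖b‖ • u) - (b - ‖b‖ • u)‖ ≤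
        ‖rot Γ α b - b‖ := by
      rw [e]
      exact norm_sub_le_norm_add _ _
    have h4 : m * ‖b - ‖b‖ • u‖ ≤ 1 / 4 * (m / 96 * ‖b‖) :=
      mul_le_mul hα4 hβu (norm_nonneg _) (by norm_num)
    have h5 : rotDev β * ‖b‖ ≤ m / 96 * ‖b‖ := mul_le_mul_of_nonneg_right hβη (norm_nonneg _)
    have h6 : 0 ≤ m * ‖b‖ := mul_nonneg hα0.le (norm_nonneg _)
    linarith)
  set η := rotDev β with hη
  set b := β.1 0 with hb
  set δ := α * β * α⁻¹ * β⁻¹ with hδ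
  have hη0 : 0 ≤ η := rotDev_nonneg β
  have hx : 0 < ‖b‖ := norm_pos_iff.2 hβ0
  set x := ‖b‖ with hxdef
  set p := ‖rot Γ α b - b‖ with hp
  have hpm : p ≤ m * x := norm_rot_sub_le α b
  have hηm : 12 * η ≤ m / 2 := by
    have : (m / 2 + 12 * η) * x ≤ m * x := hβ.trans hpm
    have := le_of_mul_le_mul_right this hx
    linarith
  have hδdev : rotDev δ ≤ η / 2 := by
    refine (rotDev_commutator_le α β).trans ?_
    rw [← hm, ← hη]
    have := mul_le_mul_of_nonneg_right hα4 hη0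
    linarith
  -- If `η` is positive, `β` competes with `α` in the choice of `α`, since `12η ≤ m / 2 ≤ 1 / 8`.
  have hηa : η * ‖α.1 0‖ ≤ η * x := by
    rcases hη0.lt_or_eq with h | h
    · exact mul_le_mul_of_nonneg_left (hαmin β ⟨h, by linarith⟩) hη0
    · rw [← h, zero_mul, zero_mul]
  set r := (b - rot Γ δ b) + rot Γ α (rot Γ α⁻¹ (α.1 0) - rot Γ β (rot Γ α⁻¹ (α.1 0))) with hr
  have hδb : δ.1 0 = (rot Γ α b - b) + r := commutator_zero α β
  have hrle : ‖r‖ ≤ 2 * η * x := by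
    have h1 := norm_rot_sub_le δ b
    have h2 := norm_rot_sub_le β (rot Γ α⁻¹ (α.1 0))
    rw [LinearIsometryEquiv.norm_map] at h2
    have h3 : rotDev δ * ‖b‖ ≤ η / 2 * x := mul_le_mul_of_nonneg_right hδdev hx.le
    refine (norm_add_le _ _).trans ?_
    rw [LinearIsometryEquiv.norm_map, norm_sub_rev, norm_sub_rev (rot Γ α⁻¹ (α.1 0))]
    have h4 : 0 ≤ η * x := mul_nonneg hη0 hx.le
    linarith
  have hup : ‖δ.1 0‖ ≤ p + 2 * η * x := by
    rw [hδb]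
    exact (norm_add_le _ _).trans (add_le_add le_rfl hrle)
  have hlow : p - 2 * η * x ≤ ‖δ.1 0‖ := by
    rw [hδb]
    exact (sub_le_sub_left hrle _).trans (norm_sub_le_norm_add _ _)
  have hmx : 0 < m * x := mul_pos hα0 hx
  have hηx : 0 ≤ η * x := mul_nonneg hη0 hx.le
  have hlt : ‖δ.1 0‖ < x := by
    have h1 := mul_le_mul_of_nonneg_right hα4 hx.le
    have h2 := mul_le_mul_of_nonneg_right hηm hx.le
    linarith
  refine absurd (hβmin δ ⟨?_, ?_⟩) (not_le.2 hlt)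
  · rw [← norm_pos_iff]
    linarith
  -- The commutator satisfies the inequality again: its deviation is at most `η / 2`, which halves
  -- the penalty, and the gain `6ηp` outweighs all the errors.
  · have h1 : p ^ 2 ≤ ‖rot Γ α (rot Γ α b - b) - (rot Γ α b - b)‖ * x := sq_norm_rot_sub_le α b
    set z := ‖rot Γ α (rot Γ α b - b) - (rot Γ α b - b)‖
    have h2 : z - m * (2 * η * x) ≤ ‖rot Γ α (δ.1 0) - δ.1 0‖ := by
      have e : rot Γ α (δ.1 0) - δ.1 0 = (rot Γ α (rot Γ α b - b) - (rot Γ α b - b)) +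
          (rot Γ α r - r) := by
        rw [hδb, map_add]
        abel
      have h3 : ‖rot Γ α r - r‖ ≤ m * (2 * η * x) :=
        (norm_rot_sub_le α r).trans (mul_le_mul_of_nonneg_left hrle hα0.le)
      rw [e]
      exact (sub_le_sub_left h3 _).trans (norm_sub_le_norm_add _ _)
    have h4 : (m / 2 + 12 * rotDev δ) * ‖δ.1 0‖ ≤ (m / 2 + 6 * η) * (p + 2 * η * x) :=
      mul_le_mul (by linarith) hup (norm_nonneg _) (by linarith)
    have h5 : (m / 2 + 12 * η) * p ≤ z := by
      have h6 : (m / 2 + 12 * η) * x * p ≤ p * p :=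
        mul_le_mul_of_nonneg_right hβ (norm_nonneg _)
      have : ((m / 2 + 12 * η) * p) * x ≤ z * x := by linarith [h1, h6, sq p]
      exact le_of_mul_le_mul_right this hx
    have h7 : 6 * η * ((m / 2 + 12 * η) * x) ≤ 6 * η * p :=
      mul_le_mul_of_nonneg_left hβ (mul_nonneg (by norm_num) hη0)
    have h8 : 0 ≤ η ^ 2 * x := mul_nonneg (sq_nonneg η) hx.le
    refine h4.trans (le_trans ?_ h2)
    linarith

/-- Linear parts at distance less than `1 / 4` belong to the same coset, and all of them lie in a
compact ball. -/
theorem IsBieberbach.finite_quotient (hΓ : IsBieberbach Γ) : Finite (Γ ⧸ latt Γ) := by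
  have : ProperSpace (Euc n →L[ℝ] Euc n) := FiniteDimensional.proper ℝ _
  rw [← Set.finite_univ_iff]
  refine finite_of_separated (f := fun q : Γ ⧸ latt Γ => rotCLM q.out) (x₀ := 0) (C := 1)
    (δ := 1 / 4) (by norm_num) (fun q _ => ?_) (fun q _ q' _ h => ?_)
  · rw [dist_zero_right]
    exact norm_rotCLM_le _
  · rw [dist_eq_norm] at h
    have h1 := hΓ.rot_eq_one_of_rotDev_le ((rotDev_inv_mul_le q.out q'.out).trans h.le)
    rw [← q.out_eq', ← q'.out_eq']
    exact QuotientGroup.eq.2 (MonoidHom.mem_ker.2 h1)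

theorem isom_zero_of_mem_latt {γ : Γ} (hγ : γ ∈ latt Γ) : γ.1 0 = transl γ := by
  rw [transl, MonoidHom.mem_ker.1 hγ]
  rfl

theorem isom_apply_of_mem_latt {γ : Γ} (hγ : γ ∈ latt Γ) (x : Euc n) : γ.1 x = x + transl γ := by
  rw [isom_apply, MonoidHom.mem_ker.1 hγ, isom_zero_of_mem_latt hγ]
  rfl

/-- By finiteness of the quotient, the orbit of the origin stays within a bounded distance `c` of
the lattice. A point at distance `d + c + 1` along a direction orthogonal to the lattice would be
farther than `d` from the orbit, against cocompactness. -/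
theorem IsBieberbach.span_latt (hΓ : IsBieberbach Γ) :
    Submodule.span ℝ (transl '' (latt Γ : Set Γ)) = ⊤ := by
  have := hΓ.finite_quotient
  obtain ⟨d, hd⟩ := hΓ.exists_norm_sub_le
  obtain ⟨c, hc⟩ := (Set.finite_range fun q : Γ ⧸ latt Γ => ‖q.out.1 0‖).bddAbove
  rw [← Submodule.orthogonal_eq_bot_iff, Submodule.eq_bot_iff]
  intro u hu
  by_contra hu0
  set v := ‖u‖⁻¹ • u with hv
  have hv1 : ‖v‖ = 1 := by
    rw [hv, norm_smul, norm_inv, norm_norm, inv_mul_cancel₀ (norm_ne_zero_iff.2 hu0)]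
  obtain ⟨γ, hγ⟩ := hd ((d + c + 1) • v)
  let ρ : Γ := (γ : Γ ⧸ latt Γ).out
  have hρ : ρ⁻¹ * γ ∈ latt Γ := QuotientGroup.eq.1 (QuotientGroup.out_eq' _)
  have hl : γ * ρ⁻¹ ∈ latt Γ := by
    have := (MonoidHom.normal_ker (rot Γ)).conj_mem _ hρ ρ
    rwa [mul_inv_cancel_left] at this
  set l := γ * ρ⁻¹ with hldef
  have hγl : γ.1 0 = ρ.1 0 + transl l := by
    rw [← isom_apply_of_mem_latt hl]
    have : γ = l * ρ := by rw [hldef, inv_mul_cancel_right]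
    nth_rewrite 1 [this]
    rfl
  have hin : inner ℝ (transl l) v = (0 : ℝ) := by
    rw [hv, real_inner_smul_right, hu _ (Submodule.subset_span ⟨l, hl, rfl⟩), mul_zero]
  have hc' : ‖ρ.1 0‖ ≤ c := hc ⟨_, rfl⟩
  have h1 : ‖transl l - (d + c + 1) • v‖ ≤ d + c := by
    have e : transl l - (d + c + 1) • v = (γ.1 0 - (d + c + 1) • v) - ρ.1 0 := by
      rw [hγl]; abel
    rw [e]
    exact (norm_sub_le _ _).trans (add_le_add hγ hc')
  have h2 := abs_real_inner_le_norm (transl l - (d + c + 1) • v) v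
  rw [inner_sub_left, hin, real_inner_smul_left, real_inner_self_eq_norm_sq, hv1] at h2
  have h3 := (abs_le.1 (h2.trans_eq (mul_one _))).1
  linarith

/-- In a torsion-free group, every linear part fixes a unit vector. -/
theorem IsBieberbach.exists_fixed {N : ℕ} {Γ : Subgroup (Isom (N + 1))} (hΓ : IsBieberbach Γ)
    (γ : Γ) : ∃ u : Euc (N + 1), ‖u‖ = 1 ∧ rot Γ γ u = u := by
  by_contra! hcon
  have hinj : Function.Injective (rotCLM γ - 1 : Euc (N + 1) →L[ℝ] Euc (N + 1)) := by
    refine (injective_iff_map_eq_zero _).2 fun x hx => ?_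
    by_contra hx0
    refine hcon (‖x‖⁻¹ • x) ?_ ?_
    · rw [norm_smul, norm_inv, norm_norm, inv_mul_cancel₀ (norm_ne_zero_iff.2 hx0)]
    · rw [map_smul]
      congr 1
      exact sub_eq_zero.1 hx
  -- If `B - 1` is injective, then it is onto and `γ` has a fixed point `p`.
  obtain ⟨p, hp⟩ := LinearMap.surjective_of_injective
    (f := ((rotCLM γ - 1 : Euc (N + 1) →L[ℝ] Euc (N + 1)) : Euc (N + 1) →ₗ[ℝ] Euc (N + 1)))
    hinj (-γ.1 0)
  have hp' : γ.1 p = p := by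
    have : rot Γ γ p - p = -γ.1 0 := hp
    rw [eq_neg_iff_add_eq_zero, ← add_sub_right_comm, sub_eq_zero, ← isom_apply] at this
    exact this
  have hpow : ∀ k : ℕ, (γ ^ k).1 p = p := by
    intro k
    induction k with
    | zero => rfl
    | succ k ih =>
      rw [pow_succ]
      change (γ ^ k).1 (γ.1 p) = p
      rw [hp', ih]
  -- All powers of `γ` fix `p`, so only finitely many are distinct; torsion-freeness then gives `γ =
  -- 1`, which fixes everything.
  have hbd : ∀ k : ℕ, γ ^ k ∈ {γ : Γ | ‖γ.1 0‖ ≤ ‖p‖ + ‖p‖} := by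
    intro k
    have e : (γ ^ k).1 0 = p - rot Γ (γ ^ k) p := by
      have := isom_apply (γ ^ k) p
      rw [hpow] at this
      exact eq_sub_of_add_eq' this.symm
    change ‖(γ ^ k).1 0‖ ≤ _
    rw [e]
    refine (norm_sub_le _ _).trans ?_
    rw [LinearIsometryEquiv.norm_map]
  have hfin := (hΓ.finite_norm_le (‖p‖ + ‖p‖)).to_subtype
  obtain ⟨i, j, hij, he⟩ := Finite.exists_ne_map_eq_of_infinite
    (fun k : ℕ => (⟨γ ^ k, hbd k⟩ : {γ : Γ | ‖γ.1 0‖ ≤ ‖p‖ + ‖p‖}))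
  have he' : γ ^ i = γ ^ j := congrArg Subtype.val he
  have hone : γ = 1 := by
    rcases lt_or_gt_of_ne hij with h | h
    · refine hΓ.torsionFree γ (j - i) (by omega) ?_
      rw [pow_sub _ h.le, he', mul_inv_cancel]
    · refine hΓ.torsionFree γ (i - j) (by omega) ?_
      rw [pow_sub _ h.le, he', mul_inv_cancel]
  refine hcon (stdVec 0) (by simp) ?_
  rw [hone, rot_one_apply]

end Bieberbach

/-! ### Fourier series of functions that are periodic under a lattice -/

section Fourier

open MeasureTheory UnitAddTorus

/-- The normalized Haar measure on the circle. -/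
local instance : MeasureSpace UnitAddCircle := ⟨AddCircle.haarAddCircle⟩

local instance : Measure.IsAddHaarMeasure (volume : Measure UnitAddCircle) :=
  inferInstanceAs (Measure.IsAddHaarMeasure AddCircle.haarAddCircle)

local instance : IsProbabilityMeasure (volume : Measure UnitAddCircle) :=
  inferInstanceAs (IsProbabilityMeasure AddCircle.haarAddCircle)

variable {n : ℕ} {M : Type*} [NormedAddCommGroup M] [NormedSpace ℂ M]

/-- The plane wave `x ↦ e^{2πi u·x}`. -/
def planeWave (u x : Euc n) : ℂ := Complex.exp (2 * Real.pi * Complex.I * (inner ℝ u x : ℝ))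

theorem planeWave_add (u x y : Euc n) : planeWave u (x + y) = planeWave u x * planeWave u y := by
  simp only [planeWave, inner_add_right, Complex.ofReal_add, mul_add, Complex.exp_add]

theorem planeWave_ne_zero (u x : Euc n) : planeWave u x ≠ 0 := Complex.exp_ne_zero _

theorem exists_planeWave_ne {u u' : Euc n} (h : u ≠ u') : ∃ x, planeWave u x ≠ planeWave u' x := by
  have h0 : ‖u - u'‖ ^ 2 ≠ 0 := pow_ne_zero 2 (norm_ne_zero_iff.2 (sub_ne_zero.2 h))
  -- At this point the two phases differ by half a period.
  refine ⟨(1 / (2 * ‖u - u'‖ ^ 2)) • (u - u'), fun he => ?_⟩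
  set x := (1 / (2 * ‖u - u'‖ ^ 2)) • (u - u') with hx
  have h1 : inner ℝ u x = inner ℝ u' x + 1 / 2 := by
    have : inner ℝ (u - u') x = (1 / 2 : ℝ) := by
      rw [hx, real_inner_smul_right, real_inner_self_eq_norm_sq, one_div, mul_inv, mul_assoc,
        inv_mul_cancel₀ h0, mul_one, one_div]
    rw [inner_sub_left] at this
    linarith
  have h2 : planeWave u x = planeWave u' x * Complex.exp (Real.pi * Complex.I) := by
    rw [planeWave, planeWave, h1, ← Complex.exp_add]
    congr 1
    push_cast
    ring
  rw [Complex.exp_pi_mul_I, he] at h2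
  exact planeWave_ne_zero u' x (by linear_combination h2 / 2)

theorem hasDerivAt_planeWave (u h : Euc n) :
    HasDerivAt (fun t : ℝ => planeWave u (t • h))
      (2 * Real.pi * Complex.I * (inner ℝ u h : ℝ)) 0 := by
  have h1 : (fun t : ℝ => planeWave u (t • h)) =
      fun t : ℝ => Complex.exp ((2 * Real.pi * Complex.I * (inner ℝ u h : ℝ)) * (t : ℂ)) := by
    ext t
    rw [planeWave, real_inner_smul_right]
    congr 1
    push_cast
    ring
  rw [h1]
  have h2 : HasDerivAt (fun t : ℝ => (2 * Real.pi * Complex.I * (inner ℝ u h : ℝ)) * (t : ℂ))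
      (2 * Real.pi * Complex.I * (inner ℝ u h : ℝ)) 0 := by
    simpa using (Complex.ofRealCLM.hasDerivAt (x := 0)).const_mul
      (2 * Real.pi * Complex.I * (inner ℝ u h : ℝ) : ℂ)
  simpa using h2.cexp

theorem contDiff_planeWave (u : Euc n) : ContDiff ℝ ∞ (planeWave u) := by
  unfold planeWave
  refine ContDiff.cexp (contDiff_const.mul ?_)
  exact Complex.ofRealCLM.contDiff.comp (contDiff_const.inner ℝ contDiff_id)

theorem continuous_planeWave (u : Euc n) : Continuous (planeWave u) :=
  (contDiff_planeWave u).continuous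

variable {v : Module.Basis (Fin n) ℝ (Euc n)}

/-- A set-theoretic section of the projection of the line onto the circle. -/
def circleSection : UnitAddCircle → ℝ :=
  Function.surjInv (QuotientAddGroup.mk_surjective : Function.Surjective ((↑) : ℝ → UnitAddCircle))

theorem coe_circleSection (θ : UnitAddCircle) : (circleSection θ : UnitAddCircle) = θ :=
  Function.surjInv_eq _ θ

theorem exists_circleSection_coe (y : ℝ) : ∃ k : ℤ, circleSection (y : UnitAddCircle) = y + k := by
  have h : ((circleSection (y : UnitAddCircle) - y : ℝ) : UnitAddCircle) = 0 := by
    rw [AddCircle.coe_sub, coe_circleSection, sub_self]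
  obtain ⟨k, hk⟩ := (AddCircle.coe_eq_zero_iff 1).1 h
  refine ⟨k, ?_⟩
  rw [zsmul_eq_mul, mul_one] at hk
  linarith

/-- The function on the torus that is defined by a function with the periods `v i`. -/
def torusLift (v : Module.Basis (Fin n) ℝ (Euc n)) (g : Euc n → M) :
    UnitAddTorus (Fin n) → M :=
  fun θ => g (∑ i, circleSection (θ i) • v i)

/-- The projection onto the torus. -/
def torusProj (y : Fin n → ℝ) : UnitAddTorus (Fin n) := fun i => (y i : UnitAddCircle)

theorem isOpenQuotientMap_torusProj : IsOpenQuotientMap (torusProj (n := n)) :=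
  IsOpenQuotientMap.piMap fun _ => QuotientAddGroup.isOpenQuotientMap_mk

/-- The arbitrary section changes the coordinates by integers only, and the periods of `g` form a
group. -/
theorem torusLift_torusProj {g : Euc n → M} (hg : ∀ i x, g (x + v i) = g x) (y : Fin n → ℝ) :
    torusLift v g (torusProj y) = g (∑ i, y i • v i) := by
  let P : AddSubgroup (Euc n) :=
    { carrier := {w | ∀ x, g (x + w) = g x}
      zero_mem' := fun x => by rw [add_zero]
      add_mem' := fun {a b} ha hb x => by rw [← add_assoc, hb, ha]
      neg_mem' := fun {a} ha x => by
        have := ha (x + -a)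
        rwa [neg_add_cancel_right, eq_comm] at this }
  choose k hk using fun i => exists_circleSection_coe (y i)
  have h1 : ∑ i, circleSection (y i : UnitAddCircle) • v i =
      ∑ i, y i • v i + ∑ i, k i • v i := by
    rw [← Finset.sum_add_distrib]
    refine Finset.sum_congr rfl fun i _ => ?_
    rw [hk, add_smul, Int.cast_smul_eq_zsmul]
  have h2 : ∑ i, k i • v i ∈ P := sum_mem fun i _ => P.zsmul_mem (fun x => hg i x) _
  change g (∑ i, circleSection (y i : UnitAddCircle) • v i) = _
  rw [h1]
  exact h2 _

theorem continuous_torusLift {g : Euc n → M} (hg : ∀ i x, g (x + v i) = g x)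
    (hc : Continuous g) : Continuous (torusLift v g) := by
  rw [isOpenQuotientMap_torusProj.isQuotientMap.continuous_iff]
  have : torusLift v g ∘ torusProj = fun y => g (∑ i, y i • v i) :=
    funext fun y => torusLift_torusProj hg y
  rw [this]
  fun_prop

theorem exists_eq_sum_smul (v : Module.Basis (Fin n) ℝ (Euc n)) (x : Euc n) :
    ∃ y : Fin n → ℝ, x = ∑ i, y i • v i :=
  ⟨v.repr x, (v.sum_repr x).symm⟩

theorem torusLift_add {g : Euc n → M} (hg : ∀ i x, g (x + v i) = g x) (s : Fin n → ℝ)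
    (θ : UnitAddTorus (Fin n)) :
    torusLift v (fun x => g (x + ∑ i, s i • v i)) θ = torusLift v g (θ + torusProj s) := by
  obtain ⟨y, rfl⟩ := isOpenQuotientMap_torusProj.surjective θ
  have h1 : torusProj y + torusProj s = torusProj (y + s) := by
    ext i
    simp [torusProj]
  rw [h1, torusLift_torusProj hg, torusLift_torusProj fun i x => ?_]
  · simp only [Pi.add_apply, add_smul, Finset.sum_add_distrib]
  · rw [add_right_comm, hg]

theorem mFourier_torusProj {u : Euc n} {k : Fin n → ℤ} (hu : ∀ i, inner ℝ u (v i) = (k i : ℝ))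
    (y : Fin n → ℝ) : mFourier k (torusProj y) = planeWave u (∑ i, y i • v i) := by
  simp only [mFourier, ContinuousMap.coe_mk, torusProj, fourier_coe_apply, planeWave]
  rw [← Complex.exp_sum, inner_sum]
  congr 1
  push_cast
  rw [Finset.mul_sum]
  refine Finset.sum_congr rfl fun i _ => ?_
  rw [real_inner_smul_right, hu]
  push_cast
  ring

theorem torusLift_planeWave {u : Euc n} {k : Fin n → ℤ} (hu : ∀ i, inner ℝ u (v i) = (k i : ℝ))
    (θ : UnitAddTorus (Fin n)) : torusLift v (planeWave u) θ = mFourier k θ := by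
  have h := mFourier_torusProj hu (fun i => circleSection (θ i))
  rw [torusLift, ← h]
  congr 1
  ext i
  exact coe_circleSection (θ i)

/-- Haar measure is invariant, so the translation can be moved onto the character, where it becomes
a scalar factor. -/
theorem mFourierCoeff_translate {g : Euc n → M} (hg : ∀ i x, g (x + v i) = g x)
    {u : Euc n} {k : Fin n → ℤ} (hu : ∀ i, inner ℝ u (v i) = (k i : ℝ)) (h : Euc n) :
    mFourierCoeff (torusLift v fun x => g (x + h)) k =
      planeWave u h • mFourierCoeff (torusLift v g) k := by
  obtain ⟨s, rfl⟩ := exists_eq_sum_smul v h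
  have hmul : ∀ θ : UnitAddTorus (Fin n), mFourier (-k) (θ + torusProj s) * mFourier k (torusProj s)
      = mFourier (-k) θ := by
    intro θ
    obtain ⟨y, rfl⟩ := isOpenQuotientMap_torusProj.surjective θ
    have h1 : torusProj y + torusProj s = torusProj (y + s) := by
      ext i
      simp [torusProj]
    have hu' : ∀ i, inner ℝ (-u) (v i) = (((-k) i : ℤ) : ℝ) := fun i => by
      rw [inner_neg_left, hu]; simp
    rw [h1, mFourier_torusProj hu', mFourier_torusProj hu', mFourier_torusProj hu]
    simp only [Pi.add_apply, add_smul, Finset.sum_add_distrib, planeWave_add]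
    rw [mul_assoc]
    have : planeWave (-u) (∑ i, s i • v i) * planeWave u (∑ i, s i • v i) = 1 := by
      rw [planeWave, planeWave, ← Complex.exp_add, inner_neg_left]
      simp
    rw [this, mul_one]
  unfold mFourierCoeff
  rw [← integral_smul,
    ← integral_add_right_eq_self (fun θ => planeWave u _ • _) (torusProj s)]
  refine integral_congr_ae (Filter.Eventually.of_forall fun θ => ?_)
  beta_reduce
  rw [torusLift_add hg, ← hmul θ, ← mFourier_torusProj hu, smul_smul, mul_comm]

/-- The dual of the lattice that is generated by a basis. -/
def dualSet (v : Module.Basis (Fin n) ℝ (Euc n)) : Set (Euc n) :=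
  {u | ∀ i, ∃ k : ℤ, inner ℝ u (v i) = (k : ℝ)}

/-- The Fourier coefficient of a periodic function at a vector of the dual lattice. -/
def waveCoeff (v : Module.Basis (Fin n) ℝ (Euc n)) (g : Euc n → M) (u : Euc n) : M :=
  mFourierCoeff (torusLift v g) fun i => round (inner ℝ u (v i))

theorem inner_eq_round {u : Euc n} (hu : u ∈ dualSet v) (i : Fin n) :
    inner ℝ u (v i) = ((round (inner ℝ u (v i)) : ℤ) : ℝ) := by
  obtain ⟨k, hk⟩ := hu i
  rw [hk, round_intCast]

theorem waveCoeff_translate {g : Euc n → M} (hg : ∀ i x, g (x + v i) = g x)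
    {u : Euc n} (hu : u ∈ dualSet v) (h : Euc n) :
    waveCoeff v (fun x => g (x + h)) u = planeWave u h • waveCoeff v g u :=
  mFourierCoeff_translate hg (inner_eq_round hu) h

theorem integrable_mFourier_smul {g : Euc n → M} (hg : ∀ i x, g (x + v i) = g x)
    (hc : Continuous g) (k : Fin n → ℤ) :
    Integrable (fun θ => mFourier k θ • torusLift v g θ) :=
  ((mFourier k).continuous.smul (continuous_torusLift hg hc)).integrable_of_hasCompactSupport
    (HasCompactSupport.of_compactSpace _)

theorem waveCoeff_sum {ι : Type*} (s : Finset ι) {g : ι → Euc n → M}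
    (hg : ∀ j i x, g j (x + v i) = g j x) (hc : ∀ j, Continuous (g j)) (u : Euc n) :
    waveCoeff v (fun x => ∑ j ∈ s, g j x) u = ∑ j ∈ s, waveCoeff v (g j) u := by
  unfold waveCoeff mFourierCoeff
  rw [← integral_finsetSum _ fun j _ => integrable_mFourier_smul (hg j) (hc j) _]
  simp only [torusLift, Finset.smul_sum]

theorem waveCoeff_comp {M' : Type*} [NormedAddCommGroup M'] [NormedSpace ℂ M'] [CompleteSpace M]
    [CompleteSpace M'] (A : M →L[ℂ] M') {g : Euc n → M} (hg : ∀ i x, g (x + v i) = g x)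
    (hc : Continuous g) (u : Euc n) :
    waveCoeff v (fun x => A (g x)) u = A (waveCoeff v g u) := by
  unfold waveCoeff mFourierCoeff
  rw [← A.integral_comp_comm (integrable_mFourier_smul hg hc _)]
  simp only [torusLift, map_smul]

theorem planeWave_add_basis {u : Euc n} (hu : u ∈ dualSet v) (i : Fin n) (x : Euc n) :
    planeWave u (x + v i) = planeWave u x := by
  obtain ⟨k, hk⟩ := hu i
  have : planeWave u (v i) = 1 := by
    rw [planeWave, hk, Complex.ofReal_intCast, mul_comm]
    exact Complex.exp_int_mul_two_pi_mul_I k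
  rw [planeWave_add, this, mul_one]

theorem continuous_planeWave_smul (u : Euc n) (w : M) : Continuous fun x => planeWave u x • w :=
  Continuous.smul (continuous_planeWave u) continuous_const

theorem waveCoeff_planeWave_smul [CompleteSpace M] {u u' : Euc n} (hu : u ∈ dualSet v)
    (hu' : u' ∈ dualSet v) (w : M) [Decidable (u = u')] :
    waveCoeff v (fun x => planeWave u' x • w) u = if u = u' then w else 0 := by
  have hper : ∀ i x, planeWave u' (x + v i) • w = planeWave u' x • w := fun i x => by
    rw [planeWave_add_basis hu']
  split_ifs with h
  · subst h
    unfold waveCoeff mFourierCoeff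
    have h1 : ∀ θ : UnitAddTorus (Fin n), mFourier (-fun i => round (inner ℝ u (v i))) θ •
        torusLift v (fun x => planeWave u x • w) θ = w := fun θ => by
      change _ • torusLift v (planeWave u) θ • w = w
      rw [torusLift_planeWave (inner_eq_round hu), smul_smul, ← mFourier_add, neg_add_cancel,
        mFourier_zero, ContinuousMap.one_apply, one_smul]
    simp only [h1, integral_const, probReal_univ, one_smul]
  -- A translation by `h` multiplies the coefficient by the values of both waves at `h`; where these
  -- differ, the coefficient must vanish.
  · obtain ⟨h, hne⟩ := exists_planeWave_ne h
    have h1 := waveCoeff_translate (g := fun x => planeWave u' x • w) hper hu h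
    have hc := continuous_planeWave_smul u' w
    have h2 := waveCoeff_comp (v := v) (planeWave u' h • ContinuousLinearMap.id ℂ M) hper hc u
    have h3 : (fun x => planeWave u' (x + h) • w) = fun x =>
        (planeWave u' h • ContinuousLinearMap.id ℂ M) (planeWave u' x • w) := by
      ext x
      rw [planeWave_add, mul_comm, mul_smul]
      rfl
    rw [h3, h2] at h1
    have h4 : (planeWave u h - planeWave u' h) •
        waveCoeff v (fun x => planeWave u' x • w) u = 0 := by
      rw [sub_smul, ← h1, smul_apply, ContinuousLinearMap.id_apply, sub_self]
    exact (smul_eq_zero.1 h4).resolve_left (sub_ne_zero.2 hne)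

theorem exists_mem_dualSet (v : Module.Basis (Fin n) ℝ (Euc n)) (k : Fin n → ℤ) :
    ∃ u ∈ dualSet v, (fun i => round (inner ℝ u (v i))) = k := by
  let ℓ : Euc n →ₗ[ℝ] ℝ := v.constr ℝ fun i => (k i : ℝ)
  have h : ∀ i, inner ℝ ((InnerProductSpace.toDual ℝ (Euc n)).symm ℓ.toContinuousLinearMap) (v i)
      = (k i : ℝ) := fun i => by
    rw [InnerProductSpace.toDual_symm_apply]
    simp [ℓ]
  refine ⟨_, fun i => ⟨k i, h i⟩, funext fun i => ?_⟩
  rw [h, round_intCast]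

/-- Continuous functionals reduce to scalar functions. There the zero coefficients are summable, so
the Fourier series converges pointwise to the function. -/
theorem eq_zero_of_waveCoeff_eq_zero [CompleteSpace M] {g : Euc n → M}
    (hg : ∀ i x, g (x + v i) = g x) (hc : Continuous g)
    (h : ∀ u ∈ dualSet v, waveCoeff v g u = 0) (x : Euc n) : g x = 0 := by
  refine SeparatingDual.eq_zero_of_forall_dual_eq_zero (R := ℂ) fun ℓ => ?_
  have hg' : ∀ i x, ℓ (g (x + v i)) = ℓ (g x) := fun i x => by rw [hg]
  have hc' : Continuous fun x => ℓ (g x) := ℓ.continuous.comp hc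
  let F : C(UnitAddTorus (Fin n), ℂ) := ⟨_, continuous_torusLift hg' hc'⟩
  have hF : ∀ k, mFourierCoeff F k = 0 := fun k => by
    obtain ⟨u, hu, rfl⟩ := exists_mem_dualSet v k
    have := waveCoeff_comp (v := v) ℓ hg hc u
    rw [h u hu, map_zero] at this
    exact this
  have hs := hasSum_mFourier_series_apply_of_summable (f := F)
    (by rw [funext hF]; exact summable_zero)
  obtain ⟨y, rfl⟩ := exists_eq_sum_smul v x
  have h1 := hs (torusProj y)
  simp only [hF, zero_smul] at h1
  rw [← torusLift_torusProj (g := fun x => ℓ (g x)) hg' y]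
  exact h1.unique hasSum_zero

theorem eq_sum_planeWave_smul [CompleteSpace M] {g : Euc n → M}
    (hg : ∀ i x, g (x + v i) = g x) (hc : Continuous g) (U : Finset (Euc n))
    (hU : (U : Set (Euc n)) ⊆ dualSet v) (h : ∀ u ∈ dualSet v, u ∉ U → waveCoeff v g u = 0)
    (x : Euc n) : g x = ∑ u ∈ U, planeWave u x • waveCoeff v g u := by
  classical
  -- The index `none` carries `g` and the others the subtracted waves, so the difference is a single
  -- finite sum.
  let G : Option U → Euc n → M := fun o => o.elim g
    fun u' x => -(planeWave (u' : Euc n) x • waveCoeff v g (u' : Euc n))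
  have hGper : ∀ o i x, G o (x + v i) = G o x := by
    rintro (_ | u') i x
    · exact hg i x
    · exact congrArg (fun a => -(a • waveCoeff v g (u' : Euc n)))
        (planeWave_add_basis (hU u'.2) i x)
  have hGc : ∀ o, Continuous (G o) := by
    rintro (_ | u')
    · exact hc
    · exact (continuous_planeWave_smul (u' : Euc n) _).neg
  have key := eq_zero_of_waveCoeff_eq_zero (v := v) (g := fun x => ∑ o, G o x)
    (fun i x => Finset.sum_congr rfl fun o _ => hGper o i x)
    (continuous_finsetSum _ fun o _ => hGc o) (fun u hu => ?_) x
  · rw [Fintype.sum_option] at key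
    change g x + ∑ u' : U, -(planeWave (u' : Euc n) x • waveCoeff v g (u' : Euc n)) = 0 at key
    rw [Finset.sum_neg_distrib, add_neg_eq_zero] at key
    rw [key, Finset.sum_coe_sort U fun u' => planeWave u' x • waveCoeff v g u']
  · rw [waveCoeff_sum _ hGper hGc, Fintype.sum_option]
    have h1 : ∀ u' : U, waveCoeff v (G (some u')) u =
        -(if u = (u' : Euc n) then waveCoeff v g (u' : Euc n) else 0) := fun u' => by
      have := waveCoeff_comp (v := v) (-ContinuousLinearMap.id ℂ M)
        (g := fun x => planeWave (u' : Euc n) x • waveCoeff v g (u' : Euc n))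
        (fun i x => by rw [planeWave_add_basis (hU u'.2)]) (continuous_planeWave_smul _ _) u
      rw [waveCoeff_planeWave_smul hu (hU u'.2)] at this
      exact this
    simp only [h1, Finset.sum_neg_distrib]
    rw [Finset.sum_coe_sort U fun u' => if u = u' then waveCoeff v g u' else 0,
      Finset.sum_ite_eq]
    split_ifs with hmem
    · exact add_neg_cancel _
    · rw [neg_zero, add_zero]
      exact h u hu hmem

/-- The translation formula for coefficients is differentiated at zero under the integral sign; the
periodic derivative is bounded, which justifies this. -/
theorem waveCoeff_fderiv [CompleteSpace M] {g : Euc n → M}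
    (hg : ∀ i x, g (x + v i) = g x) (hd : ContDiff ℝ ∞ g) {u : Euc n} (hu : u ∈ dualSet v)
    (h : Euc n) :
    waveCoeff v (fun x => fderiv ℝ g x h) u =
      (2 * Real.pi * Complex.I * (inner ℝ u h : ℝ)) • waveCoeff v g u := by
  set k : Fin n → ℤ := fun i => round (inner ℝ u (v i)) with hk
  have hper : ∀ i x, fderiv ℝ g (x + v i) h = fderiv ℝ g x h := fun i x => by
    have : (fun x => g (x + v i)) = g := funext fun x => hg i x
    rw [← fderiv_comp_add_right, this]
  have hcont : Continuous fun x => fderiv ℝ g x h :=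
    (hd.continuous_fderiv (by simp)).clm_apply continuous_const
  obtain ⟨C, hC⟩ : ∃ C, ∀ x, ‖fderiv ℝ g x h‖ ≤ C := by
    obtain ⟨C, hC⟩ := (isCompact_range (continuous_torusLift hper hcont)).isBounded.exists_norm_le
    refine ⟨C, fun x => ?_⟩
    obtain ⟨y, rfl⟩ := exists_eq_sum_smul v x
    rw [← torusLift_torusProj (g := fun x => fderiv ℝ g x h) hper]
    exact hC _ ⟨_, rfl⟩
  let F : ℝ → UnitAddTorus (Fin n) → M := fun t θ =>
    mFourier (-k) θ • torusLift v (fun x => g (x + t • h)) θ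
  let F' : ℝ → UnitAddTorus (Fin n) → M := fun t θ =>
    mFourier (-k) θ • torusLift v (fun x => fderiv ℝ g (x + t • h) h) θ
  have hFint : ∀ t, Integrable (F t) := fun t =>
    integrable_mFourier_smul (g := fun x => g (x + t • h))
      (fun i x => by rw [add_right_comm, hg])
      (hd.continuous.comp (continuous_add_const (t • h))) _
  have hF'int : ∀ t, Integrable (F' t) := fun t =>
    integrable_mFourier_smul (g := fun x => fderiv ℝ g (x + t • h) h)
      (fun i x => by rw [add_right_comm, hper])
      (hcont.comp (continuous_add_const (t • h))) _
  have hderiv := (hasDerivAt_integral_of_dominated_loc_of_deriv_le (F := F) (F' := F')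
    (x₀ := (0 : ℝ)) (s := Set.univ) (bound := fun _ => C) Filter.univ_mem
    (Filter.Eventually.of_forall fun t => (hFint t).aestronglyMeasurable) (hFint 0)
    (hF'int 0).aestronglyMeasurable
    (Filter.Eventually.of_forall fun θ t _ => by
      rw [norm_smul]
      have h1 : ‖mFourier (-k) θ‖ ≤ 1 :=
        ((mFourier (-k)).norm_coe_le_norm θ).trans mFourier_norm.le
      have h2 := hC ((∑ i, circleSection (θ i) • v i) + t • h)
      calc _ ≤ 1 * C := mul_le_mul h1 h2 (norm_nonneg _) zero_le_one
        _ = C := one_mul C)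
    (integrable_const C)
    (Filter.Eventually.of_forall fun θ t _ => by
      have h1 : HasDerivAt (fun t : ℝ => (∑ i, circleSection (θ i) • v i) + t • h) h t := by
        simpa using ((hasDerivAt_id t).smul_const h).const_add (∑ i, circleSection (θ i) • v i)
      have h2 := ((hd.differentiable (by simp))
        ((∑ i, circleSection (θ i) • v i) + t • h)).hasFDerivAt.comp_hasDerivAt t h1
      exact h2.const_smul (mFourier (-k) θ))).2
  have h1 : (fun t => ∫ θ, F t θ) = fun t => planeWave u (t • h) • waveCoeff v g u :=
    funext fun t => waveCoeff_translate hg hu (t • h)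
  rw [h1] at hderiv
  have h2 := (hasDerivAt_planeWave u h).smul_const (waveCoeff v g u)
  have h3 := hderiv.unique h2
  have h4 : waveCoeff v (fun x => fderiv ℝ g x h) u = ∫ θ, F' 0 θ := by
    simp only [F', zero_smul, add_zero]
    rfl
  rw [h4, h3]

end Fourier

/-! ### The plane waves with frequencies in the shifted dual lattice -/

section Waves

variable {n : ℕ} {Γ : Subgroup (Isom n)} {ε : Γ →* Spin n} {μ : ℝ}

theorem transl_mul_self {γ : Γ} (hγ : γ ∈ latt Γ) : transl (γ * γ) = (2 : ℝ) • transl γ := by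
  rw [← isom_zero_of_mem_latt (mul_mem hγ hγ), isom_mul_zero, isom_zero_of_mem_latt hγ,
    (rot Γ).mem_ker.1 hγ, two_smul]
  rfl

theorem IsSpinStructure.map_mul_self (hε : IsSpinStructure ε) {γ : Γ} (hγ : γ ∈ latt Γ) :
    ε (γ * γ) = 1 := by
  rw [map_mul]
  refine Subtype.ext ?_
  change (ε γ : Cl n) * (ε γ : Cl n) = 1
  rcases hε.latt_eq hγ with h | h <;> rw [h]
  · exact one_mul 1
  · rw [neg_mul_neg, one_mul]

/-- The kernel of `ε` on the lattice contains a basis of `ℝⁿ`. -/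
theorem IsBieberbach.exists_basis (hΓ : IsBieberbach Γ) (hε : IsSpinStructure ε) :
    ∃ v : Module.Basis (Fin n) ℝ (Euc n), ∀ i, ∃ γ ∈ latt Γ, ε γ = 1 ∧ transl γ = v i := by
  have hspan : Submodule.span ℝ ((fun γ : Γ => transl γ) '' {γ | γ ∈ latt Γ ∧ ε γ = 1}) = ⊤ := by
    rw [eq_top_iff, ← hΓ.span_latt, Submodule.span_le]
    rintro _ ⟨γ, hγ, rfl⟩
    -- Since `ε` is `±1` on the lattice, doubled lattice vectors lie in its kernel, and they have
    -- the same span.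
    have h1 : transl (γ * γ) ∈
        Submodule.span ℝ ((fun γ : Γ => transl γ) '' {γ | γ ∈ latt Γ ∧ ε γ = 1}) :=
      Submodule.subset_span ⟨γ * γ, ⟨mul_mem hγ hγ, hε.map_mul_self hγ⟩, rfl⟩
    have h2 := Submodule.smul_mem _ (1 / 2 : ℝ) h1
    rw [transl_mul_self hγ, smul_smul] at h2
    simpa using h2
  obtain ⟨b, hb, hbs, hli⟩ := exists_linearIndependent ℝ
    ((fun γ : Γ => transl γ) '' {γ | γ ∈ latt Γ ∧ ε γ = 1})
  let B : Module.Basis b ℝ (Euc n) := Module.Basis.mk hli (by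
    rw [Subtype.range_coe, hbs, hspan])
  have : Fintype b := FiniteDimensional.fintypeBasisIndex B
  have hcard : Fintype.card b = n := by
    rw [← Module.finrank_eq_card_basis B, finrank_euclideanSpace_fin]
  let e : b ≃ Fin n := Fintype.equivFinOfCardEq hcard
  refine ⟨B.reindex e, fun i => ?_⟩
  obtain ⟨γ, hγ, h⟩ := hb (e.symm i).2
  refine ⟨γ, hγ.1, hγ.2, ?_⟩
  rw [Module.Basis.reindex_apply, Module.Basis.mk_apply]
  exact h

theorem planeWave_transl_of_mem_shiftedDual {u : Euc n} (hu : u ∈ shiftedDual ε) {γ : Γ}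
    (hγ : γ ∈ latt Γ) : planeWave u (transl γ) = delta ε ⟨γ, hγ⟩ := by
  rw [← hu ⟨γ, hγ⟩, planeWave, real_inner_comm]

theorem shiftedDual_subset_dualSet {v : Module.Basis (Fin n) ℝ (Euc n)}
    (hv : ∀ i, ∃ γ ∈ latt Γ, ε γ = 1 ∧ transl γ = v i) : shiftedDual ε ⊆ dualSet v := by
  intro u hu i
  obtain ⟨γ, hγ, h1, h2⟩ := hv i
  have h3 := planeWave_transl_of_mem_shiftedDual hu hγ
  rw [h2, delta, if_pos h1, planeWave, Complex.exp_eq_one_iff] at h3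
  obtain ⟨k, hk⟩ := h3
  refine ⟨k, ?_⟩
  rw [mul_comm (k : ℂ)] at hk
  exact_mod_cast mul_left_cancel₀ Complex.two_pi_I_ne_zero hk

/-- The integers `u · v i` determine `u`, and Cauchy–Schwarz bounds them. -/
theorem finite_dualSet_norm_eq (v : Module.Basis (Fin n) ℝ (Euc n)) (μ : ℝ) :
    {u | u ∈ dualSet v ∧ ‖u‖ = μ}.Finite := by
  let K : Fin n → ℤ := fun i => ⌈|μ| * ‖v i‖⌉
  refine Set.Finite.of_finite_image (f := fun u i => round (inner ℝ u (v i)))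
    ((Set.finite_Icc (-K) K).subset ?_) ?_
  · rintro _ ⟨u, ⟨hu, hn⟩, rfl⟩
    have h : ∀ i, |((round (inner ℝ u (v i)) : ℤ) : ℝ)| ≤ (K i : ℝ) := fun i => by
      rw [← inner_eq_round hu]
      refine (abs_real_inner_le_norm _ _).trans (le_trans ?_ (Int.le_ceil _))
      rw [hn]
      gcongr
      exact le_abs_self μ
    refine ⟨fun i => ?_, fun i => ?_⟩
    · exact_mod_cast (abs_le.1 (h i)).1
    · exact_mod_cast (abs_le.1 (h i)).2
  · rintro u ⟨hu, -⟩ u' ⟨hu', -⟩ h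
    refine InnerProductSpace.ext_inner_right_basis (𝕜 := ℝ) v fun i => ?_
    rw [inner_eq_round hu, inner_eq_round hu']
    exact congrArg (fun k : ℤ => (k : ℝ)) (congrFun h i)

theorem IsBieberbach.finite_shiftedDualNorm (hΓ : IsBieberbach Γ) (hε : IsSpinStructure ε)
    (μ : ℝ) : (shiftedDualNorm ε μ).Finite := by
  obtain ⟨v, hv⟩ := hΓ.exists_basis hε
  exact (finite_dualSet_norm_eq v μ).subset fun u hu =>
    ⟨shiftedDual_subset_dualSet hv hu.1, hu.2⟩

theorem transl_conj {γ' : Γ} (γ : Γ) (hγ' : γ' ∈ latt Γ) :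
    transl (γ⁻¹ * γ' * γ) = (rot Γ γ).symm (transl γ') := by
  have hm : γ⁻¹ * γ' * γ ∈ latt Γ := by
    simpa using (MonoidHom.normal_ker (rot Γ)).conj_mem γ' hγ' γ⁻¹
  rw [← isom_zero_of_mem_latt hm, isom_mul_zero, isom_apply, isom_mul_zero,
    isom_zero_of_mem_latt hγ', isom_inv_zero, rot_mul_apply, (rot Γ).mem_ker.1 hγ', rot_symm_apply]
  simp

/-- Conjugation by `γ` permutes the lattice translations through the linear part and does not change
whether `ε` is `1` on them. -/
theorem rot_mem_shiftedDual (γ : Γ) {u : Euc n} (hu : u ∈ shiftedDual ε) :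
    rot Γ γ u ∈ shiftedDual ε := by
  intro γ'
  have hm : γ⁻¹ * γ'.1 * γ ∈ latt Γ := by
    simpa using (MonoidHom.normal_ker (rot Γ)).conj_mem γ' γ'.2 γ⁻¹
  have h1 := hu ⟨_, hm⟩
  have h2 : delta ε ⟨_, hm⟩ = delta ε γ' := by
    have : ε (γ⁻¹ * γ'.1 * γ) = 1 ↔ ε γ' = 1 := by
      rw [map_mul, map_mul, map_inv, mul_eq_one_iff_eq_inv, inv_mul_eq_iff_eq_mul, mul_inv_cancel]
    classical
    exact if_congr this rfl rfl
  rw [h2] at h1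
  rw [← h1, transl_conj γ γ'.2, LinearIsometryEquiv.inner_map_eq_flip,
    LinearIsometryEquiv.symm_symm]

/-- The action of the holonomy on `Λ*_{ε,μ}`. -/
def rotDual (ε : Γ →* Spin n) (μ : ℝ) (γ : Γ) : shiftedDualNorm ε μ ≃ shiftedDualNorm ε μ where
  toFun u := ⟨rot Γ γ u, rot_mem_shiftedDual γ u.2.1, by rw [LinearIsometryEquiv.norm_map, u.2.2]⟩
  invFun u := ⟨rot Γ γ⁻¹ u, rot_mem_shiftedDual γ⁻¹ u.2.1, by
    rw [LinearIsometryEquiv.norm_map, u.2.2]⟩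
  left_inv u := Subtype.ext (rot_inv_apply_self γ _)
  right_inv u := Subtype.ext (rot_apply_inv_self γ _)

variable {M : Type*} [NormedAddCommGroup M] [NormedSpace ℂ M]

/-- The superposition of the plane waves with frequencies in `U` and given amplitudes. -/
def waveSum (U : Set (Euc n)) [Fintype U] : (U → M) →ₗ[ℂ] Euc n → M where
  toFun w x := ∑ u : U, planeWave (u : Euc n) x • w u
  map_add' w w' := by
    ext x
    simp [smul_add, Finset.sum_add_distrib]
  map_smul' c w := by
    ext x
    simp only [Pi.smul_apply, RingHom.id_apply, Finset.smul_sum, smul_comm c]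

theorem waveSum_apply (U : Set (Euc n)) [Fintype U] (w : U → M) (x : Euc n) :
    waveSum U w x = ∑ u : U, planeWave (u : Euc n) x • w u := rfl

theorem waveSum_injective {v : Module.Basis (Fin n) ℝ (Euc n)} [CompleteSpace M]
    {U : Set (Euc n)} [Fintype U] (hU : U ⊆ dualSet v) :
    Function.Injective (waveSum (M := M) U) := by
  classical
  rw [← LinearMap.ker_eq_bot, LinearMap.ker_eq_bot']
  intro w hw
  ext u
  have h1 := waveCoeff_sum (v := v) Finset.univ
    (g := fun (u' : U) x => planeWave (u' : Euc n) x • w u')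
    (fun u' i x => by rw [planeWave_add_basis (hU u'.2)])
    (fun u' => continuous_planeWave_smul _ _) u
  have h2 : (fun x => ∑ u' : U, planeWave (u' : Euc n) x • w u') = fun _ => 0 := hw
  have h3 : ∀ u' : U, waveCoeff v (fun x => planeWave (u' : Euc n) x • w u') (u : Euc n) =
      if u = u' then w u' else 0 := fun u' => by
    rw [waveCoeff_planeWave_smul (hU u.2) (hU u'.2)]
    exact if_congr Subtype.ext_iff.symm rfl rfl
  rw [h2] at h1
  simp only [h3, Finset.sum_ite_eq, Finset.mem_univ, if_true] at h1
  rw [← h1]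
  simp [waveCoeff, UnitAddTorus.mFourierCoeff, torusLift]

variable (T : Representation ℂ Γ M)

/-- The action of `γ` on the amplitudes of the plane waves. -/
def waveAct (ε : Γ →* Spin n) (μ : ℝ) (γ : Γ) : Module.End ℂ (shiftedDualNorm ε μ → M) where
  toFun w u := phase γ ((rotDual ε μ γ).symm u : Euc n) • T γ (w ((rotDual ε μ γ).symm u))
  map_add' w w' := by
    ext u
    simp
  map_smul' c w := by
    ext u
    simp [smul_comm c]

theorem waveAct_apply (γ : Γ) (w : shiftedDualNorm ε μ → M) (u : shiftedDualNorm ε μ) :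
    waveAct T ε μ γ w u =
      phase γ ((rotDual ε μ γ).symm u : Euc n) • T γ (w ((rotDual ε μ γ).symm u)) := rfl

variable [Fintype (shiftedDualNorm ε μ)]

theorem planeWave_isom_mul_phase (γ : Γ) (u x : Euc n) :
    planeWave (rot Γ γ u) (γ.1 x) * phase γ u = planeWave u x := by
  have h : inner ℝ (rot Γ γ u) (γ.1 x) = inner ℝ u x + inner ℝ u (transl γ) := by
    rw [isom_apply, inner_add_right, LinearIsometryEquiv.inner_map_map, transl,
      LinearIsometryEquiv.inner_map_eq_flip]
  rw [planeWave, phase, planeWave, h, ← Complex.exp_add]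
  congr 1
  push_cast
  ring

/-- The phase in `waveAct` is exactly what `γ` adds to the exponent of the wave at `Bu`. Through the
injectivity of `waveSum`, all properties of the action follow from this identity. -/
theorem waveSum_waveAct (γ : Γ) (w : shiftedDualNorm ε μ → M) (x : Euc n) :
    waveSum _ (waveAct T ε μ γ w) (γ.1 x) = T γ (waveSum _ w x) := by
  rw [waveSum_apply, waveSum_apply, map_sum]
  refine (Fintype.sum_equiv (rotDual ε μ γ) _ _ fun u => ?_).symm
  rw [waveAct_apply, Equiv.symm_apply_apply, smul_smul, map_smul]
  congr 1
  exact (planeWave_isom_mul_phase γ _ x).symm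

theorem waveAct_mul (hinj : Function.Injective (waveSum (M := M) (shiftedDualNorm ε μ)))
    (γ γ' : Γ) : waveAct T ε μ (γ * γ') = waveAct T ε μ γ * waveAct T ε μ γ' := by
  refine LinearMap.ext fun w => hinj (funext fun y => ?_)
  obtain ⟨x, rfl⟩ := (γ * γ').1.surjective y
  rw [waveSum_waveAct]
  change _ = waveSum _ (waveAct T ε μ γ (waveAct T ε μ γ' w)) (γ.1 (γ'.1 x))
  rw [waveSum_waveAct, waveSum_waveAct, map_mul, Module.End.mul_apply]

/-- The sign by which `T` acts on a lattice translation cancels against the value of every wave with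
frequency in `Λ*_ε`. -/
theorem waveAct_of_mem_latt
    (hinj : Function.Injective (waveSum (M := M) (shiftedDualNorm ε μ))) {γ : Γ}
    (hγ : γ ∈ latt Γ) (hT : T γ = delta ε ⟨γ, hγ⟩ • 1) : waveAct T ε μ γ = 1 := by
  refine LinearMap.ext fun w => hinj (funext fun y => ?_)
  obtain ⟨x, rfl⟩ := γ.1.surjective y
  rw [waveSum_waveAct, hT, isom_apply_of_mem_latt hγ, Module.End.one_apply, waveSum_apply,
    waveSum_apply, LinearMap.smul_apply, Module.End.one_apply, Finset.smul_sum]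
  refine Finset.sum_congr rfl fun u _ => ?_
  rw [planeWave_add, planeWave_transl_of_mem_shiftedDual u.2.1 hγ, smul_smul, mul_comm]

theorem waveSum_equivariant_iff
    (hinj : Function.Injective (waveSum (M := M) (shiftedDualNorm ε μ))) (γ : Γ)
    (w : shiftedDualNorm ε μ → M) :
    (∀ x, waveSum _ w (γ.1 x) = T γ (waveSum _ w x)) ↔ waveAct T ε μ γ w = w := by
  constructor
  · intro h
    refine hinj (funext fun y => ?_)
    obtain ⟨x, rfl⟩ := γ.1.surjective y
    rw [waveSum_waveAct, h]
  · intro h x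
    conv_lhs => rw [← h]
    exact waveSum_waveAct T γ w x

/-- The action of the holonomy group on the amplitudes of the plane waves. -/
def waveRep (hinj : Function.Injective (waveSum (M := M) (shiftedDualNorm ε μ)))
    (hT : ∀ γ (hγ : γ ∈ latt Γ), T γ = delta ε ⟨γ, hγ⟩ • 1) :
    Representation ℂ (Γ ⧸ latt Γ) (shiftedDualNorm ε μ → M) :=
  QuotientGroup.lift (latt Γ)
    { toFun := waveAct T ε μ
      map_one' := waveAct_of_mem_latt T hinj (one_mem _) (hT 1 (one_mem _))
      map_mul' := waveAct_mul T hinj }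
    fun γ hγ => waveAct_of_mem_latt T hinj hγ (hT γ hγ)

theorem waveRep_mk (hinj : Function.Injective (waveSum (M := M) (shiftedDualNorm ε μ)))
    (hT : ∀ γ (hγ : γ ∈ latt Γ), T γ = delta ε ⟨γ, hγ⟩ • 1) (γ : Γ) :
    waveRep T hinj hT (γ : Γ ⧸ latt Γ) = waveAct T ε μ γ := rfl

end Waves

/-! ### Traces and invariants -/

section Traces

/-- The average of the group projects onto the invariants and commutes with `P`, so its product with
`P` projects onto the intersection; the trace of a projection is its rank. -/
theorem finrank_invariants_inf_range {G W : Type*} [Group G] [Fintype G] [AddCommGroup W]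
    [Module ℂ W] [FiniteDimensional ℂ W] (R : Representation ℂ G W) (P : Module.End ℂ W)
    (hP : P * P = P) (hc : ∀ g, R g * P = P * R g) :
    (Module.finrank ℂ ↥(R.invariants ⊓ LinearMap.range P) : ℂ) =
      1 / (Nat.card G : ℂ) * ∑ g, LinearMap.trace ℂ W (R g * P) := by
  have hcard : (Fintype.card G : ℂ) ≠ 0 := Nat.cast_ne_zero.2 Fintype.card_ne_zero
  let A : Module.End ℂ W := (1 / (Fintype.card G : ℂ)) • ∑ g, R g
  have hRA : ∀ g, R g * A = A := fun g => by
    simp only [A, mul_smul_comm, Finset.mul_sum, ← map_mul]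
    rw [Fintype.sum_equiv (Equiv.mulLeft g) (fun h => R (g * h)) R fun h => rfl]
  have hAP : A * P = P * A := by
    simp only [A, mul_smul_comm, smul_mul_assoc, Finset.mul_sum, Finset.sum_mul, hc]
  have hproj : LinearMap.IsProj (R.invariants ⊓ LinearMap.range P) (A * P) := by
    refine ⟨fun w => ⟨fun g => ?_, ?_⟩, fun w hw => ?_⟩
    · rw [← Module.End.mul_apply, ← mul_assoc, hRA]
    · rw [hAP]
      exact ⟨A w, rfl⟩
    · obtain ⟨h1, w', rfl⟩ := hw
      have h2 : P (P w') = P w' := by rw [← Module.End.mul_apply, hP]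
      rw [Module.End.mul_apply, h2]
      simp only [A, LinearMap.smul_apply, LinearMap.sum_apply, h1 _, Finset.sum_const,
        Finset.card_univ]
      rw [← Nat.cast_smul_eq_nsmul ℂ, smul_smul, one_div, inv_mul_cancel₀ hcard, one_smul]
  rw [← hproj.trace, Nat.card_eq_fintype_card]
  simp only [A, smul_mul_assoc, Finset.sum_mul, map_smul, map_sum, smul_eq_mul]

theorem trace_pi {ι M : Type*} [Fintype ι] [DecidableEq ι] [AddCommGroup M] [Module ℂ M]
    [FiniteDimensional ℂ M] (A : Module.End ℂ (ι → M)) :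
    LinearMap.trace ℂ (ι → M) A = ∑ i, LinearMap.trace ℂ M
      (LinearMap.proj i ∘ₗ A ∘ₗ LinearMap.single ℂ (fun _ => M) i) := by
  have h : A = ∑ i, (A ∘ₗ LinearMap.single ℂ (fun _ => M) i) ∘ₗ LinearMap.proj i := by
    refine LinearMap.ext fun w => ?_
    simp only [LinearMap.sum_apply, LinearMap.comp_apply, ← map_sum]
    congr 1
    ext j
    simp [Finset.sum_apply, Pi.single_apply]
  conv_lhs => rw [h, map_sum]
  exact Finset.sum_congr rfl fun i _ => LinearMap.trace_comp_comm' _ _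

end Traces

/-! ### The Dirac operator on plane waves -/

section WaveDerivatives

variable {n : ℕ} {M : Type*} [NormedAddCommGroup M] [NormedSpace ℂ M]

theorem contDiff_waveSum (U : Set (Euc n)) [Fintype U] (w : U → M) :
    ContDiff ℝ ∞ (waveSum U w) := by
  have : waveSum U w = fun x => ∑ u : U, planeWave (u : Euc n) x • w u := rfl
  rw [this]
  exact ContDiff.sum fun u _ => (contDiff_planeWave (u : Euc n)).smul contDiff_const

theorem fderiv_planeWave (u x h : Euc n) :
    fderiv ℝ (planeWave u) x h = (2 * Real.pi * Complex.I * (inner ℝ u h : ℝ)) * planeWave u x := by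
  have h1 : HasDerivAt (fun t : ℝ => planeWave u (x + t • h)) (fderiv ℝ (planeWave u) x h) 0 := by
    have hl : HasDerivAt (fun t : ℝ => x + t • h) h 0 := by
      simpa using ((hasDerivAt_id (0 : ℝ)).smul_const h).const_add x
    have hd : HasFDerivAt (planeWave u) (fderiv ℝ (planeWave u) x) (x + (0 : ℝ) • h) := by
      rw [zero_smul, add_zero]
      exact ((contDiff_planeWave u).differentiable (by simp) x).hasFDerivAt
    exact hd.comp_hasDerivAt 0 hl
  have h2 := (hasDerivAt_planeWave u h).const_mul (planeWave u x)
  simp only [← planeWave_add] at h2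
  rw [h1.unique h2, mul_comm]

theorem fderiv_waveSum (U : Set (Euc n)) [Fintype U] (w : U → M) (x h : Euc n) :
    fderiv ℝ (waveSum U w) x h = waveSum U (fun u =>
      (2 * Real.pi * Complex.I * (inner ℝ (u : Euc n) h : ℝ) : ℂ) • w u) x := by
  have hd : ∀ u : U, HasFDerivAt (fun x => planeWave (u : Euc n) x • w u)
      ((fderiv ℝ (planeWave (u : Euc n)) x).smulRight (w u)) x := fun u =>
    (((contDiff_planeWave (u : Euc n)).differentiable (by simp) x).hasFDerivAt).smul_const (w u)
  have h1 : HasFDerivAt (waveSum U w)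
      (∑ u : U, (fderiv ℝ (planeWave (u : Euc n)) x).smulRight (w u)) x := by
    have := HasFDerivAt.fun_sum (u := Finset.univ) fun u _ => hd u
    exact this
  rw [h1.fderiv, waveSum_apply, sum_apply]
  refine Finset.sum_congr rfl fun u _ => ?_
  rw [ContinuousLinearMap.smulRight_apply, fderiv_planeWave, smul_smul, mul_comm]

/-- The derivative of a function with values in a complex vector space. -/
def dirDeriv (f : Euc n → M) (x h : Euc n) : M := fderiv ℝ f x h

theorem map_waveSum (U : Set (Euc n)) [Fintype U] (w : U → M)
    (A : Module.End ℂ M) (x : Euc n) :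
    A (waveSum U w x) = waveSum U (fun u => A (w u)) x := by
  simp only [waveSum_apply, map_sum, map_smul]

end WaveDerivatives

/-! ### Clifford multiplication on amplitudes -/

section DiracWaves

variable {n : ℕ} {V : Type*} [NormedAddCommGroup V] [InnerProductSpace ℂ V]

/-- Clifford multiplication by a vector on twisted spinors. -/
def twistedVec (V : Type*) [NormedAddCommGroup V] [InnerProductSpace ℂ V] (u : Euc n) :
    Module.End ℂ (Spinor n ⊗[ℂ] V) :=
  LinearMap.rTensor V (cliffordRep n (vec u))

theorem cliffordRep_vec_eq_sum (u : Euc n) :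
    cliffordRep n (vec u) = ∑ k, (u k : ℂ) • cliffordRep n (vec (stdVec k)) := by
  simp only [cliffordRep_stdVec]
  rw [cliffordRep_vec]
  change ∑ k, u k • gammaOp n k = _
  exact Finset.sum_congr rfl fun k _ => (Complex.coe_smul (u k) (gammaOp n k)).symm

theorem sum_smul_twistedVec (u : Euc n) :
    ∑ k, ((inner ℝ u (stdVec k) : ℝ) : ℂ) • twistedVec V (stdVec k) = twistedVec V u := by
  unfold twistedVec
  rw [cliffordRep_vec_eq_sum u]
  simp only [← LinearMap.coe_rTensorHom, map_sum, map_smul]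
  refine Finset.sum_congr rfl fun k _ => ?_
  rw [EuclideanSpace.inner_single_right]
  simp

theorem cliffordRep_vec_mul_self (u : Euc n) :
    cliffordRep n (vec u) * cliffordRep n (vec u) = (-(‖u‖ : ℂ) ^ 2) • 1 := by
  rw [← map_mul, vec_mul_self, AlgHom.commutes, Algebra.algebraMap_eq_smul_one]
  rw [← Complex.coe_smul]
  push_cast
  rfl

theorem twistedVec_apply_self (u : Euc n) (m : Spinor n ⊗[ℂ] V) :
    twistedVec V u (twistedVec V u m) = (-(‖u‖ : ℂ) ^ 2) • m := by
  unfold twistedVec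
  rw [← LinearMap.comp_apply, ← LinearMap.rTensor_comp]
  have h : cliffordRep n (vec u) ∘ₗ cliffordRep n (vec u) = (-(‖u‖ : ℂ) ^ 2) • LinearMap.id :=
    cliffordRep_vec_mul_self u
  rw [h, LinearMap.rTensor_smul, LinearMap.rTensor_id]
  rfl

theorem dirac_eq_sum (f : Euc n → Spinor n ⊗[ℂ] V) (x : Euc n) :
    dirac f x = ∑ k, twistedVec V (stdVec k) (dirDeriv f x (stdVec k)) := rfl

/-- Each partial derivative brings down `2πi u_k`, and the sum of the `u_k e_k` is Clifford
multiplication by `u`. -/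
theorem dirac_waveSum (U : Set (Euc n)) [Fintype U] (w : U → Spinor n ⊗[ℂ] V) (x : Euc n) :
    dirac (waveSum U w) x =
      waveSum U (fun u => (2 * Real.pi * Complex.I : ℂ) • twistedVec V (u : Euc n) (w u)) x := by
  have h : ∀ k, twistedVec V (stdVec k) (dirDeriv (waveSum U w) x (stdVec k)) = ∑ u : U, planeWave (u : Euc n) x •
        (2 * Real.pi * Complex.I : ℂ) • (((inner ℝ (u : Euc n) (stdVec k) : ℝ) : ℂ) •
          twistedVec V (stdVec k)) (w u) := fun k => by
    rw [dirDeriv, fderiv_waveSum, map_waveSum, waveSum_apply]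
    refine Finset.sum_congr rfl fun u _ => ?_
    rw [map_smul, mul_smul]
    rfl
  rw [dirac_eq_sum, Finset.sum_congr rfl fun k _ => h k, Finset.sum_comm, waveSum_apply]
  refine Finset.sum_congr rfl fun u _ => ?_
  rw [← Finset.smul_sum, ← Finset.smul_sum, ← LinearMap.sum_apply, sum_smul_twistedVec]

/-- The projection onto the spinors `φ` with `i u φ = s ‖u‖ φ`. -/
def waveProj (s : ℤˣ) (u : Euc n) : Module.End ℂ (Spinor n) := by
  classical exact if u = 0 then 1 else spinProj s u

theorem units_mul_self (s : ℤˣ) : ((s : ℤ) : ℂ) * ((s : ℤ) : ℂ) = 1 := by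
  rcases Int.units_eq_one_or s with rfl | rfl <;> simp

theorem waveProj_mul_self (s : ℤˣ) (u : Euc n) : waveProj s u * waveProj s u = waveProj s u := by
  unfold waveProj
  split_ifs with hu
  · exact one_mul 1
  have hu' : (‖u‖ : ℂ) ≠ 0 := by simpa using hu
  unfold spinProj
  have h := cliffordRep_vec_mul_self u
  generalize cliffordRep n (vec u) = L at h
  have hs := units_mul_self s
  set a : ℂ := ((s : ℤ) : ℂ) * Complex.I * (‖u‖ : ℂ)⁻¹ with ha
  have h1 : (a * a) * (-(‖u‖ : ℂ) ^ 2) = 1 := by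
    have e := inv_mul_cancel₀ hu'
    have e2 : (a * a) * (-(‖u‖ : ℂ) ^ 2) = -(((s : ℤ) : ℂ) * ((s : ℤ) : ℂ)) * Complex.I ^ 2 *
        ((‖u‖ : ℂ)⁻¹ * ‖u‖) ^ 2 := by rw [ha]; ring
    rw [e2, hs, e, Complex.I_sq]
    norm_num
  rw [smul_mul_smul_comm, add_mul, one_mul, mul_add, mul_one, smul_mul_smul_comm, h, smul_smul, h1,
    one_smul]
  module

theorem cliffordRep_mul_waveProj {g : Cl n} {u u' : Euc n} (h : g * vec u = vec u' * g)
    (hn : ‖u‖ = ‖u'‖) (s : ℤˣ) :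
    cliffordRep n g * waveProj s u = waveProj s u' * cliffordRep n g := by
  have h0 : u = 0 ↔ u' = 0 := by rw [← norm_eq_zero, hn, norm_eq_zero]
  unfold waveProj
  by_cases hu : u = 0
  · rw [if_pos hu, if_pos (h0.1 hu), mul_one, one_mul]
  · rw [if_neg hu, if_neg (mt h0.2 hu), spinProj, spinProj, mul_smul_comm, smul_mul_assoc, mul_add,
      add_mul, mul_smul_comm, smul_mul_assoc, ← map_mul, ← map_mul, h, hn, mul_one, one_mul]

/-- At `u = 0` both sides hold for every `m`, because `waveProj` is the identity there. So harmonic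
spinors need no separate treatment. -/
theorem waveProj_apply_eq_iff (s : ℤˣ) (u : Euc n) (m : Spinor n ⊗[ℂ] V) :
    LinearMap.rTensor V (waveProj s u) m = m ↔
      (2 * Real.pi * Complex.I : ℂ) • twistedVec V u m =
        (((s : ℤ) : ℂ) * (2 * Real.pi * (‖u‖ : ℝ))) • m := by
  unfold waveProj
  split_ifs with hu
  · subst hu
    have h1 : LinearMap.rTensor V (1 : Module.End ℂ (Spinor n)) m = m := by
      rw [Module.End.one_eq_id, LinearMap.rTensor_id]
      rfl
    have h2 : twistedVec V (0 : Euc n) m = 0 := by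
      simp [twistedVec]
    simp [h1, h2]
  have hu' : (‖u‖ : ℂ) ≠ 0 := by simpa using hu
  have hpi : (Real.pi : ℂ) ≠ 0 := by exact_mod_cast Real.pi_ne_zero
  have hs := units_mul_self s
  have h1 : LinearMap.rTensor V (spinProj s u) m = (1 / 2 : ℂ) •
      (m + (((s : ℤ) : ℂ) * Complex.I * (‖u‖ : ℂ)⁻¹) • twistedVec V u m) := by
    rw [spinProj, LinearMap.rTensor_smul, LinearMap.rTensor_add, LinearMap.rTensor_smul,
      Module.End.one_eq_id, LinearMap.rTensor_id]
    rfl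
  rw [h1]
  generalize twistedVec V u m = m'
  constructor
  · intro h
    have h2 : m = (((s : ℤ) : ℂ) * Complex.I * (‖u‖ : ℂ)⁻¹) • m' := by
      have h3 := congrArg (fun z => (2 : ℂ) • z) h
      simp only [smul_smul] at h3
      norm_num at h3
      rw [two_smul] at h3
      exact (add_left_cancel h3).symm
    conv_rhs => rw [h2, smul_smul]
    congr 1
    have e : ((s : ℤ) : ℂ) * (2 * Real.pi * (‖u‖ : ℝ)) * (((s : ℤ) : ℂ) * Complex.I *
      (‖u‖ : ℂ)⁻¹) = (((s : ℤ) : ℂ) * ((s : ℤ) : ℂ)) * (2 * Real.pi * Complex.I) *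
      ((‖u‖ : ℂ) * (‖u‖ : ℂ)⁻¹) := by ring
    rw [e, hs, mul_inv_cancel₀ hu']
    ring
  · intro h
    have h2 : (((s : ℤ) : ℂ) * Complex.I * (‖u‖ : ℂ)⁻¹) • m' = m := by
      have h3 := congrArg (fun z => (((s : ℤ) : ℂ) * (‖u‖ : ℂ)⁻¹ * (2 * Real.pi : ℂ)⁻¹) • z) h
      simp only [smul_smul] at h3
      have e1 : ((s : ℤ) : ℂ) * (‖u‖ : ℂ)⁻¹ * (2 * Real.pi : ℂ)⁻¹ * (2 * Real.pi * Complex.I) =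
          ((s : ℤ) : ℂ) * Complex.I * (‖u‖ : ℂ)⁻¹ := by
        field_simp
      have e2 : ((s : ℤ) : ℂ) * (‖u‖ : ℂ)⁻¹ * (2 * Real.pi : ℂ)⁻¹ *
          (((s : ℤ) : ℂ) * (2 * Real.pi * (‖u‖ : ℝ))) = 1 := by
        rw [← hs]
        field_simp
      rwa [e1, e2, one_smul] at h3
    rw [h2, ← two_smul ℂ, smul_smul]
    norm_num

end DiracWaves

/-! ### The eigenspaces of the Dirac operator -/

section Eigenspaces

variable {n : ℕ} {Γ : Subgroup (Isom n)} {ε : Γ →* Spin n} {μ : ℝ}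
variable {V : Type*} [NormedAddCommGroup V] [InnerProductSpace ℂ V]
variable {ρ : Representation ℂ Γ V}

theorem twistedRep_of_mem_latt (hε : IsSpinStructure ε) (hρ : ∀ γ ∈ latt Γ, ρ γ = 1) (γ : Γ)
    (hγ : γ ∈ latt Γ) : twistedRep ε ρ γ = delta ε ⟨γ, hγ⟩ • 1 := by
  have h : twistedRep ε ρ γ = TensorProduct.map (cliffordRep n (ε γ)) (ρ γ) := rfl
  have h0 : ε γ = 1 ↔ (ε γ : Cl n) = 1 := Subtype.ext_iff
  rw [h, hρ γ hγ, Module.End.one_eq_id]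
  rcases hε.latt_eq hγ with h1 | h1
  · rw [delta, if_pos (h0.2 h1), h1, map_one, Module.End.one_eq_id, TensorProduct.map_id, one_smul]
    rfl
  · have hmap : TensorProduct.map (-LinearMap.id : Module.End ℂ (Spinor n))
        (LinearMap.id : Module.End ℂ V) = (-1 : ℂ) • 1 := by
      rw [← neg_one_smul ℂ (LinearMap.id : Module.End ℂ (Spinor n)), TensorProduct.map_smul_left,
        TensorProduct.map_id]
      rfl
    -- The elements `1` and `-1` are separated by their traces on the spinors.
    have hne : ε γ ≠ 1 := fun he => by
      rw [h0.1 he] at h1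
      have h2 := congrArg (fun z => LinearMap.trace ℂ _ (cliffordRep n z)) h1
      simp only [map_one, map_neg, LinearMap.trace_one] at h2
      have h3 : (Module.finrank ℂ (Spinor n) : ℂ) = 0 := by linear_combination h2 / 2
      rw [Nat.cast_eq_zero] at h3
      exact Module.finrank_pos.ne' h3
    rw [delta, if_neg hne, h1, map_neg, map_one, Module.End.one_eq_id, hmap]

/-- Plane waves with different frequencies are independent, so the Dirac equation can be compared
frequency by frequency, and equivariance becomes invariance of the amplitudes. -/
theorem waveSum_mem_diracEigenspace_iff [Fintype (shiftedDualNorm ε μ)]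
    (hinj : Function.Injective (waveSum (M := Spinor n ⊗[ℂ] V) (shiftedDualNorm ε μ)))
    (s : ℤˣ) (w : shiftedDualNorm ε μ → Spinor n ⊗[ℂ] V) :
    waveSum _ w ∈ diracEigenspace ε ρ ((s : ℤ) * (2 * Real.pi * μ)) ↔
      (∀ γ, waveAct (twistedRep ε ρ) ε μ γ w = w) ∧
        ∀ u : shiftedDualNorm ε μ, LinearMap.rTensor V (waveProj s (u : Euc n)) (w u) = w u := by
  have h1 : (∀ x, dirac (waveSum (shiftedDualNorm ε μ) w) x =
      (((s : ℤ) : ℂ) * (2 * Real.pi * μ)) • waveSum (shiftedDualNorm ε μ) w x) ↔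
      ∀ u : shiftedDualNorm ε μ, LinearMap.rTensor V (waveProj s (u : Euc n)) (w u) = w u := by
    simp only [waveProj_apply_eq_iff]
    constructor
    · intro h u
      have h2 : waveSum (shiftedDualNorm ε μ)
          (fun u => (2 * Real.pi * Complex.I : ℂ) • twistedVec V (u : Euc n) (w u)) =
          waveSum (shiftedDualNorm ε μ) ((((s : ℤ) : ℂ) * (2 * Real.pi * μ)) • w) := by
        ext1 x
        rw [← dirac_waveSum, h, map_smul]
        rfl
      have h3 := congrFun (hinj h2) u
      rw [u.2.2]
      exact h3
    · intro h x
      rw [dirac_waveSum]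
      have h2 : (fun u : shiftedDualNorm ε μ =>
          (2 * Real.pi * Complex.I : ℂ) • twistedVec V (u : Euc n) (w u)) =
          (((s : ℤ) : ℂ) * (2 * Real.pi * μ)) • w := by
        ext1 u
        rw [h u, u.2.2]
        rfl
      rw [h2, map_smul]
      rfl
  change (ContDiff ℝ ∞ _ ∧ _) ∧ _ ↔ _
  rw [← h1]
  refine and_congr_left' ?_
  rw [and_iff_right (contDiff_waveSum _ _)]
  exact forall_congr' fun γ => waveSum_equivariant_iff _ hinj γ w

variable [FiniteDimensional ℂ V]

/-- The Fourier coefficients of the twisted spinors are eigenvectors of Clifford multiplication. -/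
theorem waveCoeff_of_mem_diracEigenspace {v : Module.Basis (Fin n) ℝ (Euc n)}
    {c : ℂ} {f : Euc n → Spinor n ⊗[ℂ] V} (hf : ContDiff ℝ ∞ f)
    (hper : ∀ i x, f (x + v i) = f x) (hD : ∀ x, dirac f x = c • f x) {u : Euc n}
    (hu : u ∈ dualSet v) :
    (2 * Real.pi * Complex.I : ℂ) • twistedVec V u (waveCoeff v f u) = c • waveCoeff v f u := by
  have : CompleteSpace (Spinor n ⊗[ℂ] V) := FiniteDimensional.complete ℂ _
  have hperd : ∀ h i x, dirDeriv f (x + v i) h = dirDeriv f x h := fun h i x => by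
    have h1 : (fun x => f (x + v i)) = f := funext fun x => hper i x
    unfold dirDeriv
    rw [← fderiv_comp_add_right, h1]
  have hcontd : ∀ h, Continuous fun x => dirDeriv f x h := fun h =>
    (hf.continuous_fderiv (by simp)).clm_apply continuous_const
  let A : Fin n → (Spinor n ⊗[ℂ] V →L[ℂ] Spinor n ⊗[ℂ] V) := fun k =>
    LinearMap.toContinuousLinearMap (twistedVec V (stdVec k))
  have h1 : waveCoeff v (dirac f) u =
      ∑ k, A k (waveCoeff v (fun x => dirDeriv f x (stdVec k)) u) := by
    rw [← Finset.sum_congr rfl fun k _ =>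
      waveCoeff_comp (v := v) (A k) (hperd (stdVec k)) (hcontd (stdVec k)) u]
    exact waveCoeff_sum (v := v) Finset.univ (g := fun k x => A k (dirDeriv f x (stdVec k)))
      (fun k i x => by rw [hperd]) (fun k => (A k).continuous.comp (hcontd _)) u
  have h2 : ∀ k, waveCoeff v (fun x => dirDeriv f x (stdVec k)) u =
      (2 * Real.pi * Complex.I * (inner ℝ u (stdVec k) : ℝ) : ℂ) • waveCoeff v f u := fun k =>
    waveCoeff_fderiv hper hf hu (stdVec k)
  have h3 : waveCoeff v (dirac f) u = c • waveCoeff v f u := by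
    have h4 := waveCoeff_comp (v := v) (c • ContinuousLinearMap.id ℂ _) hper hf.continuous u
    have h5 : dirac f = fun x => (c • ContinuousLinearMap.id ℂ (Spinor n ⊗[ℂ] V)) (f x) :=
      funext fun x => hD x
    rw [h5, h4]
    rfl
  rw [← h3, h1, ← sum_smul_twistedVec, LinearMap.sum_apply, Finset.smul_sum]
  refine Finset.sum_congr rfl fun k _ => ?_
  rw [h2, map_smul, mul_smul (2 * Real.pi * Complex.I : ℂ), LinearMap.smul_apply]
  rfl

/-- Suppose that the coefficient at `u` does not vanish. Comparing the effect of lattice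
translations on it with equivariance puts `u` into `Λ*_ε`, and applying the Clifford equation twice
gives `‖u‖ = μ`. Only finitely many waves remain. -/
theorem mem_range_waveSum (hΓ : IsBieberbach Γ) (hε : IsSpinStructure ε)
    (hρ : ∀ γ ∈ latt Γ, ρ γ = 1) (hμ : 0 ≤ μ) (s : ℤˣ) [Fintype (shiftedDualNorm ε μ)]
    {f : Euc n → Spinor n ⊗[ℂ] V}
    (hf : f ∈ diracEigenspace ε ρ ((s : ℤ) * (2 * Real.pi * μ))) :
    f ∈ LinearMap.range (waveSum (M := Spinor n ⊗[ℂ] V) (shiftedDualNorm ε μ)) := by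
  have : CompleteSpace (Spinor n ⊗[ℂ] V) := FiniteDimensional.complete ℂ _
  obtain ⟨v, hv⟩ := hΓ.exists_basis hε
  obtain ⟨⟨hsmooth, hequiv⟩, hD⟩ := hf
  have htransl : ∀ γ (hγ : γ ∈ latt Γ) x, f (x + transl γ) = delta ε ⟨γ, hγ⟩ • f x :=
    fun γ hγ x => by
    rw [← isom_apply_of_mem_latt hγ, hequiv, twistedRep_of_mem_latt hε hρ γ hγ]
    rfl
  have hper : ∀ i x, f (x + v i) = f x := fun i x => by
    obtain ⟨γ, hγ, h1, h2⟩ := hv i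
    rw [← h2, htransl γ hγ, delta, if_pos h1, one_smul]
  have hzero : ∀ u ∈ dualSet v, u ∉ shiftedDualNorm ε μ → waveCoeff v f u = 0 := by
    intro u hu hnot
    by_contra hne
    refine hnot ⟨fun γ => ?_, ?_⟩
    · have h1 := waveCoeff_translate hper hu (transl γ.1)
      have h2 := waveCoeff_comp (v := v) (delta ε γ • ContinuousLinearMap.id ℂ _) hper
        hsmooth.continuous u
      have h3 : (fun x => f (x + transl γ.1)) = fun x =>
          (delta ε γ • ContinuousLinearMap.id ℂ (Spinor n ⊗[ℂ] V)) (f x) :=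
        funext fun x => htransl γ.1 γ.2 x
      rw [h3, h2] at h1
      rw [real_inner_comm]
      exact (smul_left_injective ℂ hne h1).symm
    · have h1 := waveCoeff_of_mem_diracEigenspace hsmooth hper hD hu
      have h2 := congrArg (fun m => (2 * Real.pi * Complex.I : ℂ) • twistedVec V u m) h1
      simp only [map_smul] at h2
      rw [smul_comm _ (((s : ℤ) : ℂ) * (2 * Real.pi * μ)), h1, twistedVec_apply_self, smul_smul,
        smul_smul, smul_smul] at h2
      have h3 := smul_left_injective ℂ hne h2
      have hs := units_mul_self s
      have hpi : (Real.pi : ℂ) ≠ 0 := by exact_mod_cast Real.pi_ne_zero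
      have h4 : (‖u‖ : ℂ) ^ 2 = (μ : ℂ) ^ 2 := by
        have h5 : (4 * (Real.pi : ℂ) ^ 2) * (‖u‖ : ℂ) ^ 2 = (4 * (Real.pi : ℂ) ^ 2) * μ ^ 2 := by
          linear_combination h3 + 4 * (Real.pi : ℂ) ^ 2 * μ ^ 2 * hs +
            4 * (Real.pi : ℂ) ^ 2 * (‖u‖ : ℂ) ^ 2 * Complex.I_sq
        exact mul_left_cancel₀ (mul_ne_zero (by norm_num) (pow_ne_zero 2 hpi)) h5
      have h5 : ‖u‖ ^ 2 = μ ^ 2 := by exact_mod_cast h4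
      exact (pow_left_inj₀ (norm_nonneg u) hμ two_ne_zero).1 h5
  refine ⟨fun u => waveCoeff v f u, ?_⟩
  ext1 x
  have hsub : shiftedDualNorm ε μ ⊆ dualSet v := fun u hu => shiftedDual_subset_dualSet hv hu.1
  have key := eq_sum_planeWave_smul hper hsmooth.continuous (shiftedDualNorm ε μ).toFinset
    (by rwa [Set.coe_toFinset]) (fun u hu hnot => hzero u hu (by rwa [Set.mem_toFinset] at hnot)) x
  rw [key, waveSum_apply]
  exact (Finset.sum_subtype _ (fun u => Set.mem_toFinset)
    fun u => planeWave u x • waveCoeff v f u).symm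

theorem waveSum_shiftedDualNorm_injective (hΓ : IsBieberbach Γ) (hε : IsSpinStructure ε) (μ : ℝ)
    [Fintype (shiftedDualNorm ε μ)] :
    Function.Injective (waveSum (M := Spinor n ⊗[ℂ] V) (shiftedDualNorm ε μ)) := by
  have : CompleteSpace (Spinor n ⊗[ℂ] V) := FiniteDimensional.complete ℂ _
  obtain ⟨v, hv⟩ := hΓ.exists_basis hε
  exact waveSum_injective (v := v) fun u hu => shiftedDual_subset_dualSet hv hu.1

end Eigenspaces

/-! ### The multiplicities as averages of traces -/

section Multiplicities

variable {n : ℕ} {Γ : Subgroup (Isom n)} {ε : Γ →* Spin n} {μ : ℝ}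
variable {V : Type*} [NormedAddCommGroup V] [InnerProductSpace ℂ V]
variable {ρ : Representation ℂ Γ V}

/-- The projection of the amplitudes onto the eigenvectors of Clifford multiplication. -/
def amplitudeProj (V : Type*) [NormedAddCommGroup V] [InnerProductSpace ℂ V] (ε : Γ →* Spin n)
    (μ : ℝ) (s : ℤˣ) : Module.End ℂ (shiftedDualNorm ε μ → Spinor n ⊗[ℂ] V) :=
  LinearMap.pi fun u => LinearMap.rTensor V (waveProj s (u : Euc n)) ∘ₗ LinearMap.proj u

theorem amplitudeProj_apply (s : ℤˣ) (w : shiftedDualNorm ε μ → Spinor n ⊗[ℂ] V)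
    (u : shiftedDualNorm ε μ) :
    amplitudeProj V ε μ s w u = LinearMap.rTensor V (waveProj s (u : Euc n)) (w u) := rfl

theorem amplitudeProj_mul_self (s : ℤˣ) :
    amplitudeProj V ε μ s * amplitudeProj V ε μ s = amplitudeProj V ε μ s := by
  refine LinearMap.ext fun w => funext fun u => ?_
  rw [Module.End.mul_apply, amplitudeProj_apply, amplitudeProj_apply, ← LinearMap.comp_apply,
    ← LinearMap.rTensor_comp]
  have h : waveProj s (u : Euc n) ∘ₗ waveProj s (u : Euc n) = waveProj s (u : Euc n) :=
    waveProj_mul_self s (u : Euc n)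
  rw [h]

theorem mem_range_amplitudeProj_iff (s : ℤˣ) (w : shiftedDualNorm ε μ → Spinor n ⊗[ℂ] V) :
    w ∈ LinearMap.range (amplitudeProj V ε μ s) ↔
      ∀ u : shiftedDualNorm ε μ, LinearMap.rTensor V (waveProj s (u : Euc n)) (w u) = w u := by
  constructor
  · rintro ⟨w', rfl⟩ u
    have := LinearMap.congr_fun (amplitudeProj_mul_self (V := V) (ε := ε) (μ := μ) s) w'
    exact congrFun this u
  · exact fun h => ⟨w, funext h⟩

theorem twistedRep_rTensor_waveProj (hε : IsSpinStructure ε) (γ : Γ) (s : ℤˣ) (u : Euc n)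
    (m : Spinor n ⊗[ℂ] V) :
    twistedRep ε ρ γ (LinearMap.rTensor V (waveProj s u) m) =
      LinearMap.rTensor V (waveProj s (rot Γ γ u)) (twistedRep ε ρ γ m) := by
  have h : cliffordRep n (ε γ) ∘ₗ waveProj s u = waveProj s (rot Γ γ u) ∘ₗ cliffordRep n (ε γ) :=
    cliffordRep_mul_waveProj (hε.mul_vec γ u) (LinearIsometryEquiv.norm_map _ _).symm s
  have h1 : TensorProduct.map (cliffordRep n (ε γ)) (ρ γ) ∘ₗ
      TensorProduct.map (waveProj s u) LinearMap.id =
      TensorProduct.map (waveProj s (rot Γ γ u)) LinearMap.id ∘ₗ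
        TensorProduct.map (cliffordRep n (ε γ)) (ρ γ) := by
    rw [← TensorProduct.map_comp, ← TensorProduct.map_comp, h, LinearMap.comp_id,
      LinearMap.id_comp]
  exact LinearMap.congr_fun h1 m

theorem waveAct_mul_amplitudeProj (hε : IsSpinStructure ε) (γ : Γ) (s : ℤˣ) :
    waveAct (twistedRep ε ρ) ε μ γ * amplitudeProj V ε μ s =
      amplitudeProj V ε μ s * waveAct (twistedRep ε ρ) ε μ γ := by
  refine LinearMap.ext fun w => funext fun u => ?_
  obtain ⟨u, rfl⟩ := (rotDual ε μ γ).surjective u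
  rw [Module.End.mul_apply, Module.End.mul_apply, waveAct_apply, amplitudeProj_apply,
    amplitudeProj_apply, waveAct_apply, Equiv.symm_apply_apply, map_smul,
    twistedRep_rTensor_waveProj hε]
  rfl

/-- The trace of `γ` on the space of the amplitudes that belong to the eigenvalue `2πsμ`. -/
def waveTrace (ε : Γ →* Spin n) (ρ : Representation ℂ Γ V) (μ : ℝ) (s : ℤˣ) (γ : Γ) : ℂ :=
  ρ.character γ * ∑ᶠ u ∈ fixedDual ε μ γ,
    phase γ u * LinearMap.trace ℂ _ (cliffordRep n (ε γ) * waveProj s u)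

variable [FiniteDimensional ℂ V]

theorem trace_twistedRep_mul (γ : Γ) (P : Module.End ℂ (Spinor n)) :
    LinearMap.trace ℂ _ (twistedRep ε ρ γ ∘ₗ LinearMap.rTensor V P) =
      LinearMap.trace ℂ _ (cliffordRep n (ε γ) * P) * ρ.character γ := by
  have h : twistedRep ε ρ γ ∘ₗ LinearMap.rTensor V P =
      TensorProduct.map (cliffordRep n (ε γ) * P) (ρ γ) := by
    have h1 : twistedRep ε ρ γ = TensorProduct.map (cliffordRep n (ε γ)) (ρ γ) := rfl
    rw [h1, LinearMap.rTensor, ← TensorProduct.map_comp, LinearMap.comp_id]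
    rfl
  rw [h, LinearMap.trace_tensorProduct']
  rfl

/-- The amplitude at `u` is moved to `Bu`, so a diagonal block vanishes unless `B` fixes `u`; the
surviving blocks are tensor products. -/
theorem trace_waveAct_mul_amplitudeProj [Fintype (shiftedDualNorm ε μ)] (γ : Γ) (s : ℤˣ) :
    LinearMap.trace ℂ _ (waveAct (twistedRep ε ρ) ε μ γ * amplitudeProj V ε μ s) =
      waveTrace ε ρ μ s γ := by
  classical
  have hblock : ∀ u : shiftedDualNorm ε μ, LinearMap.trace ℂ (Spinor n ⊗[ℂ] V)
      (LinearMap.proj u ∘ₗ (waveAct (twistedRep ε ρ) ε μ γ * amplitudeProj V ε μ s) ∘ₗ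
        LinearMap.single ℂ (fun _ => Spinor n ⊗[ℂ] V) u) =
      if rot Γ γ (u : Euc n) = u then phase γ (u : Euc n) *
        (LinearMap.trace ℂ _ (cliffordRep n (ε γ) * waveProj s (u : Euc n)) * ρ.character γ)
      else 0 := by
    intro u
    have happ : ∀ m : Spinor n ⊗[ℂ] V,
        (LinearMap.proj u ∘ₗ (waveAct (twistedRep ε ρ) ε μ γ * amplitudeProj V ε μ s) ∘ₗ
          LinearMap.single ℂ (fun _ => Spinor n ⊗[ℂ] V) u) m =
        phase γ ((rotDual ε μ γ).symm u : Euc n) • twistedRep ε ρ γ (LinearMap.rTensor V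
          (waveProj s ((rotDual ε μ γ).symm u : Euc n))
          ((Pi.single u m : shiftedDualNorm ε μ → Spinor n ⊗[ℂ] V) ((rotDual ε μ γ).symm u))) :=
      fun m => rfl
    have hfix : rot Γ γ (u : Euc n) = u ↔ (rotDual ε μ γ).symm u = u := by
      rw [Equiv.symm_apply_eq, eq_comm, Subtype.ext_iff]
      rfl
    by_cases h : rot Γ γ (u : Euc n) = u
    · rw [if_pos h, ← trace_twistedRep_mul, ← smul_eq_mul (phase γ (u : Euc n)), ← map_smul]
      congr 1
      refine LinearMap.ext fun m => ?_
      rw [happ, hfix.1 h, Pi.single_eq_same]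
      rfl
    · rw [if_neg h]
      convert map_zero (LinearMap.trace ℂ (Spinor n ⊗[ℂ] V))
      refine LinearMap.ext fun m => ?_
      rw [happ, Pi.single_eq_of_ne (mt hfix.2 h), map_zero, map_zero, smul_zero]
      rfl
  rw [trace_pi, Finset.sum_congr rfl fun u _ => hblock u, waveTrace]
  have hset : fixedDual ε μ γ =
      ((shiftedDualNorm ε μ).toFinset.filter fun u => rot Γ γ u = u : Finset (Euc n)) := by
    ext u
    simp [fixedDual]
  rw [hset, finsum_mem_coe_finset, Finset.sum_filter, Finset.mul_sum,
    Finset.sum_subtype _ (fun u => Set.mem_toFinset (s := shiftedDualNorm ε μ))]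
  refine Finset.sum_congr rfl fun u _ => ?_
  rw [mul_ite, mul_zero]
  exact if_congr Iff.rfl (by ring) rfl

/-- It is the trace of an operator that comes from the quotient group. The independence of the
summands from all choices rests on this. -/
theorem waveTrace_eq_of_mk_eq (hΓ : IsBieberbach Γ) (hε : IsSpinStructure ε)
    (hρ : ∀ γ ∈ latt Γ, ρ γ = 1) (μ : ℝ) (s : ℤˣ) {γ γ' : Γ}
    (h : (γ : Γ ⧸ latt Γ) = (γ' : Γ ⧸ latt Γ)) : waveTrace ε ρ μ s γ = waveTrace ε ρ μ s γ' := by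
  have := (hΓ.finite_shiftedDualNorm hε μ).fintype
  have hinj := waveSum_shiftedDualNorm_injective (V := V) hΓ hε μ
  have hT := twistedRep_of_mem_latt hε hρ
  rw [← trace_waveAct_mul_amplitudeProj, ← trace_waveAct_mul_amplitudeProj,
    ← waveRep_mk _ hinj hT, h, waveRep_mk]

theorem card_holonomy (Γ : Subgroup (Isom n)) :
    Nat.card (holonomy Γ) = Nat.card (Γ ⧸ latt Γ) :=
  Nat.card_congr (QuotientGroup.quotientKerEquivRange (rot Γ)).toEquiv.symm

theorem diracEigenspace_eq_map (hΓ : IsBieberbach Γ) (hε : IsSpinStructure ε)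
    (hρ : ∀ γ ∈ latt Γ, ρ γ = 1) (hμ : 0 ≤ μ) (s : ℤˣ) [Fintype (shiftedDualNorm ε μ)]
    (hinj : Function.Injective (waveSum (M := Spinor n ⊗[ℂ] V) (shiftedDualNorm ε μ))) :
    diracEigenspace ε ρ ((s : ℤ) * (2 * Real.pi * μ)) =
      ((waveRep (twistedRep ε ρ) hinj (twistedRep_of_mem_latt hε hρ)).invariants ⊓
        LinearMap.range (amplitudeProj V ε μ s)).map (waveSum (shiftedDualNorm ε μ)) := by
  have hiff : ∀ w, w ∈ ((waveRep (twistedRep ε ρ) hinj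
      (twistedRep_of_mem_latt hε hρ)).invariants ⊓ LinearMap.range (amplitudeProj V ε μ s)) ↔
      waveSum _ w ∈ diracEigenspace ε ρ ((s : ℤ) * (2 * Real.pi * μ)) := fun w => by
    rw [waveSum_mem_diracEigenspace_iff hinj, Submodule.mem_inf, mem_range_amplitudeProj_iff]
    refine and_congr_left' ⟨fun h γ => h (γ : Γ ⧸ latt Γ), fun h q => ?_⟩
    obtain ⟨γ, rfl⟩ := QuotientGroup.mk_surjective q
    exact h γ
  ext f
  constructor
  · intro hf
    obtain ⟨w, rfl⟩ := mem_range_waveSum hΓ hε hρ hμ s hf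
    exact ⟨w, (hiff w).2 hf, rfl⟩
  · rintro ⟨w, hw, rfl⟩
    exact (hiff w).1 hw

theorem finiteDimensional_diracEigenspace (hΓ : IsBieberbach Γ) (hε : IsSpinStructure ε)
    (hρ : ∀ γ ∈ latt Γ, ρ γ = 1) (hμ : 0 ≤ μ) (s : ℤˣ) :
    FiniteDimensional ℂ (diracEigenspace ε ρ ((s : ℤ) * (2 * Real.pi * μ))) := by
  have := (hΓ.finite_shiftedDualNorm hε μ).fintype
  rw [diracEigenspace_eq_map hΓ hε hρ hμ s (waveSum_shiftedDualNorm_injective hΓ hε μ)]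
  infer_instance

theorem finrank_diracEigenspace (hΓ : IsBieberbach Γ) (hε : IsSpinStructure ε)
    (hρ : ∀ γ ∈ latt Γ, ρ γ = 1) (hμ : 0 ≤ μ) (s : ℤˣ) {rep : Γ ⧸ latt Γ → Γ}
    (hrep : ∀ q, (rep q : Γ ⧸ latt Γ) = q) :
    (Module.finrank ℂ (diracEigenspace ε ρ ((s : ℤ) * (2 * Real.pi * μ))) : ℂ) =
      1 / (Nat.card (holonomy Γ) : ℂ) * ∑ᶠ q, waveTrace ε ρ μ s (rep q) := by
  have := (hΓ.finite_shiftedDualNorm hε μ).fintype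
  have := hΓ.finite_quotient
  have := Fintype.ofFinite (Γ ⧸ latt Γ)
  have hinj := waveSum_shiftedDualNorm_injective (V := V) hΓ hε μ
  rw [diracEigenspace_eq_map hΓ hε hρ hμ s hinj,
    ← (Submodule.equivMapOfInjective _ hinj _).finrank_eq,
    finrank_invariants_inf_range _ _ (amplitudeProj_mul_self s) fun q => ?_, card_holonomy,
    finsum_eq_sum_of_fintype]
  · congr 1
    refine Finset.sum_congr rfl fun q _ => ?_
    rw [← trace_waveAct_mul_amplitudeProj, ← waveRep_mk _ hinj (twistedRep_of_mem_latt hε hρ),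
      hrep]
  · obtain ⟨γ, rfl⟩ := QuotientGroup.mk_surjective q
    exact waveAct_mul_amplitudeProj hε γ s

end Multiplicities

/-! ### The multiplicity formulas -/

section Formulas

variable {n : ℕ} {V : Type*} [NormedAddCommGroup V] [InnerProductSpace ℂ V]

theorem phase_eq_one_of_eq_zero {Γ : Subgroup (Isom n)} (γ : Γ) : phase γ 0 = 1 := by
  simp [phase]

theorem waveProj_of_ne_zero (s : ℤˣ) {u : Euc n} (hu : u ≠ 0) : waveProj s u = spinProj s u := by
  rw [waveProj, if_neg hu]

theorem ne_zero_of_mem_fixedDual {Γ : Subgroup (Isom n)} {ε : Γ →* Spin n} {μ : ℝ} (hμ : 0 < μ)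
    {γ : Γ} {u : Euc n} (hu : u ∈ fixedDual ε μ γ) : u ≠ 0 := by
  rintro rfl
  have h := hu.1.2
  rw [norm_zero] at h
  exact hμ.ne h

theorem expSum_mul {Γ : Subgroup (Isom n)} (ε : Γ →* Spin n) (μ : ℝ) (γ : Γ) (c : ℂ) :
    expSum ε μ γ * c = ∑ᶠ u ∈ fixedDual ε μ γ, phase γ u * c := by
  rw [expSum, finsum_mem_mul]

variable {N : ℕ} {Γ : Subgroup (Isom (N + 1))} {ε : Γ →* Spin (N + 1)}
variable {ρ : Representation ℂ Γ V} {μ : ℝ}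

theorem evenSummand_eq_waveTrace (hμ : 0 < μ)
    (hN : Even (N + 1)) (s : ℤˣ) {γ : Γ} {x : Spin N} (h : IsTorusRep (ε γ) x) :
    evenSummand ε ρ μ γ x = waveTrace ε ρ μ s γ := by
  rw [evenSummand, waveTrace, mul_assoc, expSum_mul]
  congr 1
  refine finsum_mem_congr rfl fun u hu => ?_
  rw [waveProj_of_ne_zero s (ne_zero_of_mem_fixedDual hμ hu), h.trace_mul_spinProj_of_even hN]

theorem oddSummand_eq_waveTrace (hε : IsSpinStructure ε) (hμ : 0 < μ)
    (hN : Even N) (s : ℤˣ) {γ : Γ} {x : Spin N} (h : IsTorusRep (ε γ) x)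
    (hγ : rot Γ γ ∉ holonomyOne Γ) : oddSummand ε ρ hN μ s γ x = waveTrace ε ρ μ s γ := by
  have hfix : fixDim (rot Γ γ) ≠ 1 := fun h1 => hγ ⟨⟨γ, rfl⟩, h1⟩
  rw [oddSummand, waveTrace, mul_assoc, expSum_mul]
  congr 1
  refine finsum_mem_congr rfl fun u hu => ?_
  have hu0 := ne_zero_of_mem_fixedDual hμ hu
  rw [waveProj_of_ne_zero s hu0,
    h.trace_mul_spinProj_of_fixDim_ne_one hN s hu0 (hε.mul_vec γ) hu.2 hfix]

theorem oddSummandOne_eq_waveTrace (hε : IsSpinStructure ε) (hμ : 0 < μ)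
    (hN : Even N) (s : ℤˣ) {γ : Γ} {x : Spin N} (h : IsTorusRep (ε γ) x)
    (hγ : rot Γ γ ∈ holonomyOne Γ) : oddSummandOne ε ρ hN μ s γ x = waveTrace ε ρ μ s γ := by
  rw [oddSummandOne, waveTrace]
  congr 1
  refine finsum_mem_congr rfl fun u hu => ?_
  have hu0 := ne_zero_of_mem_fixedDual hμ hu
  rw [waveProj_of_ne_zero s hu0,
    h.trace_mul_spinProj_of_fixDim_eq_one hN s hu0 (hε.mul_vec γ) hu.2 hγ.2]

theorem rot_eq_of_mk_eq {γ γ' : Γ} (h : (γ : Γ ⧸ latt Γ) = (γ' : Γ ⧸ latt Γ)) :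
    rot Γ γ = rot Γ γ' := by
  have h1 := (rot Γ).mem_ker.1 (QuotientGroup.eq.1 h)
  rw [map_mul, map_inv, inv_mul_eq_one] at h1
  exact h1

end Formulas

/-! ### Lattice vectors on which the spin structure is non-trivial -/

section Factors

variable {n : ℕ} {Γ : Subgroup (Isom n)} {ε : Γ →* Spin n} {μ : ℝ}

theorem phase_of_mem_latt {γ : Γ} (hγ : γ ∈ latt Γ) (h : ε γ ≠ 1) {u : Euc n}
    (hu : u ∈ shiftedDual ε) : phase γ u = -1 := by
  have h1 := planeWave_transl_of_mem_shiftedDual hu hγ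
  rw [delta, if_neg h, planeWave] at h1
  rw [phase, Complex.exp_neg, h1]
  norm_num

theorem fixedDual_of_mem_latt {γ : Γ} (hγ : γ ∈ latt Γ) :
    fixedDual ε μ γ = shiftedDualNorm ε μ := by
  ext u
  refine and_iff_left ?_
  rw [(rot Γ).mem_ker.1 hγ]
  rfl

/-- All phases are `1` for the identity and `-1` for `γ`, so the sums are opposite and nonzero. -/
theorem expSum_one_ne_expSum (hΓ : IsBieberbach Γ) (hε : IsSpinStructure ε) {γ : Γ}
    (hγ : γ ∈ latt Γ) (h : ε γ ≠ 1) (hne : (shiftedDualNorm ε μ).Nonempty) :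
    expSum ε μ 1 ≠ expSum ε μ γ := by
  have hf := hΓ.finite_shiftedDualNorm hε μ
  have h1 : expSum ε μ 1 = (hf.toFinset.card : ℂ) := by
    rw [expSum, fixedDual_of_mem_latt (one_mem _), finsum_mem_eq_finite_toFinset_sum _ hf,
      Finset.card_eq_sum_ones, Nat.cast_sum]
    refine Finset.sum_congr rfl fun u _ => ?_
    have : transl (1 : Γ) = 0 := by
      rw [← isom_zero_of_mem_latt (one_mem _)]
      rfl
    simp [phase, this]
  have h2 : expSum ε μ γ = -(hf.toFinset.card : ℂ) := by
    rw [expSum, fixedDual_of_mem_latt hγ, finsum_mem_eq_finite_toFinset_sum _ hf,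
      Finset.card_eq_sum_ones, Nat.cast_sum, ← Finset.sum_neg_distrib]
    refine Finset.sum_congr rfl fun u hu => ?_
    rw [phase_of_mem_latt hγ h (hf.mem_toFinset.1 hu).1, Nat.cast_one]
  rw [h1, h2]
  intro h3
  have h4 : (hf.toFinset.card : ℂ) = 0 := by linear_combination h3 / 2
  rw [Nat.cast_eq_zero, Finset.card_eq_zero, Set.Finite.toFinset_eq_empty] at h4
  exact hne.ne_empty h4

end Factors

/-! ### Harmonic spinors -/

section Harmonic

variable {n : ℕ} {Γ : Subgroup (Isom n)} {ε : Γ →* Spin n}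
variable {V : Type*} [NormedAddCommGroup V] [InnerProductSpace ℂ V] [FiniteDimensional ℂ V]
variable {ρ : Representation ℂ Γ V}

theorem unit_mul_zero_eigenvalue :
    (((1 : ℤˣ) : ℤ) : ℂ) * (2 * Real.pi * ((0 : ℝ) : ℂ)) = 0 := by simp

/-- The only possible frequency is `0`, and it is not in `Λ*_ε` when `ε` is non-trivial on the
lattice. -/
theorem diracEigenspace_zero_eq_bot (hΓ : IsBieberbach Γ) (hε : IsSpinStructure ε)
    (hρ : ∀ γ ∈ latt Γ, ρ γ = 1) (h : ∃ γ ∈ latt Γ, ε γ ≠ 1) : diracEigenspace ε ρ 0 = ⊥ := by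
  obtain ⟨γ, hγ, hne⟩ := h
  have hempty : IsEmpty (shiftedDualNorm ε 0) := ⟨fun u => by
    have h0 : (u : Euc n) = 0 := norm_eq_zero.1 u.2.2
    have h1 := phase_of_mem_latt hγ hne u.2.1
    rw [h0, phase_eq_one_of_eq_zero] at h1
    norm_num at h1⟩
  have := (hΓ.finite_shiftedDualNorm hε 0).fintype
  rw [eq_bot_iff]
  intro f hf
  rw [← unit_mul_zero_eigenvalue] at hf
  obtain ⟨w, rfl⟩ := mem_range_waveSum hΓ hε hρ le_rfl 1 hf
  rw [Submodule.mem_bot]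
  ext1 x
  rw [waveSum_apply, Finset.univ_eq_empty, Finset.sum_empty]
  rfl

/-- Here `0` is the only frequency, with phase `1` and the identity as projection. -/
theorem waveTrace_zero (hΛ : ∀ γ ∈ latt Γ, ε γ = 1) (γ : Γ) :
    waveTrace ε ρ 0 1 γ = ρ.character γ * (spinRep n).character (ε γ) := by
  have hset : fixedDual ε 0 γ = {0} := by
    ext u
    refine ⟨fun hu => norm_eq_zero.1 hu.1.2, ?_⟩
    rintro rfl
    refine ⟨⟨fun γ' => ?_, norm_zero⟩, map_zero _⟩
    rw [delta, if_pos (hΛ γ'.1 γ'.2)]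
    simp
  rw [waveTrace, hset, finsum_mem_singleton, phase_eq_one_of_eq_zero, one_mul, waveProj,
    if_pos rfl, mul_one]
  rfl

theorem finrank_holonomyRep_invariants (hΓ : IsBieberbach Γ) (hρ : ∀ γ ∈ latt Γ, ρ γ = 1)
    (hΛ : ∀ γ ∈ latt Γ, ε γ = 1) {rep : Γ ⧸ latt Γ → Γ} (hrep : ∀ q, (rep q : Γ ⧸ latt Γ) = q) :
    (Module.finrank ℂ (holonomyRep ε ρ hΛ hρ).invariants : ℂ) =
      1 / (Nat.card (holonomy Γ) : ℂ) *
        ∑ᶠ q, ρ.character (rep q) * (spinRep n).character (ε (rep q)) := by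
  have := hΓ.finite_quotient
  have := Fintype.ofFinite (Γ ⧸ latt Γ)
  have h := finrank_invariants_inf_range (holonomyRep ε ρ hΛ hρ) 1 (one_mul 1)
    fun g => by rw [mul_one, one_mul]
  have h1 : LinearMap.range (1 : Module.End ℂ (Spinor n ⊗[ℂ] V)) = ⊤ := LinearMap.range_id
  rw [h1, inf_top_eq] at h
  rw [h, card_holonomy, finsum_eq_sum_of_fintype]
  congr 1
  refine Finset.sum_congr rfl fun q _ => ?_
  have h2 : holonomyRep ε ρ hΛ hρ q =
      TensorProduct.map (spinRep n (ε (rep q))) (ρ (rep q)) := by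
    conv_lhs => rw [← hrep q]
    rfl
  rw [mul_one, h2, LinearMap.trace_tensorProduct', mul_comm]
  rfl

end Harmonic

end FlatDirac

end

/-! ### The multiplicity theorem -/

open FlatDirac in
theorem theorem2p5 (N : ℕ) (Γ : Subgroup (Isom (N + 1))) (hΓ : IsBieberbach Γ)
    (ε : Γ →* Spin (N + 1)) (hε : IsSpinStructure ε)
    {V : Type*} [NormedAddCommGroup V] [InnerProductSpace ℂ V] [FiniteDimensional ℂ V]
    (ρ : Representation ℂ Γ V) (hunitary : ∀ γ v w, inner ℂ (ρ γ v) (ρ γ w) = inner ℂ v w)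
    (hρ : ∀ γ ∈ latt Γ, ρ γ = 1) :
    Finite (Γ ⧸ latt Γ) ∧
    -- the elements `x_γ` exist (if `N ≤ 1` then `F` is trivial and `1` is a representative)
    (2 ≤ N → ∀ γ : Γ, ∃ x : Spin N, IsTorusRep (ε γ) x) ∧
    (∀ μ : ℝ, 0 < μ →
      -- the sums over `u` and the multiplicities are finite
      (shiftedDualNorm ε μ).Finite ∧
      (∀ s : ℤˣ, FiniteDimensional ℂ (diracEigenspace ε ρ ((s : ℤ) * (2 * Real.pi * μ)))) ∧
      -- the multiplicity formulas, for all representatives of `Λ \ Γ` and all choices of `x_γ`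
      (∀ (rep : Γ ⧸ latt Γ → Γ) (x : Γ ⧸ latt Γ → Spin N),
        (∀ q, (rep q : Γ ⧸ latt Γ) = q) → (∀ q, IsTorusRep (ε (rep q)) (x q)) →
        (Even (N + 1) → ∀ s : ℤˣ,
          (Module.finrank ℂ (diracEigenspace ε ρ ((s : ℤ) * (2 * Real.pi * μ))) : ℂ) =
            1 / (Nat.card (holonomy Γ) : ℂ) * ∑ᶠ q, evenSummand ε ρ μ (rep q) (x q)) ∧
        (∀ (hN : Even N) (s : ℤˣ),
          (Module.finrank ℂ (diracEigenspace ε ρ ((s : ℤ) * (2 * Real.pi * μ))) : ℂ) =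
            1 / (Nat.card (holonomy Γ) : ℂ) *
              ((∑ᶠ q ∈ {q | rot Γ (rep q) ∉ holonomyOne Γ},
                  oddSummand ε ρ hN μ s (rep q) (x q)) +
                (∑ᶠ q ∈ {q | rot Γ (rep q) ∈ holonomyOne Γ},
                  oddSummandOne ε ρ hN μ s (rep q) (x q))))) ∧
      -- the summands do not depend on the representative, nor on the choice of `x_γ`
      (∀ (γ γ' : Γ) (x x' : Spin N), (γ : Γ ⧸ latt Γ) = (γ' : Γ ⧸ latt Γ) →
        IsTorusRep (ε γ) x → IsTorusRep (ε γ') x' →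
        (Even (N + 1) → evenSummand ε ρ μ γ x = evenSummand ε ρ μ γ' x') ∧
        (∀ (hN : Even N) (s : ℤˣ),
          (rot Γ γ ∉ holonomyOne Γ → oddSummand ε ρ hN μ s γ x = oddSummand ε ρ hN μ s γ' x') ∧
          (rot Γ γ ∈ holonomyOne Γ →
            oddSummandOne ε ρ hN μ s γ x = oddSummandOne ε ρ hN μ s γ' x'))) ∧
      -- the individual factors do depend on the representative in general
      ((∃ γ ∈ latt Γ, ε γ ≠ 1) → (shiftedDualNorm ε μ).Nonempty →
        ∃ γ γ' : Γ, (γ : Γ ⧸ latt Γ) = (γ' : Γ ⧸ latt Γ) ∧ expSum ε μ γ ≠ expSum ε μ γ' ∧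
          ∀ x x' : Spin N, IsTorusRep (ε γ) x → IsTorusRep (ε γ') x' →
            (spinRep N).character x ≠ (spinRep N).character x')) ∧
    -- for odd `n ≥ 3` they also depend on the choice of `x_γ`
    (∀ hN : Even N, 0 < N → ∀ (γ : Γ) (x : Spin N), rot Γ γ ∈ holonomyOne Γ →
      IsTorusRep (ε γ) x → ∃ x' : Spin N, IsTorusRep (ε γ) x' ∧
        ∀ s : ℤˣ, (halfSpinRep N hN s).character x ≠ (halfSpinRep N hN s).character x') ∧
    -- harmonic spinors
    ((∃ γ ∈ latt Γ, ε γ ≠ 1) → diracEigenspace ε ρ 0 = ⊥) ∧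
    (∀ hΛ : ∀ γ ∈ latt Γ, ε γ = 1,
      FiniteDimensional ℂ (diracEigenspace ε ρ 0) ∧
      (∀ rep : Γ ⧸ latt Γ → Γ, (∀ q, (rep q : Γ ⧸ latt Γ) = q) →
        (Module.finrank ℂ (diracEigenspace ε ρ 0) : ℂ) =
          1 / (Nat.card (holonomy Γ) : ℂ) *
            ∑ᶠ q, ρ.character (rep q) * (spinRep (N + 1)).character (ε (rep q))) ∧
      Module.finrank ℂ (diracEigenspace ε ρ 0) =
        Module.finrank ℂ (holonomyRep ε ρ hΛ hρ).invariants) := by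
  have hrep_sum : ∀ {μ : ℝ} (_ : 0 < μ) (s : ℤˣ) {rep : Γ ⧸ latt Γ → Γ}
      (_ : ∀ q, (rep q : Γ ⧸ latt Γ) = q),
      (Module.finrank ℂ (diracEigenspace ε ρ ((s : ℤ) * (2 * Real.pi * μ))) : ℂ) =
        1 / (Nat.card (holonomy Γ) : ℂ) * ∑ᶠ q, waveTrace ε ρ μ s (rep q) :=
    fun hμ s _ hrep => finrank_diracEigenspace hΓ hε hρ hμ.le s hrep
  have hfin := hΓ.finite_quotient
  refine ⟨hfin, fun hN γ => ?_, fun μ hμ => ⟨hΓ.finite_shiftedDualNorm hε μ,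
    fun s => finiteDimensional_diracEigenspace hΓ hε hρ hμ.le s, fun rep x hrep hx =>
      ⟨fun hN s => ?_, fun hN s => ?_⟩, fun γ γ' x x' h hx hx' =>
      ⟨fun hN => ?_, fun hN s => ⟨fun hγ => ?_, fun hγ => ?_⟩⟩, ?_⟩, ?_,
    diracEigenspace_zero_eq_bot hΓ hε hρ, fun hΛ => ?_⟩
  · obtain ⟨u, hu, hBu⟩ := hΓ.exists_fixed γ
    exact exists_isTorusRep hN (ε γ) (rot Γ γ) (hε.mul_vec γ) hu hBu
  · rw [hrep_sum hμ s hrep]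
    congr 1
    exact finsum_congr fun q => (evenSummand_eq_waveTrace hμ hN s (hx q)).symm
  · rw [hrep_sum hμ s hrep]
    congr 1
    have hF := Set.toFinite {q | rot Γ (rep q) ∉ holonomyOne Γ}
    have hF' := Set.toFinite {q | rot Γ (rep q) ∈ holonomyOne Γ}
    have hunion : {q | rot Γ (rep q) ∉ holonomyOne Γ} ∪ {q | rot Γ (rep q) ∈ holonomyOne Γ} =
        Set.univ := Set.compl_union_self {q | rot Γ (rep q) ∈ holonomyOne Γ}
    have hsum : ∑ᶠ q ∈ {q | rot Γ (rep q) ∉ holonomyOne Γ}, oddSummand ε ρ hN μ s (rep q) (x q) =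
        ∑ᶠ q ∈ {q | rot Γ (rep q) ∉ holonomyOne Γ}, waveTrace ε ρ μ s (rep q) :=
      finsum_mem_congr rfl fun q hq => oddSummand_eq_waveTrace hε hμ hN s (hx q) hq
    have hsum' : ∑ᶠ q ∈ {q | rot Γ (rep q) ∈ holonomyOne Γ},
        oddSummandOne ε ρ hN μ s (rep q) (x q) =
        ∑ᶠ q ∈ {q | rot Γ (rep q) ∈ holonomyOne Γ}, waveTrace ε ρ μ s (rep q) :=
      finsum_mem_congr rfl fun q hq => oddSummandOne_eq_waveTrace hε hμ hN s (hx q) hq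
    have hdisj : Disjoint {q | rot Γ (rep q) ∉ holonomyOne Γ}
        {q | rot Γ (rep q) ∈ holonomyOne Γ} := disjoint_compl_left
    rw [hsum, hsum', ← finsum_mem_union hdisj hF hF', hunion, finsum_mem_univ]
  -- For even `n` the trace does not depend on the sign of the eigenvalue, so the sign `1` is an
  -- arbitrary choice.
  · rw [evenSummand_eq_waveTrace hμ hN 1 hx, evenSummand_eq_waveTrace hμ hN 1 hx',
      waveTrace_eq_of_mk_eq hΓ hε hρ μ 1 h]
  · rw [oddSummand_eq_waveTrace hε hμ hN s hx hγ, oddSummand_eq_waveTrace hε hμ hN s hx'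
      (rot_eq_of_mk_eq h ▸ hγ), waveTrace_eq_of_mk_eq hΓ hε hρ μ s h]
  · rw [oddSummandOne_eq_waveTrace hε hμ hN s hx hγ, oddSummandOne_eq_waveTrace hε hμ hN s hx'
      (rot_eq_of_mk_eq h ▸ hγ), waveTrace_eq_of_mk_eq hΓ hε hρ μ s h]
  · rintro ⟨γ, hγ, hne⟩ hU
    -- Both elements lie in the trivial class, with `ε` equal to `1` and to `-1`.
    refine ⟨1, γ, ?_, expSum_one_ne_expSum hΓ hε hγ hne hU, fun x x' hx hx' => ?_⟩
    · rw [QuotientGroup.eq, inv_one, one_mul]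
      exact hγ
    · refine character_ne_of_eq_one_of_eq_neg_one hx hx' (by rw [map_one]; rfl) ?_
      exact (hε.latt_eq hγ).resolve_left fun h => hne (Subtype.ext h)
  · intro hN hpos γ x hγ hx
    exact exists_isTorusRep_character_ne hN hpos hx (hε.mul_vec γ) hγ.2
  · have hzero := unit_mul_zero_eigenvalue
    have hformula : ∀ rep : Γ ⧸ latt Γ → Γ, (∀ q, (rep q : Γ ⧸ latt Γ) = q) →
        (Module.finrank ℂ (diracEigenspace ε ρ 0) : ℂ) = 1 / (Nat.card (holonomy Γ) : ℂ) *
          ∑ᶠ q, ρ.character (rep q) * (spinRep (N + 1)).character (ε (rep q)) := by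
      intro rep hrep
      have h := finrank_diracEigenspace hΓ hε hρ le_rfl 1 hrep
      rw [hzero] at h
      rw [h]
      congr 1
      exact finsum_congr fun q => waveTrace_zero hΛ _
    refine ⟨?_, hformula, ?_⟩
    · have h := finiteDimensional_diracEigenspace hΓ hε hρ (le_refl (0 : ℝ)) 1
      rwa [hzero] at h
    · obtain ⟨rep, hrep⟩ := QuotientGroup.mk_surjective (s := latt Γ) |>.hasRightInverse
      have h := (hformula rep hrep).trans (finrank_holonomyRep_invariants hΓ hρ hΛ hrep).symm
      exact_mod_cast h
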